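/- **Setting.** A network is a finite simple connected graph $G=(V,L)$ with at least two nodes. Each link $l\in L$ carries an unknown real metric $W_l$; the metric of a path is the sum of the metrics of its links. For a set $M\subseteq V$ of monitors (a placement), one measures the metrics of all simple paths of $G$ between two distinct monitors. A link metric is *identifiable* under $M$ if these measurements determine it uniquely. **Components.** A graph is $k$-vertex-connected if it has more than $k$ nodes and stays connected after deletion of any fewer than $k$ nodes. The *biconnected components* of $G$ are its maximal subgraphs that are 2-vertex-connected or complete with at most two nodes. A partition of a biconnected component $B$ into *triconnected components* is obtained by splitting: a graph that is 3-vertex-connected or complete with at most three nodes is its own only component; otherwise one chooses a 2-vertex cut $\{a,b\}$, divides the graph into two sides which share exactly $a,b$, each having further nodes, with no link between nodes of different sides outside $\{a,b\}$, adds the (possibly virtual) link $ab$ to both sides, and partitions both sides further. For a biconnected component $B$ let $c_B$ be the number of cut-vertices of $G$ in $B$, and $M_B$ the number of current monitors in $B$ that are not cut-vertices of $G$. The *separation vertices* of $B$ are the nodes of $B$ that are cut-vertices of $G$ or belong to a 2-vertex cut of $B$. For a triconnected component $T$ of $B$ let $s_T$ be the number of separation vertices of $B$ in $T$, and $M_T$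 the number of current monitors in $T$ that are not separation vertices. **Algorithm MMP.** 1. Choose all nodes of degree less than 3 as monitors. 2. For each biconnected component $B$ with $|B|\ge 3$ (in any order): partition $B$ into triconnected components; for each triconnected component $T$ with $|T|\ge 3$ (in any order), if $0<s_T<3$ and $s_T+M_T<3$, choose $3-s_T-M_T$ arbitrary nodes of $T$ that are neither separation vertices nor monitors as monitors; then, if $0<c_B<3$ and $c_B+M_B<3$, choose $3-c_B-M_B$ arbitrary nodes of $B$ that are neither cut-vertices nor monitors as monitors. 3. If the total number $K$ of monitors is less than 3, choose $3-K$ arbitrary non-monitor nodes as monitors (all of them, if there are fewer). **Theorem 1.** For every connected network $G$ with at least two nodes, Algorithm MMP produces a placement, and every placement it can produce (whatever the arbitrary choices, the orders and the partitions) is optimal: (1) all link metrics of $G$ are identifiable under it, and (2) no placement with fewer monitors identifies all link metrics of $G$. -/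

import Mathlib

namespace MonitorPlacement

/-! ## Measurements and identifiability

A network is a finite simple graph `G`; its edges are the links.  Link metrics are real numbers
attached to the links, and only the values on `G.edgeSet` ever matter. -/

/-- The metric of a path: the sum of the metrics of its links. -/
def pathMetric {V : Type*} {G : SimpleGraph V} (w : Sym2 V → ℝ) {u v : V} (p : G.Walk u v) : ℝ :=
  (p.edges.map w).sum

/-- Two assignments of link metrics that give the same end-to-end measurement on every simple path
between two distinct monitors. -/
def SameMeasurements {V : Type*} (G : SimpleGraph V) (M : Finset V) (w w' : Sym2 V → ℝ) : Prop :=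
  ∀ u ∈ M, ∀ v ∈ M, u ≠ v → ∀ p : G.Walk u v, p.IsPath → pathMetric w p = pathMetric w' p

/-- The metric of the link `e` is uniquely determined by the measurements between monitors. -/
def LinkIdentifiable {V : Type*} (G : SimpleGraph V) (M : Finset V) (e : Sym2 V) : Prop :=
  ∀ w w' : Sym2 V → ℝ, SameMeasurements G M w w' → w e = w' e

/-- The placement `M` identifies all link metrics. -/
def IdentifiesAllLinks {V : Type*} (G : SimpleGraph V) (M : Finset V) : Prop :=
  ∀ e ∈ G.edgeSet, LinkIdentifiable G M e

/-! ## Biconnected and triconnected components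

A vertex set `U` stands for the subgraph of the ambient graph induced on `U`. -/

/-- The subgraph of `H` induced on `U` is `k`-vertex-connected: it has more than `k` nodes and
stays connected after the deletion of fewer than `k` nodes. -/
def VertexConnectedOn {V : Type*} [DecidableEq V] (H : SimpleGraph V) (k : ℕ) (U : Finset V) :
    Prop :=
  k < U.card ∧ ∀ S : Finset V, S ⊆ U → S.card < k →
    (H.induce ((U \ S : Finset V) : Set V)).Connected

/-- The subgraph of `H` induced on `U` is `k`-vertex-connected or a complete graph with at least
one and at most `k` nodes. -/
def IsConnectedPiece {V : Type*} [DecidableEq V] (H : SimpleGraph V) (k : ℕ) (U : Finset V) :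
    Prop :=
  VertexConnectedOn H k U ∨ (U.Nonempty ∧ U.card ≤ k ∧ H.IsClique (U : Set V))

/-- Biconnected components (blocks): the maximal subgraphs that are 2-vertex-connected or complete
with at most two nodes.  Such a maximal subgraph is induced, so it is given by its nodes. -/
def IsBiconnectedComponent {V : Type*} [DecidableEq V] (G : SimpleGraph V) (B : Finset V) : Prop :=
  Maximal (IsConnectedPiece G 2) B

/-- `TriconnectedPartition H U D`: `D` is the collection of the node sets of the triconnected
components in a partition of the subgraph of `H` induced on `U`.  A graph which is
3-vertex-connected or complete with at most three nodes is its own only triconnected component.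
Otherwise it is split along a 2-vertex cut `{a, b}` into two sides that share exactly `a` and `b`,
the (possibly virtual) link `ab` is present in both sides, and both sides are partitioned
further. -/
inductive TriconnectedPartition {V : Type*} [DecidableEq V] :
    SimpleGraph V → Finset V → Multiset (Finset V) → Prop
  | piece (H : SimpleGraph V) (U : Finset V) (hU : IsConnectedPiece H 3 U) :
      TriconnectedPartition H U {U}
  | split (H : SimpleGraph V) (U₁ U₂ : Finset V) (a b : V) (D₁ D₂ : Multiset (Finset V))
      (hab : a ≠ b) (hinter : U₁ ∩ U₂ = {a, b})
      (h₁ : (U₁ \ U₂).Nonempty) (h₂ : (U₂ \ U₁).Nonempty)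
      (hsep : ∀ x ∈ U₁ \ U₂, ∀ y ∈ U₂ \ U₁, ¬ H.Adj x y)
      (hD₁ : TriconnectedPartition (H ⊔ SimpleGraph.edge a b) U₁ D₁)
      (hD₂ : TriconnectedPartition (H ⊔ SimpleGraph.edge a b) U₂ D₂) :
      TriconnectedPartition H (U₁ ∪ U₂) (D₁ + D₂)

/-- `v` is a cut-vertex of (the connected graph) `G`. -/
def IsCutVertex {V : Type*} (G : SimpleGraph V) (v : V) : Prop :=
  ¬ (G.induce ({v}ᶜ : Set V)).Preconnected

/-- `{a, b}` is a 2-vertex cut of the subgraph of `G` induced on `B`. -/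
def IsTwoVertexCut {V : Type*} [DecidableEq V] (G : SimpleGraph V) (B : Finset V) (a b : V) :
    Prop :=
  a ∈ B ∧ b ∈ B ∧ a ≠ b ∧ ¬ (G.induce ((B \ {a, b} : Finset V) : Set V)).Preconnected

open Classical in
/-- The cut-vertices of `G`. -/
noncomputable def cutVertices {V : Type*} [Fintype V] (G : SimpleGraph V) : Finset V :=
  Finset.univ.filter (IsCutVertex G)

open Classical in
/-- The separation vertices of `G` inside the biconnected component `B`: the nodes of `B` that are
cut-vertices of `G` or belong to a 2-vertex cut of `B`. -/
noncomputable def separationVertices {V : Type*} [DecidableEq V] (G : SimpleGraph V)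
    (B : Finset V) : Finset V :=
  B.filter fun v => IsCutVertex G v ∨ ∃ u, IsTwoVertexCut G B v u

/-! ## The algorithm MMP

Every step is a relation between the set `M` of monitors before it and the set `M'` after it; the
relation leaves open the random choices and the order in which components are visited. -/

/-- Choose `k` arbitrary nodes of `A` that are not yet monitors as monitors (all such nodes, if
there are fewer than `k` of them). -/
def AddMonitors {V : Type*} [DecidableEq V] (A : Finset V) (k : ℕ) (M M' : Finset V) : Prop :=
  ∃ N : Finset V, N ⊆ A \ M ∧ N.card = min k (A \ M).card ∧ M' = M ∪ N

/-- If the component with node set `C` has at least one and at most two of its nodes in `S` and,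
together with its monitors outside `S`, fewer than three, then add the missing number of monitors
among the nodes of `C` outside `S`; otherwise do nothing. -/
def CompleteComponent {V : Type*} [DecidableEq V] (C S : Finset V) (M M' : Finset V) : Prop :=
  if 0 < (C ∩ S).card ∧ (C ∩ S).card < 3 ∧ (C ∩ S).card + ((C ∩ M) \ S).card < 3 then
    AddMonitors (C \ S) (3 - (C ∩ S).card - ((C ∩ M) \ S).card) M M'
  else M' = M

/-- Carry out the step for all entries of a list, one after the other. -/
inductive ForEach {α σ : Type*} (step : α → σ → σ → Prop) : List α → σ → σ → Prop
  | nil (M : σ) : ForEach step [] M M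
  | cons (x : α) (l : List α) (M M₁ M₂ : σ) (h : step x M M₁) (hl : ForEach step l M₁ M₂) :
      ForEach step (x :: l) M M₂

/-- The step for a triconnected component `T` of the biconnected component `B`. -/
def TriconnectedStep {V : Type*} [DecidableEq V] (G : SimpleGraph V) (B : Finset V)
    (T : Finset V) (M M' : Finset V) : Prop :=
  if 3 ≤ T.card then CompleteComponent T (separationVertices G B) M M' else M' = M

/-- The step for a biconnected component `B`: partition `B` into triconnected components, treat
them in some order, then treat `B` itself. -/
def BiconnectedStep {V : Type*} [Fintype V] [DecidableEq V] (G : SimpleGraph V)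
    (B : Finset V) (M M' : Finset V) : Prop :=
  if 3 ≤ B.card then
    ∃ (l : List (Finset V)) (M₁ : Finset V), TriconnectedPartition G B (l : Multiset (Finset V)) ∧
      ForEach (TriconnectedStep G B) l M M₁ ∧ CompleteComponent B (cutVertices G) M₁ M'
  else M' = M

open Classical in
/-- The nodes of degree less than three. -/
noncomputable def lowDegreeNodes {V : Type*} [Fintype V] (G : SimpleGraph V) : Finset V :=
  Finset.univ.filter fun v => G.degree v < 3

/-- `M` is the output of some run of the algorithm MMP on `G`: start with the nodes of degree less
than three, treat the biconnected components in some order, and finally add arbitrary nodes until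
there are three monitors. -/
def IsMMPOutput {V : Type*} [Fintype V] [DecidableEq V] (G : SimpleGraph V) (M : Finset V) : Prop :=
  ∃ (l : List (Finset V)) (M₁ : Finset V), l.Nodup ∧
    (∀ B : Finset V, B ∈ l ↔ IsBiconnectedComponent G B) ∧
    ForEach (BiconnectedStep G) l (lowDegreeNodes G) M₁ ∧
    (if M₁.card < 3 then AddMonitors Finset.univ (3 - M₁.card) M₁ M else M = M₁)

end MonitorPlacement

/-! The boundary of a node set `A` consists of the nodes outside `A` that have a neighbour in `A`.
Everything rests on one criterion: a placement `M` identifies all link metrics if and only if every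
nonempty `A` disjoint from `M` has at least three boundary nodes.

Necessity (`IdentifiesAllLinks.three_le_card_boundary`): if the boundary of `A` is contained in `{p,
q}`, put 1 on the links from `A` to `p`, -1 on those from `A` to `q` and 0 elsewhere. A simple path
between nodes outside `A` that visits `A` enters at one of `p`, `q` and leaves at the other, so no
measurement sees this assignment.

Sufficiency (`identifiesAllLinks_of_boundary`): the difference of two assignments with equal
measurements vanishes on all paths between monitors, and `Vanishes.eq_zero` shows that it vanishes
on the links. That theorem is an induction on the set `U` of inner nodes, made possible by letting
outer nodes share colours: only paths between different colours are known to vanish, and every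
nonempty subset of `U` must have three boundary colours. Three paths from one node that share only
this node and end at different colours have pairwise sums zero, so each weighs zero; the Menger-type
theorem `exists_linkage` supplies such fans. The set `U` shrinks by recolouring a node, by splitting
along a subset with exactly three boundary colours, or by releasing a cut node.

Correctness of the algorithm (`three_le_card_boundary_of_isComplete`): let `A` be a smallest set
violating the criterion and `F` its boundary. Minimality makes `A ∪ F` 2-connected and keeps
cut-vertices out of `A`. Either `A ∪ F` is a whole block, or it is a triconnected component in every
partition of its block, meeting the separation vertices exactly in `F`. In both cases the algorithm
would have placed a monitor in `A`.

Optimality (`IsMMPOutput.card_le`): for a component `C` with separating nodes `S`, the boundary of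
`C \ S` lies in `C ∩ S`, so the criterion forces every identifying placement to satisfy the demand
served by the corresponding step. The sets `C \ S` are disjoint for different blocks, and inside a
block the sets of its triconnected components are disjoint. Hence monitors can be exchanged within
each `C \ S`, and the run always stays inside a placement as large as the given competitor. -/

namespace MonitorPlacement

/-! ## Vertex boundaries and paths given by their interior nodes -/

section Paths

variable {V : Type*}

/-- `l` lists the interior nodes of a walk from `a` to `b`. -/
def Joined (H : SimpleGraph V) : V → List V → V → Prop
  | a, [], b => H.Adj a b
  | a, x :: l, b => H.Adj a x ∧ Joined H x l b

/-- The weight of the walk from `a` to `b` with interior nodes `l`. -/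
def chainWeight (w : Sym2 V → ℝ) : V → List V → V → ℝ
  | a, [], b => w s(a, b)
  | a, x :: l, b => w s(a, x) + chainWeight w x l b

@[simp] lemma joined_nil {H : SimpleGraph V} {a b : V} : Joined H a [] b ↔ H.Adj a b := Iff.rfl

@[simp] lemma joined_cons {H : SimpleGraph V} {a b x : V} {l : List V} :
    Joined H a (x :: l) b ↔ H.Adj a x ∧ Joined H x l b := Iff.rfl

@[simp] lemma chainWeight_nil {w : Sym2 V → ℝ} {a b : V} : chainWeight w a [] b = w s(a, b) := rfl

@[simp] lemma chainWeight_cons {w : Sym2 V → ℝ} {a b x : V} {l : List V} :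
    chainWeight w a (x :: l) b = w s(a, x) + chainWeight w x l b := rfl

@[simp] lemma joined_append {H : SimpleGraph V} {a b x : V} {l l' : List V} :
    Joined H a (l ++ x :: l') b ↔ Joined H a l x ∧ Joined H x l' b := by
  induction l generalizing a with
  | nil => simp
  | cons y l ih => simp [ih, and_assoc]

@[simp] lemma chainWeight_append {w : Sym2 V → ℝ} {a b x : V} {l l' : List V} :
    chainWeight w a (l ++ x :: l') b = chainWeight w a l x + chainWeight w x l' b := by
  induction l generalizing a with
  | nil => simp
  | cons y l ih => simp [ih, add_assoc]

@[simp] lemma joined_reverse {H : SimpleGraph V} {a b : V} {l : List V} :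
    Joined H a l.reverse b ↔ Joined H b l a := by
  induction l generalizing b with
  | nil => simp [H.adj_comm]
  | cons y l ih => simp [ih, H.adj_comm, and_comm]

@[simp] lemma chainWeight_reverse {w : Sym2 V → ℝ} {a b : V} {l : List V} :
    chainWeight w a l.reverse b = chainWeight w b l a := by
  induction l generalizing b with
  | nil => simp [Sym2.eq_swap]
  | cons y l ih => simp [ih, Sym2.eq_swap, add_comm]

lemma chainWeight_congr {w w' : Sym2 V → ℝ} {a b : V} {l : List V} (P : V → Prop)
    (hw : ∀ x y, P x → P y → w s(x, y) = w' s(x, y)) (ha : P a) (hb : P b) (hl : ∀ x ∈ l, P x) :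
    chainWeight w a l b = chainWeight w' a l b := by
  induction l generalizing a with
  | nil => exact hw _ _ ha hb
  | cons y l ih =>
    simp only [List.mem_cons, forall_eq_or_imp] at hl
    rw [chainWeight_cons, chainWeight_cons, hw _ _ ha hl.1, ih hl.1 hl.2]

/-- The last link of a walk. -/
lemma Joined.exists_adj_last {H : SimpleGraph V} {a b : V} {l : List V} (h : Joined H a l b) :
    H.Adj a b ∨ ∃ x ∈ l, H.Adj x b := by
  induction l generalizing a with
  | nil => exact Or.inl h
  | cons y l ih =>
    right
    rcases ih h.2 with h' | ⟨x, hx, h'⟩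
    · exact ⟨y, by simp, h'⟩
    · exact ⟨x, by simp [hx], h'⟩

/-- If every set of nodes of `W` that contains the neighbours of `u` and is closed under adjacency
in `W` has a neighbour with the property `P`, then a path through `W` leads from `u` to such a
node. -/
lemma exists_joined (H : SimpleGraph V) (W : Finset V) (u : V) (P : V → Prop)
    (h : ∀ Y ⊆ W, (∀ x ∈ W, H.Adj u x → x ∈ Y) → (∀ y ∈ Y, ∀ x ∈ W, H.Adj y x → x ∈ Y) →
      ∃ z, P z ∧ (H.Adj u z ∨ ∃ y ∈ Y, H.Adj y z)) :
    ∃ l z, P z ∧ Joined H u l z ∧ l.Nodup ∧ ∀ x ∈ l, x ∈ W := by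
  classical
  -- The hypothesis is applied to the set of all nodes reached from `u` by a simple path inside `W`.
  obtain ⟨z, hz, h'⟩ := h
    (W.filter fun y => ∃ l, Joined H u l y ∧ (l ++ [y]).Nodup ∧ ∀ x ∈ l, x ∈ W)
    (Finset.filter_subset _ _)
    (fun x hx hux => Finset.mem_filter.2 ⟨hx, [], by simpa using hux⟩)
    (by
      intro y hy x hx hyx
      rw [Finset.mem_filter] at hy ⊢
      obtain ⟨hyW, l, hl, hnd, hlW⟩ := hy
      refine ⟨hx, ?_⟩
      -- A new endpoint that already lies on the path is reached by truncating the path there.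
      by_cases hxl : x ∈ l ++ [y]
      · have hx' : x ∈ l := by
          rcases List.mem_append.1 hxl with h1 | h1
          · exact h1
          · exact absurd (List.mem_singleton.1 h1) hyx.ne'
        obtain ⟨s, t, rfl⟩ := List.append_of_mem hx'
        refine ⟨s, (joined_append.1 hl).1, ?_, fun x hx => hlW _ (by simp [hx])⟩
        have : List.Sublist (s ++ [x]) ((s ++ x :: t) ++ [y]) := by simp
        exact this.nodup hnd
      · refine ⟨l ++ [y], by simp [hl, hyx], List.nodup_append.2 ⟨hnd, by simp, ?_⟩, ?_⟩
        · rintro a ha b hb rfl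
          rw [List.mem_singleton] at hb
          exact hxl (hb ▸ ha)
        · intro z hz
          rcases List.mem_append.1 hz with h1 | h1
          · exact hlW _ h1
          · exact (List.mem_singleton.1 h1) ▸ hyW)
  rcases h' with h' | ⟨y, hy, hyz⟩
  · exact ⟨[], z, hz, h', by simp, by simp⟩
  · rw [Finset.mem_filter] at hy
    obtain ⟨hyW, l, hl, hnd, hlW⟩ := hy
    refine ⟨l ++ [y], z, hz, by simp [hl, hyz], hnd, fun x hx => ?_⟩
    rcases List.mem_append.1 hx with h1 | h1
    · exact hlW _ h1
    · exact (List.mem_singleton.1 h1) ▸ hyW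

end Paths

section Boundary

variable {V : Type*} [Fintype V]

open Classical in
/-- The nodes outside `A` that have a neighbour in `A`. -/
noncomputable def boundary (H : SimpleGraph V) (A : Finset V) : Finset V :=
  Finset.univ.filter fun x => x ∉ A ∧ ∃ a ∈ A, H.Adj a x

lemma mem_boundary {H : SimpleGraph V} {A : Finset V} {x : V} :
    x ∈ boundary H A ↔ x ∉ A ∧ ∃ a ∈ A, H.Adj a x := by simp [boundary]

end Boundary

/-! ### Colourings of outer nodes -/

section Coloring

variable {V : Type*}

/-- `f` fixes the nodes of `U` and maps the other nodes to nodes outside `U`. -/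
def IsColoring (U : Finset V) (f : V → V) : Prop := (∀ x ∈ U, f x = x) ∧ ∀ x ∉ U, f x ∉ U

/-- Colour classes of nodes of `U` are singletons, so inside `U` distinct nodes count as distinct
colours. -/
lemma IsColoring.eq_of_mem {U : Finset V} {f : V → V} (hf : IsColoring U f) {x u : V}
    (hu : u ∈ U) (h : f x = u) : x = u := by
  by_cases hx : x ∈ U
  · rw [← hf.1 x hx, h]
  · exact absurd (h ▸ hu) (hf.2 x hx)

/-- Nodes released from `U` keep themselves as private colours. -/
lemma IsColoring.mono {U U' : Finset V} {f : V → V} (hf : IsColoring U f) (h : U' ⊆ U) :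
    IsColoring U' f := by
  refine ⟨fun x hx => hf.1 x (h hx), fun x hx hx' => ?_⟩
  have := hf.eq_of_mem (h hx') rfl
  exact hx (this ▸ hx')

variable [DecidableEq V]

/-- Recolouring some nodes of `U` by the colour of a node outside `U`. -/
lemma IsColoring.recolor {U A : Finset V} {f : V → V} (hf : IsColoring U f) {c : V} (hc : c ∉ U) :
    IsColoring (U \ A) (fun x => if x ∈ A then c else f x) := by
  constructor
  · intro x hx
    rw [Finset.mem_sdiff] at hx
    simp [hx.2, hf.1 x hx.1]
  · intro x hx
    rw [Finset.mem_sdiff] at hx ⊢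
    by_cases hxA : x ∈ A
    · simp [hxA, hc]
    · simp only [hxA, if_false]
      intro h
      have := hf.eq_of_mem h.1 rfl
      rw [← this] at h
      exact hx h

end Coloring

/-! ### A coloured Menger theorem for two paths -/

section Linkage

variable {V : Type*} [Fintype V] [DecidableEq V]

/-- Two disjoint paths from `A` through `U` to targets in `E` of different colours. -/
theorem exists_linkage (H : SimpleGraph V) (A E : Finset V) :
    ∀ (U : Finset V) (f : V → V), A ⊆ U → IsColoring U f → U ⊆ E →
      (∀ B, A ⊆ B → B ⊆ U → 2 ≤ ((boundary H B ∩ E).image f).card) →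
      ∃ a₁ l₁ b₁ a₂ l₂ b₂, a₁ ∈ A ∧ a₂ ∈ A ∧ b₁ ∈ E \ U ∧ b₂ ∈ E \ U ∧ f b₁ ≠ f b₂ ∧
        Joined H a₁ l₁ b₁ ∧ Joined H a₂ l₂ b₂ ∧ (∀ x ∈ l₁, x ∈ U \ A) ∧ (∀ x ∈ l₂, x ∈ U \ A) ∧
        (l₁ ++ l₂).Nodup := by
  intro U
  induction hn : U.card using Nat.strong_induction_on generalizing U with
  | _ n ih =>
  intro f hAU hf hUE hcut
  -- A node `u` next to a target `b` is moved out of `U` and takes the colour of `b`. A path found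
  -- for the smaller set that ends at `u` is prolonged to `b`.
  by_cases hex : ∃ u ∈ U \ A, ∃ b ∈ E \ U, H.Adj u b
  · obtain ⟨u, hu, b, hb, hub⟩ := hex
    rw [Finset.mem_sdiff] at hu hb
    have hfb : f b ∉ U := hf.2 b hb.2
    set f' : V → V := fun x => if x ∈ ({u} : Finset V) then f b else f x with hf'
    have hcol : IsColoring (U \ {u}) f' := hf.recolor hfb
    have hlt : (U \ {u}).card < n := by
      rw [← hn]
      exact Finset.card_lt_card (Finset.sdiff_ssubset (by simpa using hu.1) (by simp))
    have hA' : A ⊆ U \ {u} := fun x hx => by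
      rw [Finset.mem_sdiff, Finset.mem_singleton]
      exact ⟨hAU hx, fun h => hu.2 (h ▸ hx)⟩
    by_cases hcut' : ∀ B, A ⊆ B → B ⊆ U \ {u} → 2 ≤ ((boundary H B ∩ E).image f').card
    · obtain ⟨a₁, l₁, b₁, a₂, l₂, b₂, ha₁, ha₂, hb₁, hb₂, hne, h₁, h₂, hl₁, hl₂, hnd⟩ :=
        ih _ hlt (U \ {u}) rfl f' hA' hcol (Finset.sdiff_subset.trans hUE) hcut'
      have hmem : ∀ {l : List V}, (∀ x ∈ l, x ∈ (U \ {u}) \ A) → ∀ x ∈ l, x ∈ U \ A := by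
        intro l hl x hx
        have := hl x hx
        simp only [Finset.mem_sdiff] at this ⊢
        exact ⟨this.1.1, this.2⟩
      have hul : ∀ {l : List V}, (∀ x ∈ l, x ∈ (U \ {u}) \ A) → u ∉ l := by
        intro l hl hx
        have := hl u hx
        simp at this
      have hE : ∀ {b : V}, b ∈ E \ (U \ {u}) → b ≠ u → b ∈ E \ U := by
        intro b hb hbu
        simp only [Finset.mem_sdiff, Finset.mem_singleton] at hb ⊢
        tauto
      by_cases h1 : b₁ = u
      · have h2 : b₂ ≠ u := by
          rintro rfl
          exact hne (by rw [h1])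
        refine ⟨a₁, l₁ ++ [u], b, a₂, l₂, b₂, ha₁, ha₂, Finset.mem_sdiff.2 hb, hE hb₂ h2, ?_,
          by subst h1; simp [h₁, hub], h₂, ?_, hmem hl₂, ?_⟩
        · simpa [hf', h1, h2] using hne
        · intro x hx
          rcases List.mem_append.1 hx with h | h
          · exact hmem hl₁ x h
          · rw [List.mem_singleton.1 h]; exact Finset.mem_sdiff.2 hu
        · have : (l₁ ++ [u] ++ l₂).Perm (u :: (l₁ ++ l₂)) := by simp
          rw [this.nodup_iff, List.nodup_cons]
          refine ⟨?_, hnd⟩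
          simp [hul hl₁, hul hl₂]
      · by_cases h2 : b₂ = u
        · refine ⟨a₁, l₁, b₁, a₂, l₂ ++ [u], b, ha₁, ha₂, hE hb₁ h1, Finset.mem_sdiff.2 hb, ?_, h₁,
            by subst h2; simp [h₂, hub], hmem hl₁, ?_, ?_⟩
          · simpa [hf', h1, h2] using hne
          · intro x hx
            rcases List.mem_append.1 hx with h | h
            · exact hmem hl₂ x h
            · rw [List.mem_singleton.1 h]; exact Finset.mem_sdiff.2 hu
          · have : (l₁ ++ (l₂ ++ [u])).Perm (u :: (l₁ ++ l₂)) := by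
              rw [← List.append_assoc]; exact List.perm_append_singleton _ _
            rw [this.nodup_iff, List.nodup_cons]
            refine ⟨?_, hnd⟩
            simp [hul hl₁, hul hl₂]
        · exact ⟨a₁, l₁, b₁, a₂, l₂, b₂, ha₁, ha₂, hE hb₁ h1, hE hb₂ h2,
            by simpa [hf', h1, h2] using hne, h₁, h₂, hmem hl₁, hmem hl₂, hnd⟩
    -- The cut condition fails after recolouring only at a set `B` all of whose boundary nodes in
    -- `E` are `u` or have colour `f b`. Inside `B` the original condition yields two paths, one to
    -- `u` and one to colour `f b`; the former must be continued to another colour without touching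
    -- `B`.
    · push Not at hcut'
      obtain ⟨B, hAB, hBU, hcard⟩ := hcut'
      have hBU' : B ⊆ U := hBU.trans Finset.sdiff_subset
      have huB : u ∉ B := fun h => by simpa using hBU h
      have hcolors : ∀ z ∈ boundary H B ∩ E, z = u ∨ f z = f b := by
        have h2 := hcut B hAB hBU'
        have huN : u ∈ boundary H B ∩ E := by
          by_contra hcon
          refine absurd h2 (not_le.2 ?_)
          convert hcard using 2
          refine Finset.image_congr fun x hx => ?_
          have : x ≠ u := by rintro rfl; exact hcon hx
          simp [hf', this]
        intro z hz
        by_contra! hcon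
        have hz1 : f' z ∈ (boundary H B ∩ E).image f' := Finset.mem_image_of_mem _ hz
        have hz2 : f' u ∈ (boundary H B ∩ E).image f' := Finset.mem_image_of_mem _ huN
        have := Finset.card_le_one.1 (Nat.le_of_lt_succ hcard) _ hz1 _ hz2
        simp [hf', hcon.1, hcon.2] at this
      have hltB : B.card < n :=
        lt_of_le_of_lt (Finset.card_le_card hBU) hlt
      obtain ⟨a₁, l₁, b₁, a₂, l₂, b₂, ha₁, ha₂, hb₁, hb₂, hne, h₁, h₂, hl₁, hl₂, hnd⟩ :=
        ih _ hltB B rfl f hAB (hf.mono hBU') (hBU'.trans hUE)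
          (fun B' h h' => hcut B' h (h'.trans hBU'))
      have hbd : ∀ {a b : V} {l : List V}, a ∈ A → b ∈ E \ B → Joined H a l b →
          (∀ x ∈ l, x ∈ B \ A) → b = u ∨ f b = f b₁ ∨ f b = f b₂ → b ∈ boundary H B ∩ E := by
        intro a b l ha hb hj hl _
        rw [Finset.mem_sdiff] at hb
        rw [Finset.mem_inter, mem_boundary]
        refine ⟨⟨hb.2, ?_⟩, hb.1⟩
        rcases hj.exists_adj_last with h | ⟨x, hx, h⟩
        · exact ⟨a, hAB ha, h⟩
        · exact ⟨x, (Finset.mem_sdiff.1 (hl x hx)).1, h⟩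
      have hz₁ := hcolors _ (hbd ha₁ hb₁ h₁ hl₁ (by simp))
      have hz₂ := hcolors _ (hbd ha₂ hb₂ h₂ hl₂ (by simp))
      obtain ⟨l₃, b₃, ⟨hb₃, hb₃'⟩, h₃, hnd₃, hl₃⟩ := exists_joined H (U \ (B ∪ {u})) u
        (fun z => z ∈ E \ U ∧ f z ≠ f b) (by
          intro Y hY hY1 hY2
          have hYU : Y ⊆ U := hY.trans Finset.sdiff_subset
          -- A boundary node of this set with a colour other than `f b` cannot be adjacent to `B`,
          -- so it hangs on `u` or `Y`.
          have h2 := hcut (B ∪ {u} ∪ Y) (fun x hx => by simp [hAB hx])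
            (Finset.union_subset (Finset.union_subset hBU' (by simpa using hu.1)) hYU)
          have : ∃ z ∈ boundary H (B ∪ {u} ∪ Y) ∩ E, f z ≠ f b := by
            by_contra! hcon
            refine absurd h2 (not_le.2 (Nat.lt_succ_of_le (Finset.card_le_one.2 ?_)))
            simp only [Finset.mem_image]
            rintro _ ⟨x, hx, rfl⟩ _ ⟨y, hy, rfl⟩
            rw [hcon x hx, hcon y hy]
          obtain ⟨z, hz, hzb⟩ := this
          rw [Finset.mem_inter, mem_boundary] at hz
          obtain ⟨⟨hzn, a, ha, haz⟩, hzE⟩ := hz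
          simp only [Finset.mem_union, Finset.mem_singleton, not_or] at ha hzn
          have haB : a ∉ B := by
            intro haB
            rcases hcolors z (by
              rw [Finset.mem_inter, mem_boundary]
              exact ⟨⟨hzn.1.1, a, haB, haz⟩, hzE⟩) with h | h
            · exact hzn.1.2 h
            · exact hzb h
          have hau : a = u ∨ a ∈ Y := by tauto
          have hzU : z ∉ U := by
            intro hzU
            have hzW : z ∈ U \ (B ∪ {u}) := by simp [hzU, hzn.1.1, hzn.1.2]
            rcases hau with rfl | h
            · exact hzn.2 (hY1 z hzW haz)
            · exact hzn.2 (hY2 a h z hzW haz)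
          refine ⟨z, ⟨Finset.mem_sdiff.2 ⟨hzE, hzU⟩, hzb⟩, ?_⟩
          rcases hau with rfl | h
          · exact Or.inl haz
          · exact Or.inr ⟨a, h, haz⟩)
      have hl₃' : ∀ x ∈ l₃, x ∈ U ∧ x ∉ B ∧ x ≠ u := by
        intro x hx
        have := hl₃ x hx
        simp only [Finset.mem_sdiff, Finset.mem_union, Finset.mem_singleton, not_or] at this
        exact this
      have hmem : ∀ {l : List V}, (∀ x ∈ l, x ∈ B \ A) → ∀ x ∈ l, x ∈ U \ A := by
        intro l hl x hx
        have := hl x hx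
        rw [Finset.mem_sdiff] at this ⊢
        exact ⟨hBU' this.1, this.2⟩
      have hlong : ∀ {l : List V}, (∀ x ∈ l, x ∈ B \ A) → ∀ x ∈ l ++ u :: l₃, x ∈ U \ A := by
        intro l hl x hx
        rw [List.mem_append, List.mem_cons] at hx
        rcases hx with h | rfl | h
        · exact hmem hl x h
        · exact Finset.mem_sdiff.2 hu
        · exact Finset.mem_sdiff.2 ⟨(hl₃' x h).1, fun hA => (hl₃' x h).2.1 (hAB hA)⟩
      have hE : ∀ {x : V}, x ∈ E \ B → x ≠ u → f x = f b → x ∈ E \ U := by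
        intro x hx _ hxb
        rw [Finset.mem_sdiff] at hx ⊢
        refine ⟨hx.1, fun hxU => hfb ?_⟩
        rw [← hxb, hf.1 x hxU]
        exact hxU
      have hnd4 : (u :: l₃ ++ (l₁ ++ l₂)).Nodup := by
        refine List.nodup_append.2 ⟨List.nodup_cons.2 ⟨fun h => (hl₃' u h).2.2 rfl, hnd₃⟩, hnd, ?_⟩
        rintro x hx y hy rfl
        have hxB : x ∈ B := by
          rcases List.mem_append.1 hy with h | h
          · exact (Finset.mem_sdiff.1 (hl₁ x h)).1
          · exact (Finset.mem_sdiff.1 (hl₂ x h)).1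
        rcases List.mem_cons.1 hx with rfl | h
        · exact huB hxB
        · exact (hl₃' x h).2.1 hxB
      by_cases h1 : b₁ = u
      · have h2 : b₂ ≠ u := by
          rintro rfl
          exact hne (by rw [h1])
        have hb2 := hz₂.resolve_left h2
        refine ⟨a₁, l₁ ++ u :: l₃, b₃, a₂, l₂, b₂, ha₁, ha₂, hb₃, hE hb₂ h2 hb2, ?_,
          ?_, h₂, hlong hl₁, hmem hl₂, ?_⟩
        · rw [hb2]; exact hb₃'
        · rw [joined_append]; exact ⟨h1 ▸ h₁, h₃⟩
        · refine (List.Perm.nodup_iff ?_).1 hnd4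
          rw [← List.append_assoc]
          exact List.perm_append_comm.append_right _
      · have hb1 := hz₁.resolve_left h1
        have h2 : b₂ = u := by
          by_contra h2
          exact hne (by rw [hb1, hz₂.resolve_left h2])
        refine ⟨a₁, l₁, b₁, a₂, l₂ ++ u :: l₃, b₃, ha₁, ha₂, hE hb₁ h1 hb1, hb₃, ?_,
          h₁, ?_, hmem hl₁, hlong hl₂, ?_⟩
        · rw [hb1]; exact hb₃'.symm
        · rw [joined_append]; exact ⟨h2 ▸ h₂, h₃⟩
        · refine (List.Perm.nodup_iff ?_).1 hnd4
          rw [← List.append_assoc l₁]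
          exact List.perm_append_comm
  -- Every link from `U` to a target starts in `A`, so two single links suffice.
  · push Not at hex
    obtain ⟨c₁, hc₁, c₂, hc₂, hne⟩ := Finset.one_lt_card.1 (hcut U hAU le_rfl)
    rw [Finset.mem_image] at hc₁ hc₂
    obtain ⟨z₁, hz₁, rfl⟩ := hc₁
    obtain ⟨z₂, hz₂, rfl⟩ := hc₂
    rw [Finset.mem_inter, mem_boundary] at hz₁ hz₂
    obtain ⟨⟨hz₁U, a₁, ha₁, h₁⟩, hz₁E⟩ := hz₁
    obtain ⟨⟨hz₂U, a₂, ha₂, h₂⟩, hz₂E⟩ := hz₂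
    have hA : ∀ {a z : V}, a ∈ U → z ∈ E \ U → H.Adj a z → a ∈ A := by
      intro a z ha hz h
      by_contra hA
      exact hex a (Finset.mem_sdiff.2 ⟨ha, hA⟩) z hz h
    have m₁ := Finset.mem_sdiff.2 ⟨hz₁E, hz₁U⟩
    have m₂ := Finset.mem_sdiff.2 ⟨hz₂E, hz₂U⟩
    exact ⟨a₁, [], z₁, a₂, [], z₂, hA ha₁ m₁ h₁, hA ha₂ m₂ h₂, m₁, m₂, hne, h₁, h₂, by simp,
      by simp, by simp⟩

end Linkage

/-! ### Weights that vanish on paths between different colours -/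

section Core

variable {V : Type*} [DecidableEq V]

/-- All paths through `U` between nodes of different colours have weight zero. -/
def Vanishes (H : SimpleGraph V) (U : Finset V) (f : V → V) (w : Sym2 V → ℝ) : Prop :=
  ∀ a l b, a ∉ U → b ∉ U → f a ≠ f b → l ≠ [] → l.Nodup → (∀ x ∈ l, x ∈ U) → Joined H a l b →
    chainWeight w a l b = 0

variable {H : SimpleGraph V} {U : Finset V} {f : V → V} {w : Sym2 V → ℝ}

/-- Two paths from `u` that share only `u` have opposite weights. -/
lemma Vanishes.add_eq_zero (h : Vanishes H U f w) {u b₁ b₂ : V} {l₁ l₂ : List V} (hu : u ∈ U)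
    (hb₁ : b₁ ∉ U) (hb₂ : b₂ ∉ U) (hne : f b₁ ≠ f b₂) (h₁ : Joined H u l₁ b₁)
    (h₂ : Joined H u l₂ b₂) (hl₁ : ∀ x ∈ l₁, x ∈ U \ {u}) (hl₂ : ∀ x ∈ l₂, x ∈ U \ {u})
    (hnd : (l₁ ++ l₂).Nodup) : chainWeight w u l₁ b₁ + chainWeight w u l₂ b₂ = 0 := by
  have := h b₁ (l₁.reverse ++ u :: l₂) b₂ hb₁ hb₂ hne (by simp) ?_ ?_ (by simp [h₁, h₂])
  · simpa using this
  · have hp : (l₁.reverse ++ u :: l₂).Perm (u :: (l₁ ++ l₂)) :=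
      List.perm_middle.trans ((List.Perm.append_right _ (List.reverse_perm _)).cons _)
    rw [hp.nodup_iff, List.nodup_cons]
    refine ⟨fun hx => ?_, hnd⟩
    rcases List.mem_append.1 hx with h | h
    · simpa using hl₁ u h
    · simpa using hl₂ u h
  · intro x hx
    rw [List.mem_append, List.mem_reverse, List.mem_cons] at hx
    rcases hx with h | rfl | h
    · exact (Finset.mem_sdiff.1 (hl₁ x h)).1
    · exact hu
    · exact (Finset.mem_sdiff.1 (hl₂ x h)).1

/-- A node adjacent to the outside may take the colour of its neighbour. -/
lemma Vanishes.recolor (h : Vanishes H U f w) {v m : V} (hv : v ∈ U) (hm : m ∉ U)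
    (hvm : H.Adj v m) (hw : w s(v, m) = 0) :
    Vanishes H (U \ {v}) (fun x => if x ∈ ({v} : Finset V) then f m else f x) w := by
  -- Prepending the link from `m` to `v`, of weight zero, turns a path from `v` into a path from
  -- `m`.
  have key : ∀ l b, b ∉ U → f m ≠ f b → l.Nodup → (∀ x ∈ l, x ∈ U \ {v}) → Joined H v l b →
      chainWeight w v l b = 0 := by
    intro l b hb hne hnd hl hj
    have := h m (v :: l) b hm hb hne (by simp)
      (List.nodup_cons.2 ⟨fun hvl => by simpa using hl v hvl, hnd⟩)
      (by
        intro x hx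
        rcases List.mem_cons.1 hx with rfl | hx
        · exact hv
        · exact (Finset.mem_sdiff.1 (hl x hx)).1) ⟨hvm.symm, hj⟩
    rw [chainWeight_cons, Sym2.eq_swap, hw, zero_add] at this
    exact this
  intro a l b ha hb hne hl0 hnd hl hj
  simp only [Finset.mem_sdiff, Finset.mem_singleton, not_and, not_not] at ha hb
  by_cases hav : a = v
  · subst hav
    by_cases hbv : b = a
    · subst hbv; exact absurd rfl hne
    · exact key l b (fun hbU => hbv (hb hbU)) (by simpa [hbv] using hne) hnd hl hj
  · by_cases hbv : b = v
    · subst hbv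
      rw [← chainWeight_reverse]
      exact key l.reverse a (fun haU => hav (ha haU)) (by simpa [hav] using hne.symm) (by simpa)
        (by simpa using hl) (by simpa using hj)
    · exact h a l b (fun h => hav (ha h)) (fun h => hbv (hb h)) (by simpa [hav, hbv] using hne) hl0
        hnd (fun x hx => (Finset.mem_sdiff.1 (hl x hx)).1) hj

/-- A node from which all paths to the outside have weight zero may leave `U`. -/
lemma Vanishes.erase (h : Vanishes H U f w) {v : V}
    (key : ∀ l b, b ∉ U → l.Nodup → (∀ x ∈ l, x ∈ U \ {v}) → Joined H v l b →
      chainWeight w v l b = 0) : Vanishes H (U \ {v}) f w := by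
  intro a l b ha hb hne hl0 hnd hl hj
  simp only [Finset.mem_sdiff, Finset.mem_singleton, not_and, not_not] at ha hb
  by_cases hav : a = v
  · subst hav
    by_cases hbv : b = a
    · subst hbv; exact absurd rfl hne
    · exact key l b (fun hbU => hbv (hb hbU)) hnd hl hj
  · by_cases hbv : b = v
    · subst hbv
      rw [← chainWeight_reverse]
      exact key l.reverse a (fun haU => hav (ha haU)) (by simpa)
        (by simpa using hl) (by simpa using hj)
    · exact h a l b (fun h => hav (ha h)) (fun h => hbv (hb h)) hne hl0
        hnd (fun x hx => (Finset.mem_sdiff.1 (hl x hx)).1) hj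

variable [Fintype V]

/-- Every nonempty set of nodes of `U` has boundary nodes of three colours. -/
def Robust (H : SimpleGraph V) (U : Finset V) (f : V → V) : Prop :=
  ∀ A ⊆ U, A.Nonempty → 3 ≤ ((boundary H A).image f).card

lemma Robust.mono (h : Robust H U f) {U' : Finset V} (hU : U' ⊆ U) : Robust H U' f :=
  fun A hA => h A (hA.trans hU)

/-- Converts the three colours of `Robust` into the cut condition of `exists_linkage` with targets
avoiding the colour `c`. -/
lemma two_le_card_image_inter {S : Finset V} {f : V → V} (c : V) (h : 3 ≤ (S.image f).card) :
    2 ≤ ((S ∩ Finset.univ.filter fun x => f x ≠ c).image f).card := by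
  have : S.image f ⊆ insert c ((S ∩ Finset.univ.filter fun x => f x ≠ c).image f) := by
    intro z hz
    rw [Finset.mem_image] at hz
    obtain ⟨x, hx, rfl⟩ := hz
    rw [Finset.mem_insert]
    by_cases hxc : f x = c
    · exact Or.inl hxc
    · exact Or.inr (Finset.mem_image_of_mem _ (by simp [hx, hxc]))
  have h1 := Finset.card_le_card this
  have h2 := Finset.card_insert_le c ((S ∩ Finset.univ.filter fun x => f x ≠ c).image f)
  omega

/-- A link from `U` to the outside has weight zero. -/
lemma Vanishes.adj_eq_zero (hf : IsColoring U f) (hr : Robust H U f) (h : Vanishes H U f w)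
    {u m : V} (hu : u ∈ U) (hm : m ∉ U) (hum : H.Adj u m) : w s(u, m) = 0 := by
  -- Two paths from `u` to different colours other than `f m`; together with the link to `m` they
  -- form a fan of three paths with pairwise sums zero.
  obtain ⟨a₁, l₁, b₁, a₂, l₂, b₂, ha₁, ha₂, hb₁, hb₂, hne, h₁, h₂, hl₁, hl₂, hnd⟩ :=
    exists_linkage H {u} (Finset.univ.filter fun x => f x ≠ f m) U f (by simpa using hu) hf
      (by
        intro x hx
        rw [Finset.mem_filter, hf.1 x hx]
        exact ⟨Finset.mem_univ _, fun h => hf.2 m hm (h ▸ hx)⟩)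
      (fun B hB hBU => two_le_card_image_inter _ (hr B hBU ⟨u, hB (by simp)⟩))
  rw [Finset.mem_singleton] at ha₁ ha₂
  subst ha₁
  subst ha₂
  simp only [Finset.mem_sdiff, Finset.mem_filter, Finset.mem_univ, true_and] at hb₁ hb₂
  have e₀ := h.add_eq_zero hu hb₁.2 hb₂.2 hne h₁ h₂ hl₁ hl₂ hnd
  have hnd' := List.nodup_append.1 hnd
  have e₁ := h.add_eq_zero hu hb₁.2 hm hb₁.1 h₁ (l₂ := []) hum hl₁ (by simp) (by simpa using hnd'.1)
  have e₂ := h.add_eq_zero hu hb₂.2 hm hb₂.1 h₂ (l₂ := []) hum hl₂ (by simp)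
    (by simpa using hnd'.2.1)
  simp only [chainWeight_nil] at e₁ e₂
  linarith

/-! ### Absorbing a set with three boundary colours -/

/-- The set `A` has exactly three boundary colours, one of them `c`, and absorbing `A` into the
colour `c` keeps the rest of `U` robust. -/
structure Absorbable (H : SimpleGraph V) (U : Finset V) (f : V → V) (A : Finset V) (c : V) :
    Prop where
  subset : A ⊆ U
  nonempty : A.Nonempty
  not_mem : c ∉ U
  card : ((boundary H A).image f).card = 3
  mem : c ∈ (boundary H A).image f
  robust : Robust H (U \ A) (fun x => if x ∈ A then c else f x)

variable {A : Finset V} {c : V}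

/-- A path inside a set with three boundary colours, from a boundary node to a boundary colour. -/
lemma exists_joined_of_mem_image (hf : IsColoring U f) (hr : Robust H U f) (hA : A ⊆ U)
    (hcard : ((boundary H A).image f).card ≤ 3) {c : V} (hcU : c ∉ U)
    (hc : c ∈ (boundary H A).image f) {v : V} (hv : v ∈ boundary H A) :
    ∃ l z, (z ∉ U ∧ f z = c) ∧ Joined H v l z ∧ l.Nodup ∧ ∀ x ∈ l, x ∈ A := by
  refine exists_joined H A v (fun z => z ∉ U ∧ f z = c) fun Y hY hY1 hY2 => ?_
  rw [mem_boundary] at hv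
  obtain ⟨hvA, a, ha, hav⟩ := hv
  have hsub : boundary H Y ⊆ boundary H A := by
    intro x hx
    rw [mem_boundary] at hx ⊢
    obtain ⟨hxY, y, hy, hyx⟩ := hx
    exact ⟨fun hxA => hxY (hY2 y hy x hxA hyx), y, hY hy, hyx⟩
  -- By robustness `Y` has at least three boundary colours, and `A` has at most three; so `Y` sees
  -- all colours that `A` sees, in particular `c`.
  have heq := Finset.eq_of_subset_of_card_le (Finset.image_subset_image (f := f) hsub)
    (hcard.trans (hr Y (hY.trans hA) ⟨a, hY1 a ha hav.symm⟩))
  rw [← heq, Finset.mem_image] at hc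
  obtain ⟨z, hz, rfl⟩ := hc
  obtain ⟨-, y, hy, hyz⟩ := mem_boundary.1 hz
  exact ⟨z, ⟨fun hzU => hcU (by rwa [hf.1 z hzU]), rfl⟩, Or.inr ⟨y, hy, hyz⟩⟩

/-- Outer and inner paths from a boundary node of an absorbable set have weight zero. -/
lemma Absorbable.chainWeight_eq_zero (hA : Absorbable H U f A c) (hf : IsColoring U f)
    (hr : Robust H U f) (h : Vanishes H U f w) {v : V} (hv : v ∈ boundary H A) (hvU : v ∈ U) :
    (∀ l b, b ∉ U → f b ≠ c → l.Nodup → (∀ x ∈ l, x ∈ (U \ A) \ {v}) → Joined H v l b →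
      chainWeight w v l b = 0) ∧
    (∀ l b, b ∉ U → f b = c → l.Nodup → (∀ x ∈ l, x ∈ A) → Joined H v l b →
      chainWeight w v l b = 0) := by
  have hvA : v ∉ A := (mem_boundary.1 hv).1
  have hvW : v ∈ U \ A := Finset.mem_sdiff.2 ⟨hvU, hvA⟩
  -- An outer path and an inner path from `v` share only `v` and end at different colours. Below,
  -- two outer paths with different end colours and one inner path form a fan, so all these weights
  -- are zero.
  have hsum : ∀ l b l' b', b ∉ U → f b ≠ c → l.Nodup → (∀ x ∈ l, x ∈ (U \ A) \ {v}) →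
      Joined H v l b → b' ∉ U → f b' = c → l'.Nodup → (∀ x ∈ l', x ∈ A) → Joined H v l' b' →
      chainWeight w v l b + chainWeight w v l' b' = 0 := by
    intro l b l' b' hb hbc hnd hl hj hb' hbc' hnd' hl' hj'
    refine h.add_eq_zero hvU hb hb' (by rw [hbc']; exact hbc) hj hj' ?_ ?_ ?_
    · intro x hx
      have := hl x hx
      simp only [Finset.mem_sdiff] at this ⊢
      exact ⟨this.1.1, this.2⟩
    · intro x hx
      rw [Finset.mem_sdiff, Finset.mem_singleton]
      exact ⟨hA.subset (hl' x hx), fun h => hvA (h ▸ hl' x hx)⟩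
    · refine List.nodup_append.2 ⟨hnd, hnd', ?_⟩
      rintro x hx y hy rfl
      have := hl x hx
      simp only [Finset.mem_sdiff] at this
      exact this.1.2 (hl' x hy)
  obtain ⟨l₀, b₀, ⟨hb₀, hb₀c⟩, hj₀, hnd₀, hl₀⟩ :=
    exists_joined_of_mem_image hf hr hA.subset hA.card.le hA.not_mem hA.mem hv
  set f' : V → V := fun x => if x ∈ A then c else f x with hf'
  obtain ⟨a₁, l₁, b₁, a₂, l₂, b₂, ha₁, ha₂, hb₁, hb₂, hne, h₁, h₂, hl₁, hl₂, hnd⟩ :=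
    exists_linkage H {v} (Finset.univ.filter fun x => f' x ≠ c) (U \ A) f' (by simpa using hvW)
      (hf.recolor hA.not_mem)
      (by
        intro x hx
        have hx' : f' x = x := (hf.recolor hA.not_mem).1 x hx
        rw [Finset.mem_filter, hx']
        exact ⟨Finset.mem_univ _, fun h => hA.not_mem (h ▸ (Finset.mem_sdiff.1 hx).1)⟩)
      (fun B hB hBU => two_le_card_image_inter _ (hA.robust B hBU ⟨v, hB (by simp)⟩))
  rw [Finset.mem_singleton] at ha₁ ha₂
  subst ha₁
  subst ha₂
  have hb : ∀ {b : V}, b ∈ (Finset.univ.filter fun x => f' x ≠ c) \ (U \ A) →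
      b ∉ U ∧ f' b = f b ∧ f b ≠ c := by
    intro b hb
    simp only [Finset.mem_sdiff, Finset.mem_filter, Finset.mem_univ, true_and, not_and,
      not_not] at hb
    have hbA : b ∉ A := fun hbA => hb.1 (by simp [hf', hbA])
    refine ⟨fun hbU => hbA (hb.2 hbU), by simp [hf', hbA], ?_⟩
    simpa [hf', hbA] using hb.1
  obtain ⟨hb₁U, hfb₁, hb₁c⟩ := hb hb₁
  obtain ⟨hb₂U, hfb₂, hb₂c⟩ := hb hb₂
  rw [hfb₁, hfb₂] at hne
  have hnd' := List.nodup_append.1 hnd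
  have hmono : ∀ {l : List V}, (∀ x ∈ l, x ∈ (U \ A) \ {a₂}) → ∀ x ∈ l, x ∈ U \ {a₂} := by
    intro l hl x hx
    have := hl x hx
    simp only [Finset.mem_sdiff] at this ⊢
    exact ⟨this.1.1, this.2⟩
  have e₀ := h.add_eq_zero hvU hb₁U hb₂U hne h₁ h₂ (hmono hl₁) (hmono hl₂) hnd
  have e₁ := hsum l₁ b₁ l₀ b₀ hb₁U hb₁c hnd'.1 hl₁ h₁ hb₀ hb₀c hnd₀ hl₀ hj₀
  have e₂ := hsum l₂ b₂ l₀ b₀ hb₂U hb₂c hnd'.2.1 hl₂ h₂ hb₀ hb₀c hnd₀ hl₀ hj₀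
  constructor
  · intro l b hb hbc hndl hl hj
    have := hsum l b l₀ b₀ hb hbc hndl hl hj hb₀ hb₀c hnd₀ hl₀ hj₀
    linarith
  · intro l b hb hbc hndl hl hj
    have := hsum l₁ b₁ l b hb₁U hb₁c hnd'.1 hl₁ h₁ hb hbc hndl hl hj
    linarith

-- A path starting in `A`, which now counts as an outer node of colour `c`, passes to a boundary
-- node `v` by a link reset to zero; the remainder is an outer path from `v`, of weight zero by
-- `Absorbable.chainWeight_eq_zero`.
open Classical in
lemma Absorbable.vanishes_outer (hA : Absorbable H U f A c) (hf : IsColoring U f)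
    (hr : Robust H U f) (h : Vanishes H U f w) :
    Vanishes H (U \ A) (fun x => if x ∈ A then c else f x)
      (fun e => if ∃ a ∈ A, a ∈ e then 0 else w e) := by
  have hcongr : ∀ {a b : V} {l : List V}, a ∉ A → b ∉ A → (∀ x ∈ l, x ∉ A) →
      chainWeight (fun e => if ∃ a ∈ A, a ∈ e then 0 else w e) a l b = chainWeight w a l b := by
    intro a b l ha hb hl
    refine chainWeight_congr (fun x => x ∉ A) (fun x y hx hy => if_neg ?_) ha hb hl
    rintro ⟨z, hz, hzm⟩
    rcases Sym2.mem_iff.1 hzm with rfl | rfl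
    · exact hx hz
    · exact hy hz
  have key : ∀ a l b, a ∈ A → b ∉ U → f b ≠ c → l ≠ [] → l.Nodup → (∀ x ∈ l, x ∈ U \ A) →
      Joined H a l b →
      chainWeight (fun e => if ∃ a ∈ A, a ∈ e then 0 else w e) a l b = 0 := by
    intro a l b ha hb hbc hl0 hnd hl hj
    obtain _ | ⟨v, l⟩ := l
    · exact absurd rfl hl0
    · rw [List.nodup_cons] at hnd
      simp only [List.mem_cons, forall_eq_or_imp] at hl
      have hvA := Finset.mem_sdiff.1 hl.1
      have hl' : ∀ x ∈ l, x ∈ (U \ A) \ {v} := fun x hx => by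
        rw [Finset.mem_sdiff, Finset.mem_singleton]
        exact ⟨hl.2 x hx, fun h => hnd.1 (h ▸ hx)⟩
      rw [chainWeight_cons, if_pos ⟨a, ha, by simp⟩, zero_add,
        hcongr hvA.2 (fun hbA => hb (hA.subset hbA)) fun x hx => (Finset.mem_sdiff.1 (hl.2 x hx)).2]
      exact (hA.chainWeight_eq_zero hf hr h (mem_boundary.2 ⟨hvA.2, a, ha, hj.1⟩) hvA.1).1 l b hb
        hbc hnd.2 hl' hj.2
  intro a l b ha hb hne hl0 hnd hl hj
  simp only [Finset.mem_sdiff, not_and, not_not] at ha hb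
  by_cases haA : a ∈ A
  · have hbA : b ∉ A := fun hbA => hne (by simp [haA, hbA])
    exact key a l b haA (fun hbU => hbA (hb hbU)) (by simpa [haA, hbA] using hne.symm) hl0 hnd hl hj
  · by_cases hbA : b ∈ A
    · rw [← chainWeight_reverse]
      exact key b l.reverse a hbA (fun haU => haA (ha haU)) (by simpa [haA, hbA] using hne)
        (by simpa using hl0) (by simpa) (by simpa using hl) (by simpa using hj)
    · rw [hcongr haA hbA fun x hx => (Finset.mem_sdiff.1 (hl x hx)).2]
      exact h a l b (fun h => haA (ha h)) (fun h => hbA (hb h)) (by simpa [haA, hbA] using hne) hl0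
        hnd (fun x hx => (Finset.mem_sdiff.1 (hl x hx)).1) hj

/-- A path that ends at a boundary node can be prolonged by a path of weight zero. -/
lemma Absorbable.exists_prolongation (hA : Absorbable H U f A c) (hf : IsColoring U f)
    (hr : Robust H U f) (h : Vanishes H U f w) {a₁ b₁ : V} {l₁ : List V} (ha₁ : a₁ ∈ A)
    (hb₁ : b₁ ∉ U) (hb₁c : f b₁ ≠ c) (hj : Joined H a₁ l₁ b₁) (hl₁ : ∀ x ∈ l₁, x ∈ U \ A)
    (hnd : l₁.Nodup) :
    ∃ n ∈ boundary H A, f n ≠ c ∧ (n ∈ l₁ ∨ n = b₁) ∧ ∀ a, f a = f n →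
      ∃ (la : List V) (ea : V), ea ∉ U ∧ f ea = f b₁ ∧ (∀ x ∈ la, x ∈ l₁) ∧ la.Nodup ∧ ∀ s z, Joined H a s z →
        Joined H ea (la.reverse ++ s) z ∧
          chainWeight w ea (la.reverse ++ s) z = chainWeight w a s z := by
  -- For a single link `n` is its end outside `U`, and any node of the same colour is itself a
  -- suitable end. Otherwise `n` is the first node of the path, and what follows is an outer path of
  -- weight zero.
  obtain _ | ⟨n, l⟩ := l₁
  · refine ⟨b₁, mem_boundary.2 ⟨fun hbA => hb₁ (hA.subset hbA), a₁, ha₁, hj⟩, hb₁c, Or.inr rfl,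
      fun a ha => ⟨[], a, fun haU => ?_, ha, by simp, by simp, fun s z hj => by simpa using hj⟩⟩
    rw [hf.1 a haU] at ha
    exact hf.2 b₁ hb₁ (ha ▸ haU)
  · have hn := Finset.mem_sdiff.1 (hl₁ n (by simp))
    have hnb : n ∈ boundary H A := mem_boundary.2 ⟨hn.2, a₁, ha₁, hj.1⟩
    refine ⟨n, hnb, fun hnc => hA.not_mem ?_, Or.inl (by simp), fun a ha => ?_⟩
    · rw [← hnc, hf.1 n hn.1]; exact hn.1
    · rw [hf.1 n hn.1] at ha
      obtain rfl := hf.eq_of_mem hn.1 ha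
      rw [List.nodup_cons] at hnd
      have h0 := (hA.chainWeight_eq_zero hf hr h hnb hn.1).1 l b₁ hb₁ hb₁c hnd.2 (fun x hx => by
        rw [Finset.mem_sdiff, Finset.mem_singleton]
        exact ⟨hl₁ x (by simp [hx]), fun h => hnd.1 (h ▸ hx)⟩) hj.2
      refine ⟨a :: l, b₁, hb₁, rfl, fun x hx => hx, List.nodup_cons.2 hnd, fun s z hs => ?_⟩
      simp [hs, hj.2, h0]

/-- A path through `A` with an end coloured `c` and the other end in `U` is an inner path. If
neither end is coloured `c`, it can be prolonged at its ends, along disjoint paths of weight zero,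
to a path of `U` between outer nodes of different colours. -/
lemma Absorbable.vanishes_inner (hA : Absorbable H U f A c) (hf : IsColoring U f)
    (hr : Robust H U f) (h : Vanishes H U f w) : Vanishes H A f w := by
  intro a l b ha hb hne hl0 hnd hl hj
  have hba : ∀ {a b : V} {l : List V}, a ∉ A → l ≠ [] → (∀ x ∈ l, x ∈ A) → Joined H a l b →
      a ∈ boundary H A := by
    intro a b l ha hl0 hl hj
    obtain _ | ⟨x, l⟩ := l
    · exact absurd rfl hl0
    · exact mem_boundary.2 ⟨ha, x, hl x (by simp), hj.1.symm⟩
  have haN := hba ha hl0 hl hj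
  have hbN := hba (l := l.reverse) hb (by simpa) (by simpa) (joined_reverse.2 hj)
  have hlU : ∀ x ∈ l, x ∈ U := fun x hx => hA.subset (hl x hx)
  by_cases habU : a ∉ U ∧ b ∉ U
  · exact h a l b habU.1 habU.2 hne hl0 hnd hlU hj
  by_cases hac : f a = c
  · have haU : a ∉ U := fun haU => hA.not_mem (by rwa [← hac, hf.1 a haU])
    have hbU : b ∈ U := by tauto
    rw [← chainWeight_reverse]
    exact (hA.chainWeight_eq_zero hf hr h hbN hbU).2 _ _ haU hac (by simpa) (by simpa)
      (joined_reverse.2 hj)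
  by_cases hbc : f b = c
  · have hbU : b ∉ U := fun hbU => hA.not_mem (by rwa [← hbc, hf.1 b hbU])
    have haU : a ∈ U := by tauto
    exact (hA.chainWeight_eq_zero hf hr h haN haU).2 _ _ hbU hbc hnd hl hj
  obtain ⟨a₁, l₁, b₁, a₂, l₂, b₂, ha₁, ha₂, hb₁, hb₂, hne', h₁, h₂, hl₁, hl₂, hnd'⟩ :=
    exists_linkage H A (Finset.univ.filter fun x => f x ≠ c) U f hA.subset hf
      (by
        intro x hx
        rw [Finset.mem_filter, hf.1 x hx]
        exact ⟨Finset.mem_univ _, fun h => hA.not_mem (h ▸ hx)⟩)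
      (fun B hB hBU => two_le_card_image_inter _ (hr B hBU (hA.nonempty.mono hB)))
  simp only [Finset.mem_sdiff, Finset.mem_filter, Finset.mem_univ, true_and] at hb₁ hb₂
  obtain ⟨hnd₁, hnd₂, hdisj⟩ := List.nodup_append.1 hnd'
  obtain ⟨n₁, hn₁, hn₁c, hn₁m, hext₁⟩ :=
    hA.exists_prolongation hf hr h ha₁ hb₁.2 hb₁.1 h₁ hl₁ hnd₁
  obtain ⟨n₂, hn₂, hn₂c, hn₂m, hext₂⟩ :=
    hA.exists_prolongation hf hr h ha₂ hb₂.2 hb₂.1 h₂ hl₂ hnd₂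
  have hn : f n₁ ≠ f n₂ := by
    intro heq
    rcases hn₁m with h1 | rfl
    · have hU := (Finset.mem_sdiff.1 (hl₁ n₁ h1)).1
      rw [hf.1 n₁ hU] at heq
      obtain rfl := hf.eq_of_mem hU heq.symm
      rcases hn₂m with h2 | rfl
      · exact hdisj _ h1 _ h2 rfl
      · exact hb₂.2 hU
    · rcases hn₂m with h2 | rfl
      · have hU := (Finset.mem_sdiff.1 (hl₂ n₂ h2)).1
        rw [hf.1 n₂ hU] at heq
        obtain rfl := hf.eq_of_mem hU heq
        exact hb₁.2 hU
      · exact hne' heq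
  -- Apart from `c` the boundary of `A` has just two colours, so the two prolongations fit the two
  -- ends in one of the two orders.
  have hcases : (f a = f n₁ ∧ f b = f n₂) ∨ (f a = f n₂ ∧ f b = f n₁) := by
    have h2 : (((boundary H A).image f).erase c).card = 2 := by
      rw [Finset.card_erase_of_mem hA.mem, hA.card]
    have hsub : ({f n₁, f n₂} : Finset V) = ((boundary H A).image f).erase c := by
      refine Finset.eq_of_subset_of_card_le ?_ ?_
      · intro x hx
        rw [Finset.mem_insert, Finset.mem_singleton] at hx
        rcases hx with rfl | rfl
        · exact Finset.mem_erase.2 ⟨hn₁c, Finset.mem_image_of_mem _ hn₁⟩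
        · exact Finset.mem_erase.2 ⟨hn₂c, Finset.mem_image_of_mem _ hn₂⟩
      · rw [h2, Finset.card_pair hn]
    have h3 : f a ∈ ({f n₁, f n₂} : Finset V) := by
      rw [hsub]; exact Finset.mem_erase.2 ⟨hac, Finset.mem_image_of_mem _ haN⟩
    have h4 : f b ∈ ({f n₁, f n₂} : Finset V) := by
      rw [hsub]; exact Finset.mem_erase.2 ⟨hbc, Finset.mem_image_of_mem _ hbN⟩
    rw [Finset.mem_insert, Finset.mem_singleton] at h3 h4
    rcases h3 with h3 | h3 <;> rcases h4 with h4 | h4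
    · exact absurd (h3.trans h4.symm) hne
    · exact Or.inl ⟨h3, h4⟩
    · exact Or.inr ⟨h3, h4⟩
    · exact absurd (h3.trans h4.symm) hne
  have hfin : ∀ (la lb : List V) (ea eb : V), ea ∉ U → eb ∉ U → f eb ≠ f ea →
      (∀ x ∈ la, x ∈ U \ A) → (∀ x ∈ lb, x ∈ U \ A) → la.Nodup → lb.Nodup →
      (∀ x ∈ la, ∀ y ∈ lb, x ≠ y) →
      Joined H eb (lb.reverse ++ (la.reverse ++ l).reverse) ea →
      chainWeight w eb (lb.reverse ++ (la.reverse ++ l).reverse) ea = 0 := by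
    intro la lb ea eb hea heb hne hla hlb hnda hndb hdis hj
    refine h _ _ _ heb hea hne ?_ ?_ ?_ hj
    · simp [hl0]
    · rw [List.nodup_append]
      refine ⟨by simpa, ?_, ?_⟩
      · rw [List.nodup_reverse, List.nodup_append]
        refine ⟨by simpa, hnd, ?_⟩
        rintro x hx y hy rfl
        exact (Finset.mem_sdiff.1 (hla x (by simpa using hx))).2 (hl x hy)
      · rintro x hx y hy rfl
        simp only [List.mem_reverse, List.mem_append] at hx hy
        rcases hy with hy | hy
        · exact hdis x hy x hx rfl
        · exact (Finset.mem_sdiff.1 (hlb x hx)).2 (hl x hy)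
    · intro x hx
      simp only [List.mem_reverse, List.mem_append] at hx
      rcases hx with hx | hx | hx
      · exact (Finset.mem_sdiff.1 (hlb x hx)).1
      · exact (Finset.mem_sdiff.1 (hla x hx)).1
      · exact hlU x hx
  have hglue : ∀ (la lb : List V) (ea eb : V),
      (∀ s z, Joined H a s z → Joined H ea (la.reverse ++ s) z ∧
        chainWeight w ea (la.reverse ++ s) z = chainWeight w a s z) →
      (∀ s z, Joined H b s z → Joined H eb (lb.reverse ++ s) z ∧
        chainWeight w eb (lb.reverse ++ s) z = chainWeight w b s z) →
      Joined H eb (lb.reverse ++ (la.reverse ++ l).reverse) ea ∧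
        chainWeight w eb (lb.reverse ++ (la.reverse ++ l).reverse) ea = chainWeight w a l b := by
    intro la lb ea eb h1 h2
    obtain ⟨j1, e1⟩ := h1 l b hj
    obtain ⟨j2, e2⟩ := h2 _ ea (joined_reverse.2 j1)
    exact ⟨j2, by rw [e2, chainWeight_reverse, e1]⟩
  rcases hcases with ⟨hc1, hc2⟩ | ⟨hc1, hc2⟩
  · obtain ⟨la, ea, hea, hfea, hla, hnda, hexta⟩ := hext₁ a hc1
    obtain ⟨lb, eb, heb, hfeb, hlb, hndb, hextb⟩ := hext₂ b hc2
    obtain ⟨j, e⟩ := hglue la lb ea eb hexta hextb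
    rw [← e]
    exact hfin la lb ea eb hea heb (by rw [hfea, hfeb]; exact hne'.symm)
      (fun x hx => hl₁ x (hla x hx)) (fun x hx => hl₂ x (hlb x hx)) hnda hndb
      (fun x hx y hy => hdisj x (hla x hx) y (hlb y hy)) j
  · obtain ⟨la, ea, hea, hfea, hla, hnda, hexta⟩ := hext₂ a hc1
    obtain ⟨lb, eb, heb, hfeb, hlb, hndb, hextb⟩ := hext₁ b hc2
    obtain ⟨j, e⟩ := hglue la lb ea eb hexta hextb
    rw [← e]
    exact hfin la lb ea eb hea heb (by rw [hfea, hfeb]; exact hne')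
      (fun x hx => hl₂ x (hla x hx)) (fun x hx => hl₁ x (hlb x hx)) hnda hndb
      (fun x hx y hy => (hdisj y (hlb y hy) x (hla x hx)).symm) j

end Core

/-! ### Cut nodes, and the induction on the inner set -/

section Core

variable {V : Type*} [Fintype V] [DecidableEq V] {H : SimpleGraph V} {U : Finset V} {f : V → V}
  {w : Sym2 V → ℝ}

/-- Two paths from `v` through `S` that share only `v`, where `S` and `S'` are the two sides of the
cut node `v` of `U`. -/
lemma exists_linkage_side (hf : IsColoring U f) (hr : Robust H U f) {v : V} {S S' : Finset V}
    (hU : U = insert v (S ∪ S')) (hvS : v ∉ S) (hvS' : v ∉ S') (hdisj : Disjoint S S')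
    (hsep : ∀ x ∈ S, ∀ y ∈ S', ¬ H.Adj x y) {x₁ x₂ : V} (hx₁ : x₁ ∈ S) (hx₂ : x₂ ∈ S)
    (hne : x₁ ≠ x₂) (h₁ : H.Adj v x₁) (h₂ : H.Adj v x₂) :
    ∃ l₁ b₁ l₂ b₂, b₁ ∉ U ∧ b₂ ∉ U ∧ f b₁ ≠ f b₂ ∧ Joined H v l₁ b₁ ∧ Joined H v l₂ b₂ ∧
      (∀ x ∈ l₁, x ∈ S) ∧ (∀ x ∈ l₂, x ∈ S) ∧ (l₁ ++ l₂).Nodup := by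
  have hSU : S ⊆ U := fun x hx => by rw [hU]; simp [hx]
  have hvU : v ∈ U := by rw [hU]; simp
  have hWU : insert v S ⊆ U := Finset.insert_subset hvU hSU
  have hS'S : ∀ x ∈ S', x ∉ S := fun x hx hx' => Finset.disjoint_left.1 hdisj hx' hx
  obtain ⟨a₁, l₁, b₁, a₂, l₂, b₂, ha₁, ha₂, hb₁, hb₂, hne, j₁, j₂, hl₁, hl₂, hnd⟩ :=
    exists_linkage H {v} (Finset.univ \ S') (insert v S) f (by simp) (hf.mono hWU)
      (by
        intro x hx
        rw [Finset.mem_insert] at hx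
        simp only [Finset.mem_sdiff, Finset.mem_univ, true_and]
        rcases hx with rfl | hx
        · exact hvS'
        · exact fun h => hS'S x h hx)
      (by
        intro B hB hBW
        have hvB : v ∈ B := hB (by simp)
        -- For `B = {v}` the neighbours `x₁`, `x₂` give two colours. Otherwise the part of `B` in
        -- `S` has three boundary colours; none of its boundary nodes lies in `S'`, and only the
        -- colour of `v` can be lost.
        rcases (B.erase v).eq_empty_or_nonempty with hBe | hBe
        · have hBv : B = {v} := by
            refine Finset.Subset.antisymm (fun x hx => ?_) hB
            by_contra hxv
            rw [Finset.mem_singleton] at hxv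
            have : x ∈ B.erase v := Finset.mem_erase.2 ⟨hxv, hx⟩
            simp [hBe] at this
          have hmem : ∀ {x : V}, x ∈ S → H.Adj v x →
              x ∈ (boundary H B ∩ (Finset.univ \ S')).image f := by
            intro x hx hvx
            refine Finset.mem_image.2 ⟨x, ?_, hf.1 x (hSU hx)⟩
            rw [Finset.mem_inter, mem_boundary, hBv]
            exact ⟨⟨by simpa using hvx.ne', v, by simp, hvx⟩,
              by simpa using fun h => hS'S x h hx⟩
          exact Finset.one_lt_card.2 ⟨x₁, hmem hx₁ h₁, x₂, hmem hx₂ h₂, hne⟩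
        · have hBS : B.erase v ⊆ S := by
            intro x hx
            rw [Finset.mem_erase] at hx
            exact (Finset.mem_insert.1 (hBW hx.2)).resolve_left hx.1
          have h3 := hr (B.erase v) (hBS.trans hSU) hBe
          have hsub : (boundary H (B.erase v)).image f ⊆
              insert (f v) ((boundary H B ∩ (Finset.univ \ S')).image f) := by
            intro z hz
            obtain ⟨x, hx, rfl⟩ := Finset.mem_image.1 hz
            rw [mem_boundary] at hx
            obtain ⟨hxB, y, hy, hyx⟩ := hx
            rw [Finset.mem_insert]
            by_cases hxv : x = v
            · exact Or.inl (by rw [hxv])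
            · refine Or.inr (Finset.mem_image_of_mem _ ?_)
              rw [Finset.mem_inter, mem_boundary]
              refine ⟨⟨fun h => hxB (Finset.mem_erase.2 ⟨hxv, h⟩), y, (Finset.mem_erase.1 hy).2,
                hyx⟩, ?_⟩
              simpa using fun h => hsep y (hBS hy) x h hyx
          have h4 := Finset.card_le_card hsub
          have h5 := Finset.card_insert_le (f v) ((boundary H B ∩ (Finset.univ \ S')).image f)
          omega)
  rw [Finset.mem_singleton] at ha₁ ha₂
  subst ha₁
  subst ha₂
  have hb : ∀ {b : V}, b ∈ (Finset.univ \ S') \ insert a₂ S → b ∉ U := by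
    intro b hb
    rw [hU]
    simp only [Finset.mem_sdiff, Finset.mem_univ, true_and, Finset.mem_insert, not_or,
      Finset.mem_union] at hb ⊢
    tauto
  have hl : ∀ {l : List V}, (∀ x ∈ l, x ∈ insert a₂ S \ {a₂}) → ∀ x ∈ l, x ∈ S := by
    intro l hl x hx
    have := hl x hx
    simp only [Finset.mem_sdiff, Finset.mem_insert, Finset.mem_singleton] at this
    tauto
  exact ⟨l₁, b₁, l₂, b₂, hb hb₁, hb hb₂, hne, j₁, j₂, hl hl₁, hl hl₂, hnd⟩

/-- A node that separates `U` into two sides with at most two outer colours each has only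
paths of weight zero to the outside. -/
lemma Vanishes.eq_zero_of_cut (hf : IsColoring U f) (hr : Robust H U f) (h : Vanishes H U f w)
    {v c q y : V} {S S' : Finset V} (hU : U = insert v (S ∪ S')) (hvS : v ∉ S) (hvS' : v ∉ S')
    (hdisj : Disjoint S S') (hsep : ∀ x ∈ S, ∀ y ∈ S', ¬ H.Adj x y)
    (hcq : c ≠ q) (hcy : c ≠ y) (hqy : q ≠ y)
    (hS : ∀ x ∈ S, ∀ b ∉ U, H.Adj x b → f b = c ∨ f b = q)
    (hS' : ∀ x ∈ insert v S', ∀ b ∉ U, H.Adj x b → f b = c ∨ f b = y)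
    {lq ly : List V} {bq byy : V} (hbq : bq ∉ U) (hfbq : f bq = q) (hjq : Joined H v lq bq)
    (hndq : lq.Nodup) (hlq : ∀ x ∈ lq, x ∈ S)
    (hby : byy ∉ U) (hfby : f byy = y) (hjy : Joined H v ly byy)
    (hndy : ly.Nodup) (hly : ∀ x ∈ ly, x ∈ S') :
    ∀ l b, b ∉ U → l.Nodup → (∀ x ∈ l, x ∈ U \ {v}) → Joined H v l b →
      chainWeight w v l b = 0 := by
  have hvU : v ∈ U := by rw [hU]; simp
  have hSU : ∀ x ∈ S, x ∈ U \ {v} := fun x hx => by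
    rw [hU, Finset.mem_sdiff]
    exact ⟨by simp [hx], by simpa using fun h : x = v => hvS (h ▸ hx)⟩
  have hS'U : ∀ x ∈ S', x ∈ U \ {v} := fun x hx => by
    rw [hU, Finset.mem_sdiff]
    exact ⟨by simp [hx], by simpa using fun h : x = v => hvS' (h ▸ hx)⟩
  have hUv : ∀ x ∈ U \ {v}, x ∈ S ∨ x ∈ S' := fun x hx => by
    rw [hU, Finset.mem_sdiff] at hx
    simp only [Finset.mem_insert, Finset.mem_union, Finset.mem_singleton] at hx
    tauto
  have hdis : ∀ l₁ l₂ : List V, l₁.Nodup → l₂.Nodup → (∀ x ∈ l₁, x ∈ S) → (∀ x ∈ l₂, x ∈ S') →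
      (l₁ ++ l₂).Nodup := by
    intro l₁ l₂ h₁ h₂ hl₁ hl₂
    refine List.nodup_append.2 ⟨h₁, h₂, ?_⟩
    rintro x hx z hz rfl
    exact Finset.disjoint_left.1 hdisj (hl₁ x hx) (hl₂ x hz)
  -- paths through one side stay there
  have stayS : ∀ l x b, x ∈ S → b ∉ U → (∀ z ∈ l, z ∈ U \ {v}) → Joined H x l b →
      (∀ z ∈ l, z ∈ S) ∧ (f b = c ∨ f b = q) := by
    intro l
    induction l with
    | nil => intro x b hx hb _ hj; exact ⟨by simp, hS x hx b hb hj⟩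
    | cons z l ih =>
      intro x b hx hb hl hj
      simp only [List.mem_cons, forall_eq_or_imp] at hl ⊢
      have hz : z ∈ S := (hUv z hl.1).resolve_right fun h => hsep x hx z h hj.1
      exact ⟨⟨hz, (ih z b hz hb hl.2 hj.2).1⟩, (ih z b hz hb hl.2 hj.2).2⟩
  have stayS' : ∀ l x b, x ∈ S' → b ∉ U → (∀ z ∈ l, z ∈ U \ {v}) → Joined H x l b →
      (∀ z ∈ l, z ∈ S') ∧ (f b = c ∨ f b = y) := by
    intro l
    induction l with
    | nil => intro x b hx hb _ hj; exact ⟨by simp, hS' x (by simp [hx]) b hb hj⟩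
    | cons z l ih =>
      intro x b hx hb hl hj
      simp only [List.mem_cons, forall_eq_or_imp] at hl ⊢
      have hz : z ∈ S' := (hUv z hl.1).resolve_left fun h => hsep z h x hx hj.1.symm
      exact ⟨⟨hz, (ih z b hz hb hl.2 hj.2).1⟩, (ih z b hz hb hl.2 hj.2).2⟩
  -- Comparison with a reference path on the opposite side shows that every path from `v` with
  -- nonempty interior in `S` weighs `-r`, and every path through `S'`, direct links included,
  -- weighs `r`. It remains to show that `r` is zero.
  set r := chainWeight w v ly byy with hr_def
  have eq₀ : chainWeight w v lq bq + r = 0 :=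
    h.add_eq_zero hvU hbq hby (by rw [hfbq, hfby]; exact hqy) hjq hjy (fun x hx => hSU x (hlq x hx))
      (fun x hx => hS'U x (hly x hx)) (hdis _ _ hndq hndy hlq hly)
  have eqS : ∀ l b, b ∉ U → l ≠ [] → l.Nodup → (∀ x ∈ l, x ∈ S) → Joined H v l b →
      chainWeight w v l b + r = 0 := by
    intro l b hb hl0 hnd hl hj
    have hfb : f b = c ∨ f b = q := by
      obtain _ | ⟨z, l⟩ := l
      · exact absurd rfl hl0
      · exact (stayS l z b (hl z (by simp)) hb (fun x hx => hSU x (hl x (by simp [hx]))) hj.2).2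
    refine h.add_eq_zero hvU hb hby ?_ hj hjy (fun x hx => hSU x (hl x hx))
      (fun x hx => hS'U x (hly x hx)) (hdis _ _ hnd hndy hl hly)
    rw [hfby]
    rcases hfb with h | h <;> rw [h] <;> assumption
  have eqS' : ∀ l b, b ∉ U → l.Nodup → (∀ x ∈ l, x ∈ S') → Joined H v l b →
      chainWeight w v l b = r := by
    intro l b hb hnd hl hj
    have hfb : f b = c ∨ f b = y := by
      obtain _ | ⟨z, l⟩ := l
      · exact hS' v (by simp) b hb hj
      · exact (stayS' l z b (hl z (by simp)) hb (fun x hx => hS'U x (hl x (by simp [hx]))) hj.2).2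
    have := h.add_eq_zero hvU hbq hb ?_ hjq hj (fun x hx => hSU x (hlq x hx))
      (fun x hx => hS'U x (hl x hx)) (hdis _ _ hndq hnd hlq hl)
    · linarith
    · rw [hfbq]
      rcases hfb with h | h <;> rw [h]
      · exact hcq.symm
      · exact hqy
  have hr0 : r = 0 := by
    -- A direct link to the outside weighs both `r` and zero.
    by_cases hdir : ∃ b ∉ U, H.Adj v b
    · obtain ⟨b, hb, hvb⟩ := hdir
      rw [← eqS' [] b hb (by simp) (by simp) hvb]
      exact h.adj_eq_zero hf hr hvU hb hvb
    · push Not at hdir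
      have hl0 : ∀ {l : List V} {b : V}, b ∉ U → Joined H v l b → l ≠ [] := by
        rintro l b hb hj rfl
        exact hdir b hb hj
      have hdeg := hr {v} (by simpa using hvU) (by simp)
      have hNv : ∀ x ∈ boundary H {v}, H.Adj v x ∧ (x ∈ S ∨ x ∈ S') := by
        intro x hx
        simp only [mem_boundary, Finset.mem_singleton, exists_eq_left] at hx
        refine ⟨hx.2, hUv x ?_⟩
        rw [Finset.mem_sdiff, Finset.mem_singleton]
        exact ⟨by_contra fun h => hdir x h hx.2, hx.1⟩
      -- Without direct links, `v` has three neighbours in `U`, hence two on one side. A fan through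
      -- that side consists of two paths of equal weight with sum zero.
      have htwo : (∃ x₁ ∈ S, ∃ x₂ ∈ S, x₁ ≠ x₂ ∧ H.Adj v x₁ ∧ H.Adj v x₂) ∨
          (∃ x₁ ∈ S', ∃ x₂ ∈ S', x₁ ≠ x₂ ∧ H.Adj v x₁ ∧ H.Adj v x₂) := by
        have hc3 : 3 ≤ (boundary H {v}).card := hdeg.trans Finset.card_image_le
        obtain ⟨x₁, h1, x₂, h2, x₃, h3, h12, h13, h23⟩ := Finset.two_lt_card.1 hc3
        obtain ⟨a1, s1⟩ := hNv x₁ h1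
        obtain ⟨a2, s2⟩ := hNv x₂ h2
        obtain ⟨a3, s3⟩ := hNv x₃ h3
        rcases s1 with s1 | s1 <;> rcases s2 with s2 | s2 <;> rcases s3 with s3 | s3
        · exact Or.inl ⟨x₁, s1, x₂, s2, h12, a1, a2⟩
        · exact Or.inl ⟨x₁, s1, x₂, s2, h12, a1, a2⟩
        · exact Or.inl ⟨x₁, s1, x₃, s3, h13, a1, a3⟩
        · exact Or.inr ⟨x₂, s2, x₃, s3, h23, a2, a3⟩
        · exact Or.inl ⟨x₂, s2, x₃, s3, h23, a2, a3⟩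
        · exact Or.inr ⟨x₁, s1, x₃, s3, h13, a1, a3⟩
        · exact Or.inr ⟨x₁, s1, x₂, s2, h12, a1, a2⟩
        · exact Or.inr ⟨x₁, s1, x₂, s2, h12, a1, a2⟩
      rcases htwo with ⟨x₁, hx₁, x₂, hx₂, hne, h₁, h₂⟩ | ⟨x₁, hx₁, x₂, hx₂, hne, h₁, h₂⟩
      · obtain ⟨l₁, b₁, l₂, b₂, hb₁, hb₂, hne, j₁, j₂, hl₁, hl₂, hnd⟩ :=
          exists_linkage_side hf hr hU hvS hvS' hdisj hsep hx₁ hx₂ hne h₁ h₂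
        have e := h.add_eq_zero hvU hb₁ hb₂ hne j₁ j₂ (fun x hx => hSU x (hl₁ x hx))
          (fun x hx => hSU x (hl₂ x hx)) hnd
        obtain ⟨hnd₁, hnd₂, -⟩ := List.nodup_append.1 hnd
        have e₁ := eqS l₁ b₁ hb₁ (hl0 hb₁ j₁) hnd₁ hl₁ j₁
        have e₂ := eqS l₂ b₂ hb₂ (hl0 hb₂ j₂) hnd₂ hl₂ j₂
        linarith
      · obtain ⟨l₁, b₁, l₂, b₂, hb₁, hb₂, hne, j₁, j₂, hl₁, hl₂, hnd⟩ :=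
          exists_linkage_side hf hr (by rw [hU, Finset.union_comm]) hvS' hvS hdisj.symm
            (fun x hx y hy hxy => hsep y hy x hx hxy.symm) hx₁ hx₂ hne h₁ h₂
        have e := h.add_eq_zero hvU hb₁ hb₂ hne j₁ j₂ (fun x hx => hS'U x (hl₁ x hx))
          (fun x hx => hS'U x (hl₂ x hx)) hnd
        obtain ⟨hnd₁, hnd₂, -⟩ := List.nodup_append.1 hnd
        have e₁ := eqS' l₁ b₁ hb₁ hnd₁ hl₁ j₁
        have e₂ := eqS' l₂ b₂ hb₂ hnd₂ hl₂ j₂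
        linarith
  intro l b hb hnd hl hj
  obtain _ | ⟨z, l⟩ := l
  · rw [eqS' [] b hb hnd (by simp) hj, hr0]
  · rcases hUv z (hl z (by simp)) with hz | hz
    · have hl' : ∀ x ∈ z :: l, x ∈ S := by
        intro x hx
        rcases List.mem_cons.1 hx with rfl | hx
        · exact hz
        · exact (stayS l z b hz hb (fun x hx => hl x (by simp [hx])) hj.2).1 x hx
      have := eqS _ b hb (by simp) hnd hl' hj
      linarith
    · have hl' : ∀ x ∈ z :: l, x ∈ S' := by
        intro x hx
        rcases List.mem_cons.1 hx with rfl | hx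
        · exact hz
        · exact (stayS' l z b hz hb (fun x hx => hl x (by simp [hx])) hj.2).1 x hx
      rw [eqS' _ b hb hnd hl' hj, hr0]

/-- If absorbing a maximal set with three boundary colours destroys robustness, then some node of
`U` has only paths of weight zero to the outside. -/
lemma Vanishes.exists_eq_zero_of_not_robust (hf : IsColoring U f) (hr : Robust H U f)
    (h : Vanishes H U f w) {A : Finset V} {c : V} (hAU : A ⊆ U) (hcU : c ∉ U)
    (hcard : ((boundary H A).image f).card = 3) (hc : c ∈ (boundary H A).image f)
    (hmax : ∀ B, A ⊂ B → B ⊂ U → ((boundary H B).image f).card = 3 →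
      c ∉ (boundary H B).image f)
    (hnot : ¬ Robust H (U \ A) (fun x => if x ∈ A then c else f x)) :
    ∃ v ∈ U, ∀ l b, b ∉ U → l.Nodup → (∀ x ∈ l, x ∈ U \ {v}) → Joined H v l b →
      chainWeight w v l b = 0 := by
  set f' : V → V := fun x => if x ∈ A then c else f x with hf'
  have hf'n : ∀ {x}, x ∉ A → f' x = f x := fun {x} hx => by simp [hf', hx]
  unfold Robust at hnot
  push Not at hnot
  obtain ⟨A', hA'U, hA'ne, hA'c⟩ := hnot
  have hA'A : ∀ x ∈ A', x ∈ U ∧ x ∉ A := fun x hx => Finset.mem_sdiff.1 (hA'U hx)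
  -- If `A'` had no neighbour in `A`, its boundary colours would be unchanged by the absorption.
  obtain ⟨v, hv, a₀, ha₀, hva⟩ : ∃ v ∈ A', ∃ a ∈ A, H.Adj v a := by
    by_contra! hcon
    refine absurd (hr A' (fun x hx => (hA'A x hx).1) hA'ne) (not_le.2 ?_)
    convert hA'c using 2
    refine Finset.image_congr fun x hx => (hf'n fun hxA => ?_).symm
    obtain ⟨-, y, hy, hyx⟩ := mem_boundary.1 hx
    exact hcon y hy x hxA hyx
  obtain ⟨hvU, hvA⟩ := hA'A v hv
  have hvN : v ∈ boundary H A := mem_boundary.2 ⟨hvA, a₀, ha₀, hva.symm⟩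
  have hcN : c ∈ (boundary H A').image f' :=
    Finset.mem_image.2 ⟨a₀, mem_boundary.2 ⟨fun h => (hA'A _ h).2 ha₀, v, hv, hva⟩,
      by simp [hf', ha₀]⟩
  have hvX : v ∈ (boundary H A).image f := Finset.mem_image.2 ⟨v, hvN, hf.1 v hvU⟩
  have hvc : v ≠ c := fun h => hcU (h ▸ hvU)
  -- The three boundary colours of `A` are `c`, `v` and `q`.
  obtain ⟨q, hq⟩ : ∃ q, (((boundary H A).image f).erase c).erase v = {q} := by
    rw [← Finset.card_eq_one, Finset.card_erase_of_mem (Finset.mem_erase.2 ⟨hvc, hvX⟩),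
      Finset.card_erase_of_mem hc, hcard]
  have hqm : q ≠ v ∧ q ≠ c ∧ q ∈ (boundary H A).image f := by
    have : q ∈ (((boundary H A).image f).erase c).erase v := by rw [hq]; simp
    simpa [Finset.mem_erase] using this
  have hX : ∀ x ∈ boundary H A, x = v ∨ f x = c ∨ f x = q := by
    intro x hx
    by_contra! hcon
    have hfx : f x ≠ v := fun h => hcon.1 (hf.eq_of_mem hvU h)
    have : f x ∈ (((boundary H A).image f).erase c).erase v :=
      Finset.mem_erase.2 ⟨hfx, Finset.mem_erase.2 ⟨hcon.2.1, Finset.mem_image_of_mem _ hx⟩⟩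
    rw [hq, Finset.mem_singleton] at this
    exact hcon.2.2 this
  -- Passing from `A'` to `A ∪ A'` can add only the colour `q`. So the union has exactly three
  -- boundary colours, among them `c`, and maximality of `A` leaves only `A ∪ A' = U`.
  have hsub : (boundary H (A ∪ A')).image f ⊆ insert q ((boundary H A').image f') := by
    intro z hz
    obtain ⟨x, hx, rfl⟩ := Finset.mem_image.1 hz
    obtain ⟨hxn, y, hy, hyx⟩ := mem_boundary.1 hx
    rw [Finset.mem_union, not_or] at hxn
    rw [Finset.mem_insert]
    rcases Finset.mem_union.1 hy with hy | hy
    · rcases hX x (mem_boundary.2 ⟨hxn.1, y, hy, hyx⟩) with rfl | h | h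
      · exact absurd hv hxn.2
      · right; rw [h]; exact hcN
      · exact Or.inl h
    · right
      exact Finset.mem_image.2 ⟨x, mem_boundary.2 ⟨hxn.2, y, hy, hyx⟩, hf'n hxn.1⟩
  have hAA'U : A ∪ A' ⊆ U := Finset.union_subset hAU fun x hx => (hA'A x hx).1
  have h3 := hr (A ∪ A') hAA'U ⟨v, by simp [hv]⟩
  have hins := Finset.card_insert_le q ((boundary H A').image f')
  have hle := Finset.card_le_card hsub
  have heq := Finset.eq_of_subset_of_card_le hsub (by omega)
  have hqn : q ∉ (boundary H A').image f' := by
    intro hq'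
    rw [Finset.insert_eq_of_mem hq'] at hle
    omega
  have hc2 : ((boundary H A').image f').card = 2 := by omega
  have hUeq : A ∪ A' = U := by
    by_contra hne
    refine hmax (A ∪ A') ?_ (Finset.ssubset_iff_subset_ne.2 ⟨hAA'U, hne⟩) (by omega)
      (by rw [heq]; simp [hcN])
    refine Finset.ssubset_iff_subset_ne.2 ⟨Finset.subset_union_left, fun h => hvA ?_⟩
    rw [h]; simp [hv]
  obtain ⟨y, hy⟩ : ∃ y, ((boundary H A').image f').erase c = {y} := by
    rw [← Finset.card_eq_one, Finset.card_erase_of_mem hcN, hc2]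
  have hym : y ≠ c ∧ y ∈ (boundary H A').image f' := by
    have : y ∈ ((boundary H A').image f').erase c := by rw [hy]; simp
    simpa [Finset.mem_erase] using this
  have hqy : q ≠ y := fun h => hqn (h ▸ hym.2)
  have hY : ∀ x ∈ boundary H A', x ∉ A → f x = c ∨ f x = y := by
    intro x hx hxA
    by_contra! hcon
    have : f' x ∈ ((boundary H A').image f').erase c := by
      refine Finset.mem_erase.2 ⟨?_, Finset.mem_image_of_mem _ hx⟩
      rw [hf'n hxA]; exact hcon.1
    rw [hy, Finset.mem_singleton, hf'n hxA] at this
    exact hcon.2 this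
  have hqU : q ∉ U := by
    intro hqU
    have : q ∈ (boundary H (A ∪ A')).image f := by rw [heq]; simp
    obtain ⟨z, hz, hzq⟩ := Finset.mem_image.1 this
    obtain rfl := hf.eq_of_mem hqU hzq
    exact (mem_boundary.1 hz).1 (hUeq ▸ hqU)
  obtain ⟨zy, hzy, hfzy⟩ := Finset.mem_image.1 hym.2
  have hzyA : zy ∉ A := fun hA => hym.1 (by rw [← hfzy]; simp [hf', hA])
  have hzyU : zy ∉ U := by
    rw [← hUeq, Finset.mem_union, not_or]
    exact ⟨hzyA, (mem_boundary.1 hzy).1⟩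
  rw [hf'n hzyA] at hfzy
  have hyU : y ∉ U := hfzy ▸ hf.2 zy hzyU
  have hsep : ∀ x ∈ A, ∀ z ∈ A' \ {v}, ¬ H.Adj x z := by
    intro x hx z hz hxz
    rw [Finset.mem_sdiff, Finset.mem_singleton] at hz
    have hzU := (hA'A z hz.1).1
    rcases hX z (mem_boundary.2 ⟨(hA'A z hz.1).2, x, hx, hxz⟩) with h | h | h
    · exact hz.2 h
    · rw [hf.1 z hzU] at h; exact hcU (h ▸ hzU)
    · rw [hf.1 z hzU] at h; exact hqU (h ▸ hzU)
  obtain ⟨lq, bq, ⟨hbq, hfbq⟩, hjq, hndq, hlq⟩ :=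
    exists_joined_of_mem_image hf hr hAU hcard.le hqU hqm.2.2 hvN
  obtain ⟨ly, b', ⟨hb', hfb'⟩, hjy, hndy, hly⟩ :=
    exists_joined H (A' \ {v}) v (fun z => z ∉ U ∧ f z = y) (by
      intro Y hYA hY1 hY2
      -- The nodes of `A' \ {v}` outside `Y` see only the colours `c` and `y`, so by robustness
      -- there are none.
      have hYeq : A' \ {v} ⊆ Y := by
        by_contra hcon
        have hne : ((A' \ {v}) \ Y).Nonempty := by
          rwa [Finset.sdiff_nonempty]
        have hsubA' : (A' \ {v}) \ Y ⊆ A' := Finset.sdiff_subset.trans Finset.sdiff_subset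
        have h3 := hr ((A' \ {v}) \ Y) (fun x hx => (hA'A x (hsubA' hx)).1) hne
        have : (boundary H ((A' \ {v}) \ Y)).image f ⊆ {c, y} := by
          intro z hz
          obtain ⟨x, hx, rfl⟩ := Finset.mem_image.1 hz
          obtain ⟨hxn, a, ha, hax⟩ := mem_boundary.1 hx
          rw [Finset.mem_sdiff] at ha hxn
          have hxv : x ≠ v := by
            rintro rfl
            exact ha.2 (hY1 a ha.1 hax.symm)
          have hxA' : x ∉ A' := by
            intro hxA'
            have hxW : x ∈ A' \ {v} := by simp [hxA', hxv]
            have hxY : x ∈ Y := by_contra fun h => hxn ⟨hxW, h⟩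
            exact ha.2 (hY2 x hxY a ha.1 hax.symm)
          have hxA : x ∉ A := fun hxA => hsep x hxA a ha.1 hax.symm
          simpa using hY x (mem_boundary.2 ⟨hxA', a, (Finset.mem_sdiff.1 ha.1).1, hax⟩) hxA
        have h4 := (Finset.card_le_card this).trans Finset.card_le_two
        omega
      obtain ⟨-, a, ha, haz⟩ := mem_boundary.1 hzy
      refine ⟨zy, ⟨hzyU, hfzy⟩, ?_⟩
      by_cases hav : a = v
      · exact Or.inl (hav ▸ haz)
      · exact Or.inr ⟨a, hYeq (by simp [ha, hav]), haz⟩)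
  -- Thus `v` separates `U` into `A`, with outer colours among `c` and `q`, and `A' \ {v}`, with
  -- outer colours among `c` and `y`.
  refine ⟨v, hvU, Vanishes.eq_zero_of_cut hf hr h (S := A) (S' := A' \ {v}) (c := c) (q := q)
    (y := y) ?_ hvA (by simp) ?_ hsep hqm.2.1.symm hym.1.symm hqy ?_ ?_ hbq hfbq hjq hndq hlq
    hb' hfb' hjy hndy hly⟩
  · rw [← hUeq]
    ext x
    by_cases hxv : x = v <;> simp [hxv, hv]
  · rw [Finset.disjoint_left]
    exact fun x hx hx' => (hA'A x (Finset.mem_sdiff.1 hx').1).2 hx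
  · intro x hx b hb hxb
    rcases hX b (mem_boundary.2 ⟨fun h => hb (hAU h), x, hx, hxb⟩) with rfl | h
    · exact absurd hvU hb
    · exact h
  · intro x hx b hb hxb
    have hx' : x ∈ A' := by
      rcases Finset.mem_insert.1 hx with rfl | h
      · exact hv
      · exact (Finset.mem_sdiff.1 h).1
    exact hY b (mem_boundary.2 ⟨fun h => hb (hA'A b h).1, x, hx', hxb⟩) fun h => hb (hAU h)

open Classical in
/-- If every nonempty subset of `U` has boundary nodes of three colours, and all paths through `U`
between different colours have weight zero, then so has every link that meets `U`. -/
theorem Vanishes.eq_zero (H : SimpleGraph V) : ∀ (U : Finset V) (f : V → V) (w : Sym2 V → ℝ),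
    IsColoring U f → Robust H U f → Vanishes H U f w →
      ∀ u ∈ U, ∀ x, H.Adj u x → w s(u, x) = 0 := by
  intro U
  induction hn : U.card using Nat.strong_induction_on generalizing U with
  | _ n ih =>
  intro f w hf hr h u hu x hux
  have ih' : ∀ W : Finset V, W ⊂ U → ∀ (f : V → V) (w : Sym2 V → ℝ), IsColoring W f →
      Robust H W f → Vanishes H W f w → ∀ u ∈ W, ∀ x, H.Adj u x → w s(u, x) = 0 :=
    fun W hW => ih W.card (hn ▸ Finset.card_lt_card hW) W rfl
  have hedge : ∀ v ∈ U, (∀ u ∈ U \ {v}, ∀ x, H.Adj u x → w s(u, x) = 0) →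
      w s(u, x) = 0 := by
    intro v hv hW
    by_cases hxU : x ∈ U
    · by_cases huv : u = v
      · rw [Sym2.eq_swap]
        exact hW x (by simp [hxU, huv ▸ hux.ne']) u hux.symm
      · exact hW u (by simp [hu, huv]) x hux
    · exact h.adj_eq_zero hf hr hu hxU hux
  have hsd : ∀ v ∈ U, U \ {v} ⊂ U := fun v hv =>
    Finset.sdiff_ssubset (by simpa using hv) (by simp)
  -- A node with only zero paths to the outside is released as a private colour. When no such node
  -- exists, a node next to the outside is recoloured, unless this destroys robustness.
  by_cases hgood : ∃ v ∈ U, ∀ l b, b ∉ U → l.Nodup → (∀ x ∈ l, x ∈ U \ {v}) → Joined H v l b →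
      chainWeight w v l b = 0
  · obtain ⟨v, hv, hgood⟩ := hgood
    exact hedge v hv (ih' _ (hsd v hv) f w (hf.mono Finset.sdiff_subset)
      (hr.mono Finset.sdiff_subset) (h.erase hgood))
  obtain ⟨m, hm⟩ : (boundary H U).Nonempty := by
    rw [← Finset.image_nonempty (f := f), ← Finset.card_pos]
    have := hr U le_rfl ⟨u, hu⟩
    omega
  obtain ⟨hmU, v, hv, hvm⟩ := mem_boundary.1 hm
  have hfm : f m ∉ U := hf.2 m hmU
  by_cases hrob : Robust H (U \ {v}) (fun x => if x ∈ ({v} : Finset V) then f m else f x)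
  · exact hedge v hv (ih' _ (hsd v hv) _ w (hf.recolor hfm) hrob
      (h.recolor hv hmU hvm (h.adj_eq_zero hf hr hv hmU hvm)))
  -- a proper subset with exactly three boundary colours
  have htight : ∃ A, A ⊂ U ∧ A.Nonempty ∧ ((boundary H A).image f).card = 3 ∧
      f m ∈ (boundary H A).image f := by
    unfold Robust at hrob
    push Not at hrob
    obtain ⟨A, hA, hAne, hAc⟩ := hrob
    have hAU : A ⊆ U := hA.trans Finset.sdiff_subset
    have h3 := hr A hAU hAne
    set f' : V → V := fun x => if x ∈ ({v} : Finset V) then f m else f x with hf'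
    -- The recolouring can only merge the colour `v` into `f m`. Since fewer than three colours
    -- remain, there were exactly three, and both `v` and `f m` occurred.
    have hsub : (boundary H A).image f ⊆ insert v ((boundary H A).image f') := by
      intro z hz
      obtain ⟨x, hx, rfl⟩ := Finset.mem_image.1 hz
      rw [Finset.mem_insert]
      by_cases hxv : x = v
      · left; rw [hxv, hf.1 v hv]
      · right; exact Finset.mem_image.2 ⟨x, hx, by simp [hf', hxv]⟩
    have h4 := Finset.card_le_card hsub
    have h5 := Finset.card_insert_le v ((boundary H A).image f')
    have heq := Finset.eq_of_subset_of_card_le hsub (by omega)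
    have hvN : v ∈ boundary H A := by
      have : v ∈ (boundary H A).image f := by rw [heq]; simp
      obtain ⟨z, hz, hzv⟩ := Finset.mem_image.1 this
      exact hf.eq_of_mem hv hzv ▸ hz
    refine ⟨A, hA.trans_ssubset (hsd v hv), hAne, by omega, ?_⟩
    rw [heq]
    exact Finset.mem_insert_of_mem (Finset.mem_image.2 ⟨v, hvN, by simp [hf']⟩)
  obtain ⟨A, hA, hAmax⟩ := Finset.exists_max_image
    (U.powerset.filter fun A => A ⊂ U ∧ A.Nonempty ∧ ((boundary H A).image f).card = 3 ∧
      f m ∈ (boundary H A).image f) Finset.card (by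
      obtain ⟨A, hA⟩ := htight
      exact ⟨A, Finset.mem_filter.2 ⟨Finset.mem_powerset.2 hA.1.subset, hA⟩⟩)
  obtain ⟨-, hAU, hAne, hAc, hAm⟩ := Finset.mem_filter.1 hA
  -- Either the induction hypothesis applies separately to `A` and to `U \ A`, or the maximality of
  -- `A` yields a cut node of the kind excluded by `hgood`.
  by_cases hrobA : Robust H (U \ A) (fun x => if x ∈ A then f m else f x)
  · have habs : Absorbable H U f A (f m) := ⟨hAU.subset, hAne, hfm, hAc, hAm, hrobA⟩
    have hin := ih' A hAU f w (hf.mono hAU.subset) (hr.mono hAU.subset)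
      (habs.vanishes_inner hf hr h)
    have hout := ih' (U \ A) (Finset.sdiff_ssubset hAU.subset hAne) _ _ (hf.recolor hfm) hrobA
      (habs.vanishes_outer hf hr h)
    by_cases huA : u ∈ A
    · exact hin u huA x hux
    by_cases hxA : x ∈ A
    · rw [Sym2.eq_swap]; exact hin x hxA u hux.symm
    have := hout u (Finset.mem_sdiff.2 ⟨hu, huA⟩) x hux
    rwa [if_neg] at this
    rintro ⟨z, hz, hzm⟩
    rcases Sym2.mem_iff.1 hzm with rfl | rfl
    · exact huA hz
    · exact hxA hz
  · refine absurd (Vanishes.exists_eq_zero_of_not_robust hf hr h hAU.subset hfm hAc hAm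
      (fun B hAB hBU hBc hBm => ?_) hrobA) hgood
    have := hAmax B (Finset.mem_filter.2 ⟨Finset.mem_powerset.2 hBU.subset, hBU,
      hAne.mono hAB.subset, hBc, hBm⟩)
    exact absurd (Finset.card_lt_card hAB) (not_lt.2 this)

end Core

/-! ### The boundary criterion for identifiability -/

section Identifiability

lemma Joined.exists_walk {V : Type*} {H : SimpleGraph V} {a b : V} {l : List V}
    (h : Joined H a l b) :
    ∃ p : H.Walk a b, p.support = a :: (l ++ [b]) ∧
      ∀ w, pathMetric w p = chainWeight w a l b := by
  induction l generalizing a with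
  | nil =>
    rw [joined_nil] at h
    exact ⟨SimpleGraph.Walk.cons h .nil, by simp, fun w => by simp [pathMetric]⟩
  | cons x l ih =>
    obtain ⟨p, hp, hw⟩ := ih h.2
    exact ⟨SimpleGraph.Walk.cons h.1 p, by simp [hp], fun w => by
      rw [chainWeight_cons, ← hw]; simp [pathMetric]⟩

lemma chainWeight_sub {V : Type*} (w w' : Sym2 V → ℝ) (a : V) (l : List V) (b : V) :
    chainWeight (fun e => w e - w' e) a l b = chainWeight w a l b - chainWeight w' a l b := by
  induction l generalizing a with
  | nil => rfl
  | cons x l ih => simp only [chainWeight_cons, ih]; ring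

/-- The link metric that is `1` on the links from `p` to `A` and `-1` on the other links that leave
`A`. -/
noncomputable def crossingWeight {V : Type*} [DecidableEq V] (A : Finset V) (p : V) : Sym2 V → ℝ :=
  Sym2.lift ⟨fun x y => if x ∈ A ∧ y ∉ A then (if y = p then 1 else -1)
    else if y ∈ A ∧ x ∉ A then (if x = p then 1 else -1) else 0, by
      intro x y
      by_cases hx : x ∈ A <;> by_cases hy : y ∈ A <;> simp [hx, hy]⟩

lemma crossingWeight_mk {V : Type*} [DecidableEq V] (A : Finset V) (p x y : V) : crossingWeight A p s(x, y) =
    if x ∈ A ∧ y ∉ A then (if y = p then 1 else -1)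
    else if y ∈ A ∧ x ∉ A then (if x = p then 1 else -1) else 0 := rfl

variable {V : Type*} [Fintype V] [DecidableEq V] {G : SimpleGraph V}

/-- If every nonempty set without monitors has at least three boundary nodes, then all link
metrics are identifiable. -/
theorem identifiesAllLinks_of_boundary {M : Finset V}
    (h : ∀ A : Finset V, A.Nonempty → Disjoint A M → 3 ≤ (boundary G A).card) :
    IdentifiesAllLinks G M := by
  intro e he w w' hww'
  induction e using Sym2.ind with
  | _ u x =>
  rw [SimpleGraph.mem_edgeSet] at he
  -- Initially the outer nodes are the monitors, each with its own colour.
  have hv : Vanishes G (Finset.univ \ M) id (fun e => w e - w' e) := by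
    intro a l b ha hb hne hl0 hnd hl hj
    simp only [Finset.mem_sdiff, Finset.mem_univ, true_and, not_not] at ha hb hl
    obtain ⟨p, hp, hw⟩ := hj.exists_walk
    have hpath : p.IsPath := by
      rw [SimpleGraph.Walk.isPath_def, hp, List.nodup_cons, List.nodup_append]
      refine ⟨?_, hnd, by simp, ?_⟩
      · rw [List.mem_append, List.mem_singleton]
        rintro (h | h)
        · exact hl a h ha
        · exact hne h
      · rintro x hx y hy rfl
        exact hl x hx (List.mem_singleton.1 hy ▸ hb)
    have := hww' a ha b hb hne p hpath
    rw [chainWeight_sub, ← hw, ← hw, this, sub_self]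
  have hr : Robust G (Finset.univ \ M) id := by
    intro A hA hne
    rw [Finset.image_id]
    refine h A hne (Finset.disjoint_left.2 fun x hx hxM => ?_)
    exact (Finset.mem_sdiff.1 (hA hx)).2 hxM
  have key := Vanishes.eq_zero G _ id _ ⟨fun _ _ => rfl, fun _ hx => hx⟩ hr hv
  -- A link between two monitors does not meet the inner set, but it is itself a measured path.
  by_cases hu : u ∈ M
  · by_cases hx : x ∈ M
    · have := hww' u hu x hx he.ne (SimpleGraph.Walk.cons he .nil) (by simp [he.ne])
      simpa [pathMetric] using this
    · rw [Sym2.eq_swap]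
      have := key x (by simp [hx]) u he.symm
      linarith
  · have := key u (by simp [hu]) x he
    linarith

/-- A path that ends outside `A` crosses the links at `p` and the other boundary node equally
often, up to its start. -/
lemma pathMetric_crossingWeight {A : Finset V} {p : V}
    (hsub : ∀ x ∈ boundary G A, ∀ y ∈ boundary G A, x ≠ p → y ≠ p → x = y)
    {u v : V} (q : G.Walk u v) (hq : q.IsPath) (hv : v ∉ A) :
    (u ∉ A → pathMetric (crossingWeight A p) q = 0) ∧
    (u ∈ A → p ∉ q.support → pathMetric (crossingWeight A p) q = -1) ∧
    (u ∈ A → (∀ x ∈ boundary G A, x ≠ p → x ∉ q.support) →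
      pathMetric (crossingWeight A p) q = 1) := by
  -- The three claims support each other: a simple path that steps into `A` from one boundary node
  -- cannot use that node again, so it leaves through the other, and the contributions cancel.
  induction q with
  | nil => exact ⟨fun _ => by simp [pathMetric], fun h => absurd h hv, fun h => absurd h hv⟩
  | @cons u x v hux q ih =>
    rw [SimpleGraph.Walk.cons_isPath_iff] at hq
    obtain ⟨ih1, ih2, ih3⟩ := ih hq.1 hv
    have hcons : pathMetric (crossingWeight A p) (SimpleGraph.Walk.cons hux q) =
        crossingWeight A p s(u, x) + pathMetric (crossingWeight A p) q := by simp [pathMetric]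
    rw [hcons, crossingWeight_mk]
    refine ⟨fun hu => ?_, fun hu hp => ?_, fun hu hp => ?_⟩
    · by_cases hx : x ∈ A
      · have huN : u ∈ boundary G A := mem_boundary.2 ⟨hu, x, hx, hux.symm⟩
        by_cases hup : u = p
        · rw [ih2 hx (hup ▸ hq.2)]
          simp [hx, hup ▸ hu, hup]
        · rw [ih3 hx fun y hy hyp => hsub u huN y hy hup hyp ▸ hq.2]
          simp [hu, hx, hup]
      · rw [ih1 hx]
        simp [hu, hx]
    · rw [SimpleGraph.Walk.support_cons, List.mem_cons, not_or] at hp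
      by_cases hx : x ∈ A
      · rw [ih2 hx hp.2]; simp [hu, hx]
      · have hxp : x ≠ p := fun h => hp.2 (h ▸ q.start_mem_support)
        rw [ih1 hx]; simp [hu, hx, hxp]
    · have hp' : ∀ y ∈ boundary G A, y ≠ p → y ∉ q.support := fun y hy hyp h =>
        hp y hy hyp (by simp [h])
      by_cases hx : x ∈ A
      · rw [ih3 hx hp']; simp [hu, hx]
      · have hxp : x = p := by
          by_contra h
          exact hp' x (mem_boundary.2 ⟨hx, u, hu, hux⟩) h q.start_mem_support
        rw [ih1 hx]
        subst hxp
        simp [hu, hx]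

lemma eq_univ_of_boundary_eq_empty (hG : G.Connected) {A : Finset V} (hA : A.Nonempty)
    (h : boundary G A = ∅) : A = Finset.univ := by
  obtain ⟨a, ha⟩ := hA
  refine Finset.eq_univ_iff_forall.2 fun x => ?_
  obtain ⟨p⟩ := hG.preconnected a x
  induction p with
  | nil => exact ha
  | @cons u v _ huv p ih =>
    refine ih ?_
    by_contra hv
    have : v ∈ boundary G A := mem_boundary.2 ⟨hv, u, ha, huv⟩
    simp [h] at this

/-- Every nonempty set without monitors has at least three boundary nodes if all link metrics are
identifiable. -/
theorem IdentifiesAllLinks.three_le_card_boundary (hG : G.Connected) (hV : 2 ≤ Fintype.card V)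
    {M : Finset V} (hM : IdentifiesAllLinks G M) {A : Finset V} (hA : A.Nonempty)
    (hAM : Disjoint A M) : 3 ≤ (boundary G A).card := by
  by_contra! hlt
  -- An empty boundary means that `A` is everything; then there are no monitors and no measurements,
  -- yet there is a link.
  rcases (boundary G A).eq_empty_or_nonempty with hemp | ⟨p, hp⟩
  · have hAu := eq_univ_of_boundary_eq_empty hG hA hemp
    have : Nontrivial V := Fintype.one_lt_card_iff_nontrivial.1 hV
    obtain ⟨a, ha⟩ := hA
    obtain ⟨x, hx⟩ := hG.preconnected.exists_adj_of_nontrivial a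
    have := hM s(a, x) hx (fun _ => 0) (fun _ => 1) fun u hu => by
      exact absurd hu (Finset.disjoint_left.1 hAM (by rw [hAu]; simp))
    simp at this
  · obtain ⟨hpA, a, ha, hap⟩ := mem_boundary.1 hp
    have hsub : ∀ x ∈ boundary G A, ∀ y ∈ boundary G A, x ≠ p → y ≠ p → x = y := by
      intro x hx y hy hxp hyp
      by_contra hxy
      exact absurd (Finset.two_lt_card.2 ⟨x, hx, y, hy, p, hp, hxy, hxp, hyp⟩) (by omega)
    -- All measurements of the crossing weight are zero, while the link `ap` has weight 1.
    have := hM s(a, p) hap (crossingWeight A p) (fun _ => 0) (by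
      intro u hu v hv _ q hq
      have hn : ∀ {x}, x ∈ M → x ∉ A := fun hx hxA => Finset.disjoint_left.1 hAM hxA hx
      rw [(pathMetric_crossingWeight hsub q hq (hn hv)).1 (hn hu)]
      simp [pathMetric])
    rw [crossingWeight_mk] at this
    simp [ha, hpA] at this

/-- A set whose boundary lies in `K` contains enough monitors. -/
lemma IdentifiesAllLinks.three_le_card_add (hG : G.Connected) (hV : 2 ≤ Fintype.card V)
    {M : Finset V} (hM : IdentifiesAllLinks G M) {X K : Finset V} (hXK : boundary G X ⊆ K)
    (hcard : 3 ≤ K.card + X.card) : 3 ≤ K.card + (M ∩ X).card := by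
  -- If `X \ M` is nonempty, the criterion applies to it, and its boundary lies in `K ∪ (M ∩ X)`.
  rcases (X \ M).eq_empty_or_nonempty with hemp | hne
  · rw [Finset.sdiff_eq_empty_iff_subset] at hemp
    rwa [Finset.inter_eq_right.2 hemp]
  · refine (hM.three_le_card_boundary hG hV hne Finset.sdiff_disjoint).trans
      ((Finset.card_le_card fun x hx => ?_).trans (Finset.card_union_le _ _))
    obtain ⟨hx, a, ha, hax⟩ := mem_boundary.1 hx
    rw [Finset.mem_sdiff] at hx ha
    rw [Finset.mem_union, Finset.mem_inter]
    by_cases hxX : x ∈ X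
    · right; exact ⟨by_contra fun h => hx ⟨hxX, h⟩, hxX⟩
    · left; exact hXK (mem_boundary.2 ⟨hxX, a, ha.1, hax⟩)

end Identifiability

/-! ## Connectivity in terms of closed sets -/

section Connectivity

/-- `Y` contains all its neighbours in `W`. -/
def ClosedIn {V : Type*} (H : SimpleGraph V) (W Y : Finset V) : Prop :=
  ∀ u ∈ Y, ∀ v ∈ W, H.Adj u v → v ∈ Y

/-- The subgraph induced on `W` is empty or connected. -/
def Linked {V : Type*} (H : SimpleGraph V) (W : Finset V) : Prop :=
  ∀ Y ⊆ W, Y.Nonempty → ClosedIn H W Y → W ⊆ Y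

variable {V : Type*}

lemma preconnected_induce_iff (H : SimpleGraph V) (W : Finset V) :
    (H.induce (W : Set V)).Preconnected ↔ Linked H W := by
  classical
  constructor
  · rintro h Y hY ⟨y, hy⟩ hcl x hx
    obtain ⟨p⟩ := h ⟨y, hY hy⟩ ⟨x, hx⟩
    have key : ∀ (a b : (W : Set V)) (_ : (H.induce (W : Set V)).Walk a b), a.1 ∈ Y → b.1 ∈ Y := by
      intro a b q
      induction q with
      | nil => exact id
      | @cons u v w huv q ih => exact fun hu => ih (hcl u.1 hu v.1 v.2 huv)
    exact key _ _ p hy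
  · rintro h ⟨u, hu⟩ ⟨v, hv⟩
    have := h (W.filter fun x => ∃ hx : x ∈ W,
        (H.induce (W : Set V)).Reachable ⟨u, hu⟩ ⟨x, hx⟩) (Finset.filter_subset _ _)
      ⟨u, Finset.mem_filter.2 ⟨hu, hu, .refl _⟩⟩ (by
        intro x hx y hy hxy
        rw [Finset.mem_filter] at hx ⊢
        obtain ⟨-, hxW, hr⟩ := hx
        refine ⟨hy, hy, hr.trans (SimpleGraph.Adj.reachable ?_)⟩
        exact hxy) hv
    exact (Finset.mem_filter.1 this).2.2

lemma linked_univ [Fintype V] {G : SimpleGraph V} (hG : G.Connected) : Linked G Finset.univ := by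
  classical
  intro Y _ hne hcl
  rw [eq_univ_of_boundary_eq_empty hG hne]
  refine Finset.eq_empty_of_forall_notMem fun x hx => ?_
  obtain ⟨hxY, a, ha, hax⟩ := mem_boundary.1 hx
  exact hxY (hcl a ha x (Finset.mem_univ x) hax)

lemma mem_cutVertices [Fintype V] {G : SimpleGraph V} {v : V} : v ∈ cutVertices G ↔ IsCutVertex G v := by simp [cutVertices]

variable [DecidableEq V]

lemma isCutVertex_iff [Fintype V] {G : SimpleGraph V} {v : V} :
    IsCutVertex G v ↔ ¬ Linked G (Finset.univ \ {v}) := by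
  rw [IsCutVertex, ← preconnected_induce_iff]
  have : ((Finset.univ \ {v} : Finset V) : Set V) = ({v}ᶜ : Set V) := by
    ext; simp
  rw [this]

lemma isTwoVertexCut_iff {G : SimpleGraph V} {B : Finset V} {a b : V} :
    IsTwoVertexCut G B a b ↔ a ∈ B ∧ b ∈ B ∧ a ≠ b ∧ ¬ Linked G (B \ {a, b}) := by
  rw [IsTwoVertexCut, preconnected_induce_iff]

/-- The subgraph induced on `U` stays connected (or becomes empty) after the deletion of fewer than
`k` nodes. -/
def KLinked (H : SimpleGraph V) (k : ℕ) (U : Finset V) : Prop :=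
  ∀ S : Finset V, S.card < k → Linked H (U \ S)

lemma ClosedIn.sdiff {H : SimpleGraph V} {W Y : Finset V} (h : ClosedIn H W Y) :
    ClosedIn H W (W \ Y) := by
  intro u hu v hv huv
  rw [Finset.mem_sdiff] at hu ⊢
  exact ⟨hv, fun hvY => hu.2 (h v hvY u hu.1 huv.symm)⟩

/-- In a set of at most `k` nodes all but two nodes may be deleted, and linkedness of the remaining
pair means adjacency. So both alternatives amount to the single condition `KLinked`. -/
lemma isConnectedPiece_iff {H : SimpleGraph V} {k : ℕ} (hk : 0 < k) {U : Finset V} :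
    IsConnectedPiece H k U ↔ U.Nonempty ∧ KLinked H k U := by
  constructor
  · rintro (⟨hc, h⟩ | ⟨hne, hc, hcl⟩)
    · refine ⟨Finset.card_pos.1 (by omega), fun S hS => ?_⟩
      have := (h (S ∩ U) Finset.inter_subset_right
        ((Finset.card_le_card Finset.inter_subset_left).trans_lt hS)).preconnected
      rw [preconnected_induce_iff] at this
      convert this using 1
      ext x
      simp only [Finset.mem_sdiff, Finset.mem_inter]
      tauto
    · refine ⟨hne, fun S _ Y hY ⟨y, hy⟩ hYc x hx => ?_⟩
      by_cases hxy : x = y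
      · exact hxy ▸ hy
      · refine hYc y hy x hx (hcl ?_ ?_ (Ne.symm hxy))
        · exact Finset.mem_coe.2 (Finset.mem_sdiff.1 (hY hy)).1
        · exact Finset.mem_coe.2 (Finset.mem_sdiff.1 hx).1
  · rintro ⟨hne, h⟩
    by_cases hc : k < U.card
    · refine Or.inl ⟨hc, fun S _ hS => ?_⟩
      have hne : (U \ S).Nonempty := by
        rw [← Finset.card_pos]
        have := Finset.le_card_sdiff S U
        omega
      have : Nonempty ((U \ S : Finset V) : Set V) := by
        obtain ⟨x, hx⟩ := hne
        exact ⟨⟨x, hx⟩⟩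
      exact ⟨(preconnected_induce_iff H _).2 (h S hS)⟩
    · refine Or.inr ⟨hne, not_lt.1 hc, fun x hx y hy hxy => ?_⟩
      rw [Finset.mem_coe] at hx hy
      by_contra hadj
      have hsub : ({x, y} : Finset V) ⊆ U := by
        intro z hz
        rw [Finset.mem_insert, Finset.mem_singleton] at hz
        rcases hz with rfl | rfl <;> assumption
      have hl := h (U \ {x, y}) (by
        have := Finset.card_sdiff_of_subset hsub
        rw [Finset.card_pair hxy] at this
        omega)
      rw [Finset.sdiff_sdiff_eq_self hsub] at hl
      have := hl {x} (by simp) (by simp) (by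
        intro u hu v hv huv
        rw [Finset.mem_singleton] at hu
        subst hu
        rw [Finset.mem_insert, Finset.mem_singleton] at hv
        rcases hv with rfl | rfl
        · simp
        · exact absurd huv hadj)
      have := this (show y ∈ ({x, y} : Finset V) by simp)
      exact hxy (Finset.mem_singleton.1 this).symm

/-! ### Blocks -/

variable {G : SimpleGraph V} {B : Finset V}

lemma IsBiconnectedComponent.kLinked (hB : IsBiconnectedComponent G B) : KLinked G 2 B :=
  ((isConnectedPiece_iff (by norm_num)).1 hB.prop).2

lemma IsBiconnectedComponent.eq_of_subset (hB : IsBiconnectedComponent G B) {U : Finset V}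
    (hU : KLinked G 2 U) (hBU : B ⊆ U) : U = B := by
  have hne := ((isConnectedPiece_iff (by norm_num)).1 hB.prop).1
  exact (hB.eq_of_le ((isConnectedPiece_iff (by norm_num)).2 ⟨hne.mono hBU, hU⟩) hBU).symm

variable [Fintype V]

lemma exists_isBiconnectedComponent {U : Finset V} (hne : U.Nonempty) (hU : KLinked G 2 U) :
    ∃ B, IsBiconnectedComponent G B ∧ U ⊆ B := by
  obtain ⟨B, hUB, hB⟩ := (Set.toFinite {B | IsConnectedPiece G 2 B}).exists_le_maximal
    (a := U) ((isConnectedPiece_iff (by norm_num)).2 ⟨hne, hU⟩)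
  exact ⟨B, hB, hUB⟩

/-- All neighbours of a node of a block that is not a cut-vertex lie in the block. -/
lemma IsBiconnectedComponent.mem_of_adj (hB : IsBiconnectedComponent G B) (hB2 : 2 ≤ B.card)
    {v u : V} (hv : v ∈ B) (hcut : ¬ IsCutVertex G v) (hvu : G.Adj v u) : u ∈ B := by
  by_contra hu
  rw [isCutVertex_iff, not_not] at hcut
  obtain ⟨z₀, hz₀, hz₀v⟩ := Finset.exists_mem_ne hB2 v
  -- `Z` contains the interior of a path from `v` to another node of `B`
  let R : Finset V → Prop := fun Z => ∀ Y ⊆ Z, (∀ x ∈ Z, G.Adj v x → x ∈ Y) → ClosedIn G Z Y →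
    ∃ y ∈ Y, ∃ z ∈ B, z ≠ v ∧ G.Adj y z
  -- As `v` is not a cut-vertex, the outside neighbour `u` is connected to `z₀` without passing `v`.
  have hR : R (Finset.univ \ B) := by
    intro Y hY hvY hcl
    by_contra! hcon
    have hYB : ∀ x ∈ Y, x ∉ B := fun x hx => (Finset.mem_sdiff.1 (hY hx)).2
    refine hYB z₀ (hcut Y ?_ ⟨u, hvY u (by simp [hu]) hvu⟩ ?_ (by simp [hz₀v])) hz₀
    · intro x hx
      rw [Finset.mem_sdiff, Finset.mem_singleton]
      exact ⟨Finset.mem_univ x, fun h => hYB x hx (h ▸ hv)⟩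
    · intro x hx y hy hxy
      rw [Finset.mem_sdiff, Finset.mem_singleton] at hy
      by_cases hyB : y ∈ B
      · exact absurd hxy (hcon x hx y hyB hy.2)
      · exact hcl x hx y (by simp [hyB]) hxy
  classical
  -- A minimal `Z` plays the role of the interior of an ear attached to `B`. Then `B ∪ Z` is
  -- 2-linked, hence equal to `B`, although `Z` is nonempty and disjoint from `B`.
  obtain ⟨Z, hZ, hmin⟩ := Finset.exists_min_image
    ((Finset.univ \ B).powerset.filter R) Finset.card
    ⟨_, Finset.mem_filter.2 ⟨Finset.mem_powerset.2 le_rfl, hR⟩⟩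
  rw [Finset.mem_filter, Finset.mem_powerset] at hZ
  obtain ⟨hZB, hZR⟩ := hZ
  have hZB' : ∀ x ∈ Z, x ∉ B := fun x hx => (Finset.mem_sdiff.1 (hZB hx)).2
  have hempty : ∀ S Y : Finset V, S.card < 2 → Y ⊆ Z → ClosedIn G ((B ∪ Z) \ S) Y → Y = ∅ := by
    intro S Y hS hYZ hcl
    have hcl' : ∀ y ∈ Y, ∀ x ∈ B ∪ Z, x ∉ S → G.Adj y x → x ∈ Y := fun y hy x hx hxS hyx =>
      hcl y hy x (Finset.mem_sdiff.2 ⟨hx, hxS⟩) hyx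
    have hS1 : ∀ x ∈ S, ∀ y ∈ S, x = y := Finset.card_le_one.1 (by omega)
    -- The set `Y` is attached to the rest of `B ∪ Z` only through the deleted nodes, of which there
    -- is at most one. A path visiting `Y` would return through that node, so `Y` is dispensable,
    -- against minimality.
    have hRY : R (Z \ Y) := by
      intro Y₀ hY₀ hv₀ hcl₀
      have hY₀' : ∀ x ∈ Y₀, x ∈ Z ∧ x ∉ Y := fun x hx => Finset.mem_sdiff.1 (hY₀ hx)
      by_cases hSY : ∃ s ∈ S, s ∈ Y₀ ∨ s = v
      · obtain ⟨s, hsS, hs⟩ := hSY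
        obtain ⟨y, hy, z, hz, hzv, hyz⟩ := hZR (Y₀ ∪ Y)
          (Finset.union_subset (hY₀.trans Finset.sdiff_subset) hYZ)
          (fun x hx hvx => by
            rw [Finset.mem_union]
            by_cases hxY : x ∈ Y
            · exact Or.inr hxY
            · exact Or.inl (hv₀ x (Finset.mem_sdiff.2 ⟨hx, hxY⟩) hvx))
          (by
            intro y hy x hx hyx
            rw [Finset.mem_union] at hy ⊢
            by_cases hxY : x ∈ Y
            · exact Or.inr hxY
            left
            rcases hy with hy | hy
            · exact hcl₀ y hy x (Finset.mem_sdiff.2 ⟨hx, hxY⟩) hyx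
            · by_cases hxS : x ∈ S
              · obtain rfl := hS1 x hxS s hsS
                exact hs.resolve_right fun h => hZB' x hx (h ▸ hv)
              · exact absurd (hcl' y hy x (by simp [hx]) hxS hyx) hxY)
        rcases Finset.mem_union.1 hy with hy | hy
        · exact ⟨y, hy, z, hz, hzv, hyz⟩
        · exfalso
          by_cases hzS : z ∈ S
          · obtain rfl := hS1 z hzS s hsS
            rcases hs with h | h
            · exact hZB' z (hY₀' z h).1 hz
            · exact hzv h
          · exact hZB' z (hYZ (hcl' y hy z (by simp [hz]) hzS hyz)) hz
      · push Not at hSY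
        have hnot : ∀ x, (x ∈ Y₀ ∨ x = v) → ∀ y ∈ Y, ¬ G.Adj x y := by
          intro x hx y hy hxy
          have hxS : x ∉ S := fun hxS => by
            rcases hx with h | h
            · exact (hSY x hxS).1 h
            · exact (hSY x hxS).2 h
          have hxm : x ∈ B ∪ Z := by
            rcases hx with h | rfl
            · simp [(hY₀' x h).1]
            · simp [hv]
          have hxY := hcl' y hy x hxm hxS hxy.symm
          rcases hx with h | rfl
          · exact (hY₀' x h).2 hxY
          · exact hZB' x (hYZ hxY) hv
        refine hZR Y₀ (hY₀.trans Finset.sdiff_subset) (fun x hx hvx => ?_)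
          (fun y hy x hx hyx => ?_)
        · exact hv₀ x (Finset.mem_sdiff.2 ⟨hx, fun h => hnot v (Or.inr rfl) x h hvx⟩) hvx
        · exact hcl₀ y hy x (Finset.mem_sdiff.2 ⟨hx, fun h => hnot y (Or.inl hy) x h hyx⟩) hyx
    have hle := hmin (Z \ Y) (Finset.mem_filter.2
      ⟨Finset.mem_powerset.2 (Finset.sdiff_subset.trans hZB), hRY⟩)
    by_contra hne
    exact absurd (Finset.card_lt_card (Finset.sdiff_ssubset hYZ
      (Finset.nonempty_iff_ne_empty.2 hne))) (not_lt.2 hle)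
  have hlink : KLinked G 2 (B ∪ Z) := by
    intro S hS Y hY hne hcl
    by_cases hYB : (Y ∩ B).Nonempty
    · have hBY : B \ S ⊆ Y ∩ B := by
        refine hB.kLinked S hS (Y ∩ B) (fun x hx => ?_) hYB (fun x hx y hy hxy => ?_)
        · rw [Finset.mem_inter] at hx
          exact Finset.mem_sdiff.2 ⟨hx.2, (Finset.mem_sdiff.1 (hY hx.1)).2⟩
        · rw [Finset.mem_inter] at hx ⊢
          rw [Finset.mem_sdiff] at hy
          exact ⟨hcl x hx.1 y (by simp [hy.1, hy.2]) hxy, hy.1⟩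
      rw [← Finset.sdiff_eq_empty_iff_subset]
      refine hempty S _ hS (fun x hx => ?_) hcl.sdiff
      rw [Finset.mem_sdiff, Finset.mem_sdiff, Finset.mem_union] at hx
      refine hx.1.1.resolve_left fun hxB => hx.2 ?_
      exact (Finset.mem_inter.1 (hBY (Finset.mem_sdiff.2 ⟨hxB, hx.1.2⟩))).1
    · rw [Finset.not_nonempty_iff_eq_empty] at hYB
      have := hempty S Y hS (fun x hx => by
        have := (Finset.mem_sdiff.1 (hY hx)).1
        rw [Finset.mem_union] at this
        refine this.resolve_left fun hxB => ?_
        have : x ∈ Y ∩ B := Finset.mem_inter.2 ⟨hx, hxB⟩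
        simp [hYB] at this) hcl
      exact absurd this hne.ne_empty
  have hBZ := hB.eq_of_subset hlink Finset.subset_union_left
  obtain ⟨y, hy, -⟩ := hZR Z le_rfl (fun x hx _ => hx) (fun _ _ x hx _ => hx)
  exact hZB' y hy (hBZ ▸ (by simp [hy] : y ∈ B ∪ Z))

/-- A node that is not a cut-vertex lies in only one block. -/
lemma IsBiconnectedComponent.eq_of_mem (hB : IsBiconnectedComponent G B) (hB2 : 2 ≤ B.card)
    {B' : Finset V} (hB' : IsBiconnectedComponent G B') (hB'2 : 2 ≤ B'.card) {v : V} (hv : v ∈ B)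
    (hv' : v ∈ B') (hcut : ¬ IsCutVertex G v) : B = B' := by
  obtain ⟨z, hz, hzv⟩ := Finset.exists_mem_ne hB2 v
  obtain ⟨u, hu, huv⟩ : ∃ u ∈ B, G.Adj v u := by
    by_contra! hcon
    have := hB.kLinked ∅ (by simp) {v} (by simpa using hv) (by simp) (by
      intro x hx y hy hxy
      rw [Finset.mem_singleton] at hx
      exact absurd (hx ▸ hxy) (hcon y (by simpa using hy)))
    have := this (show z ∈ B \ ∅ by simpa using hz)
    exact hzv (by simpa using this)
  have hu' := hB'.mem_of_adj hB'2 hv' hcut huv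
  have hlink : KLinked G 2 (B ∪ B') := by
    intro S hS Y hY hne hcl
    -- The blocks share the two nodes `u` and `v`, so deleting one node leaves a common node, and
    -- the union is 2-linked.
    obtain ⟨s, hs, hsB, hsB'⟩ : ∃ s, s ∉ S ∧ s ∈ B ∧ s ∈ B' := by
      by_contra! hcon
      have h1 : v ∈ S := by_contra fun h => hcon v h hv hv'
      have h2 : u ∈ S := by_contra fun h => hcon u h hu hu'
      exact huv.ne (Finset.card_le_one.1 (by omega) v h1 u h2)
    have key : ∀ W, KLinked G 2 W → W ⊆ B ∪ B' → (Y ∩ W).Nonempty → W \ S ⊆ Y := by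
      intro W hW hWs hne
      refine (hW S hS (Y ∩ W) (fun x hx => ?_) hne (fun x hx y hy hxy => ?_)).trans
        Finset.inter_subset_left
      · rw [Finset.mem_inter] at hx
        exact Finset.mem_sdiff.2 ⟨hx.2, (Finset.mem_sdiff.1 (hY hx.1)).2⟩
      · rw [Finset.mem_inter] at hx ⊢
        rw [Finset.mem_sdiff] at hy
        exact ⟨hcl x hx.1 y (Finset.mem_sdiff.2 ⟨hWs hy.1, hy.2⟩) hxy, hy.1⟩
    have hsY : s ∈ Y := by
      obtain ⟨y, hy⟩ := hne
      rcases Finset.mem_union.1 (Finset.mem_sdiff.1 (hY hy)).1 with h | h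
      · exact key B hB.kLinked Finset.subset_union_left ⟨y, Finset.mem_inter.2 ⟨hy, h⟩⟩
          (Finset.mem_sdiff.2 ⟨hsB, hs⟩)
      · exact key B' hB'.kLinked Finset.subset_union_right ⟨y, Finset.mem_inter.2 ⟨hy, h⟩⟩
          (Finset.mem_sdiff.2 ⟨hsB', hs⟩)
    rw [Finset.union_sdiff_distrib]
    exact Finset.union_subset
      (key B hB.kLinked Finset.subset_union_left ⟨s, Finset.mem_inter.2 ⟨hsY, hsB⟩⟩)
      (key B' hB'.kLinked Finset.subset_union_right ⟨s, Finset.mem_inter.2 ⟨hsY, hsB'⟩⟩)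
  rw [← hB.eq_of_subset hlink Finset.subset_union_left]
  exact hB'.eq_of_subset hlink Finset.subset_union_right

/-- Links leave a block only at its cut-vertices. This makes the boundary criterion applicable to
the demand of a block. -/
lemma IsBiconnectedComponent.boundary_subset (hB : IsBiconnectedComponent G B)
    (hB2 : 2 ≤ B.card) : boundary G (B \ cutVertices G) ⊆ B ∩ cutVertices G := by
  intro x hx
  obtain ⟨hx, a, ha, hax⟩ := mem_boundary.1 hx
  rw [Finset.mem_sdiff, mem_cutVertices] at ha
  have hxB := hB.mem_of_adj hB2 ha.1 ha.2 hax
  rw [Finset.mem_sdiff] at hx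
  exact Finset.mem_inter.2 ⟨hxB, by_contra fun h => hx ⟨hxB, h⟩⟩

end Connectivity

/-! ## Triconnected partitions -/

section Partition

variable {V : Type*} {G H : SimpleGraph V} {B U U₁ U₂ S : Finset V} {a b : V}

lemma sup_edge_adj {x y : V} : (H ⊔ SimpleGraph.edge a b).Adj x y ↔
    H.Adj x y ∨ ((x = a ∧ y = b ∨ x = b ∧ y = a) ∧ x ≠ y) := by
  rw [SimpleGraph.sup_adj, SimpleGraph.edge_adj]

variable [DecidableEq V]

/-- A closed set of one side of a split extends to a closed set of the whole. -/
lemma exists_closedIn_of_split (hab : a ≠ b) (hinter : U₁ ∩ U₂ = {a, b})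
    (hsep : ∀ x ∈ U₁ \ U₂, ∀ y ∈ U₂ \ U₁, ¬ H.Adj x y) {C Y : Finset V} (hC : C ⊆ U₁)
    (hY : Y ⊆ U₁ \ C) (hcl : ClosedIn (H ⊔ SimpleGraph.edge a b) (U₁ \ C) Y) :
    ∃ Y' ⊆ (U₁ ∪ U₂) \ C, Y' ∩ U₁ = Y ∧ ClosedIn H ((U₁ ∪ U₂) \ C) Y' := by
  have hab' : ∀ x, x ∈ U₁ → x ∈ U₂ → x = a ∨ x = b := by
    intro x h1 h2
    have : x ∈ U₁ ∩ U₂ := Finset.mem_inter.2 ⟨h1, h2⟩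
    simpa [hinter] using this
  have hYm : ∀ x ∈ Y, x ∈ U₁ ∧ x ∉ C := fun x hx => Finset.mem_sdiff.1 (hY hx)
  have hmem : ∀ x, x = a ∨ x = b → x ∈ U₁ := by
    intro x hx
    have : x ∈ U₁ ∩ U₂ := by rw [hinter]; simpa using hx
    exact (Finset.mem_inter.1 this).1
  -- The link `ab` keeps the undeleted nodes among `a`, `b` together. If `Y` contains one of them,
  -- the whole interior of the other side is added; otherwise `Y` has no neighbours there.
  by_cases habY : a ∈ Y ∨ b ∈ Y
  · have hclab : ∀ x, x = a ∨ x = b → x ∉ C → x ∈ Y := by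
      intro x hx hxC
      rcases habY with h | h
      · by_cases hxa : x = a
        · rwa [hxa]
        · have hxb := hx.resolve_left hxa
          exact hcl a h x (Finset.mem_sdiff.2 ⟨hmem x hx, hxC⟩)
            (sup_edge_adj.2 (Or.inr ⟨Or.inl ⟨rfl, hxb⟩, Ne.symm hxa⟩))
      · by_cases hxb : x = b
        · rwa [hxb]
        · have hxa := hx.resolve_right hxb
          exact hcl b h x (Finset.mem_sdiff.2 ⟨hmem x hx, hxC⟩)
            (sup_edge_adj.2 (Or.inr ⟨Or.inr ⟨rfl, hxa⟩, Ne.symm hxb⟩))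
    refine ⟨Y ∪ (U₂ \ U₁), ?_, ?_, ?_⟩
    · intro x hx
      simp only [Finset.mem_union, Finset.mem_sdiff] at hx ⊢
      rcases hx with h | h
      · exact ⟨Or.inl (hYm x h).1, (hYm x h).2⟩
      · exact ⟨Or.inr h.1, fun hxC => h.2 (hC hxC)⟩
    · ext x
      simp only [Finset.mem_inter, Finset.mem_union, Finset.mem_sdiff]
      constructor
      · rintro ⟨h | h, h'⟩
        · exact h
        · exact absurd h' h.2
      · exact fun h => ⟨Or.inl h, (hYm x h).1⟩
    · intro x hx y hy hxy
      simp only [Finset.mem_union, Finset.mem_sdiff] at hx hy ⊢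
      by_cases hyU : y ∈ U₁
      · left
        rcases hx with h | h
        · exact hcl x h y (Finset.mem_sdiff.2 ⟨hyU, hy.2⟩) (sup_edge_adj.2 (Or.inl hxy))
        · by_cases hyU₂ : y ∈ U₂
          · exact hclab y (hab' y hyU hyU₂) hy.2
          · exact absurd hxy.symm (hsep y (Finset.mem_sdiff.2 ⟨hyU, hyU₂⟩) x
              (Finset.mem_sdiff.2 h))
      · exact Or.inr ⟨hy.1.resolve_left hyU, hyU⟩
  · push Not at habY
    refine ⟨Y, hY.trans (Finset.sdiff_subset_sdiff Finset.subset_union_left le_rfl),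
      Finset.inter_eq_left.2 (hY.trans Finset.sdiff_subset), ?_⟩
    intro x hx y hy hxy
    rw [Finset.mem_sdiff, Finset.mem_union] at hy
    have hyU : y ∈ U₁ := by
      by_contra hyU
      have hxU₂ : x ∉ U₂ := by
        intro hxU₂
        rcases hab' x (hYm x hx).1 hxU₂ with rfl | rfl
        · exact habY.1 hx
        · exact habY.2 hx
      exact hsep x (Finset.mem_sdiff.2 ⟨(hYm x hx).1, hxU₂⟩) y
        (Finset.mem_sdiff.2 ⟨hy.1.resolve_left hyU, hyU⟩) hxy
    exact hcl x hx y (Finset.mem_sdiff.2 ⟨hyU, hy.2⟩) (sup_edge_adj.2 (Or.inl hxy))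

/-- `H` on `U` arises from `G` on `B` by splitting: the additional links join nodes of `S`, and
closed sets lift. -/
structure ArisesFrom (G : SimpleGraph V) (B S : Finset V) (H : SimpleGraph V) (U : Finset V) :
    Prop where
  subset : U ⊆ B
  le : G ≤ H
  adj : ∀ x y, H.Adj x y → G.Adj x y ∨ (x ∈ S ∧ y ∈ S)
  lift : ∀ C ⊆ U, ∀ Y ⊆ U \ C, ClosedIn H (U \ C) Y →
    ∃ Y' ⊆ B \ C, Y' ∩ U = Y ∧ ClosedIn G (B \ C) Y'

lemma ArisesFrom.refl (G : SimpleGraph V) (B S : Finset V) : ArisesFrom G B S G B :=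
  ⟨le_rfl, le_rfl, fun _ _ h => Or.inl h, fun _ _ Y hY h =>
    ⟨Y, hY, Finset.inter_eq_left.2 (hY.trans Finset.sdiff_subset), h⟩⟩

/-- The two nodes of a split form a cut. -/
lemma ArisesFrom.not_linked (h : ArisesFrom G B S H (U₁ ∪ U₂)) (hinter : U₁ ∩ U₂ = {a, b})
    (h₁ : (U₁ \ U₂).Nonempty) (h₂ : (U₂ \ U₁).Nonempty)
    (hsep : ∀ x ∈ U₁ \ U₂, ∀ y ∈ U₂ \ U₁, ¬ H.Adj x y) : ¬ Linked G (B \ {a, b}) := by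
  intro hl
  have hab : ∀ x, x = a ∨ x = b → x ∈ U₁ ∧ x ∈ U₂ := by
    intro x hx
    have : x ∈ U₁ ∩ U₂ := by rw [hinter]; simpa using hx
    exact Finset.mem_inter.1 this
  -- The side `U₁ \ U₂` is closed once `a` and `b` are deleted; its lift to `B` still misses `U₂ \
  -- U₁`.
  obtain ⟨Y, hY, hYU, hcl⟩ := h.lift {a, b} (fun x hx => Finset.mem_union_left _
      (hab x (by simpa using hx)).1) (U₁ \ U₂)
    (fun x hx => by
      rw [Finset.mem_sdiff] at hx ⊢
      refine ⟨Finset.mem_union_left _ hx.1, fun hxab => hx.2 (hab x (by simpa using hxab)).2⟩)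
    (fun x hx y hy hxy => by
      rw [Finset.mem_sdiff, Finset.mem_union] at hy
      by_contra hcon
      have hyU₂ : y ∈ U₂ := by
        by_contra hyU₂
        exact hcon (Finset.mem_sdiff.2 ⟨hy.1.resolve_right hyU₂, hyU₂⟩)
      have hyU₁ : y ∉ U₁ := by
        intro hyU₁
        have : y ∈ U₁ ∩ U₂ := Finset.mem_inter.2 ⟨hyU₁, hyU₂⟩
        rw [hinter] at this
        exact hy.2 this
      exact hsep x hx y (Finset.mem_sdiff.2 ⟨hyU₂, hyU₁⟩) hxy)
  obtain ⟨x, hx⟩ := h₁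
  obtain ⟨y, hy⟩ := h₂
  rw [Finset.mem_sdiff] at hy
  have hxY : x ∈ Y := (Finset.mem_inter.1 (hYU ▸ hx : x ∈ Y ∩ (U₁ ∪ U₂))).1
  have hyY := hl Y hY ⟨x, hxY⟩ hcl (Finset.mem_sdiff.2 ⟨h.subset (Finset.mem_union_right _ hy.1),
    fun hyab => hy.2 (hab y (by simpa using hyab)).1⟩)
  have : y ∈ U₁ \ U₂ := hYU ▸ Finset.mem_inter.2 ⟨hyY, Finset.mem_union_right _ hy.1⟩
  exact (Finset.mem_sdiff.1 this).2 hy.1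

lemma ArisesFrom.left (h : ArisesFrom G B S H (U₁ ∪ U₂)) (hab : a ≠ b)
    (hinter : U₁ ∩ U₂ = {a, b}) (hsep : ∀ x ∈ U₁ \ U₂, ∀ y ∈ U₂ \ U₁, ¬ H.Adj x y) (ha : a ∈ S)
    (hb : b ∈ S) : ArisesFrom G B S (H ⊔ SimpleGraph.edge a b) U₁ := by
  refine ⟨Finset.subset_union_left.trans h.subset, h.le.trans le_sup_left, fun x y hxy => ?_,
    fun C hC Y hY hcl => ?_⟩
  · rcases sup_edge_adj.1 hxy with h' | ⟨⟨rfl, rfl⟩ | ⟨rfl, rfl⟩, -⟩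
    · exact h.adj x y h'
    · exact Or.inr ⟨ha, hb⟩
    · exact Or.inr ⟨hb, ha⟩
  · obtain ⟨Y₁, hY₁, hY₁U, hcl₁⟩ := exists_closedIn_of_split hab hinter hsep hC hY hcl
    obtain ⟨Y', hY', hY'U, hcl'⟩ := h.lift C (hC.trans Finset.subset_union_left) Y₁ hY₁ hcl₁
    refine ⟨Y', hY', ?_, hcl'⟩
    rw [← hY₁U, ← hY'U, Finset.inter_assoc, Finset.inter_eq_right.2 Finset.subset_union_left]

lemma ArisesFrom.right (h : ArisesFrom G B S H (U₁ ∪ U₂)) (hab : a ≠ b)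
    (hinter : U₁ ∩ U₂ = {a, b}) (hsep : ∀ x ∈ U₁ \ U₂, ∀ y ∈ U₂ \ U₁, ¬ H.Adj x y) (ha : a ∈ S)
    (hb : b ∈ S) : ArisesFrom G B S (H ⊔ SimpleGraph.edge a b) U₂ :=
  (show ArisesFrom G B S H (U₂ ∪ U₁) by rwa [Finset.union_comm]).left hab
    (by rwa [Finset.inter_comm]) (fun x hx y hy hxy => hsep y hy x hx hxy.symm) ha hb

lemma mem_separationVertices {v : V} : v ∈ separationVertices G B ↔
    v ∈ B ∧ (IsCutVertex G v ∨ ∃ u, IsTwoVertexCut G B v u) := by simp [separationVertices]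

/-- A cut used at any stage of the splitting is a cut of the original block. Hence virtual links
join only separation vertices, which keeps `ArisesFrom` valid along the recursion. -/
lemma ArisesFrom.mem_separationVertices (h : ArisesFrom G B S H (U₁ ∪ U₂)) (hab : a ≠ b)
    (hinter : U₁ ∩ U₂ = {a, b}) (h₁ : (U₁ \ U₂).Nonempty) (h₂ : (U₂ \ U₁).Nonempty)
    (hsep : ∀ x ∈ U₁ \ U₂, ∀ y ∈ U₂ \ U₁, ¬ H.Adj x y) :
    a ∈ separationVertices G B ∧ b ∈ separationVertices G B := by
  have hl := h.not_linked hinter h₁ h₂ hsep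
  have hmem : ∀ x, x = a ∨ x = b → x ∈ B := by
    intro x hx
    have : x ∈ U₁ ∩ U₂ := by rw [hinter]; simpa using hx
    exact h.subset (Finset.mem_union_left _ (Finset.mem_inter.1 this).1)
  have ha := hmem a (Or.inl rfl)
  have hb := hmem b (Or.inr rfl)
  rw [MonitorPlacement.mem_separationVertices, MonitorPlacement.mem_separationVertices]
  refine ⟨⟨ha, Or.inr ⟨b, isTwoVertexCut_iff.2 ⟨ha, hb, hab, hl⟩⟩⟩,
    ⟨hb, Or.inr ⟨a, isTwoVertexCut_iff.2 ⟨hb, ha, hab.symm, ?_⟩⟩⟩⟩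
  rwa [Finset.pair_comm]

lemma TriconnectedPartition.subset {D : Multiset (Finset V)} (h : TriconnectedPartition H U D) :
    ∀ T ∈ D, T ⊆ U := by
  induction h with
  | piece H U hU => simp
  | split H U₁ U₂ a b D₁ D₂ _ _ _ _ _ _ _ ih₁ ih₂ =>
    intro T hT
    rcases Multiset.mem_add.1 hT with h | h
    · exact (ih₁ T h).trans Finset.subset_union_left
    · exact (ih₂ T h).trans Finset.subset_union_right

/-- A node that is not a separation vertex lies in at most one triconnected component. -/
lemma TriconnectedPartition.countP_le_one {D : Multiset (Finset V)}
    (h : TriconnectedPartition H U D) (hU : ArisesFrom G B (separationVertices G B) H U) {v : V}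
    (hv : v ∉ separationVertices G B) : D.countP (fun T => v ∈ T) ≤ 1 := by
  induction h with
  | piece H U _ => exact (Multiset.countP_le_card _ _).trans (by simp)
  | split H U₁ U₂ a b D₁ D₂ hab hinter h₁ h₂ hsep hD₁ hD₂ ih₁ ih₂ =>
    obtain ⟨ha, hb⟩ := hU.mem_separationVertices hab hinter h₁ h₂ hsep
    have i₁ := ih₁ (hU.left hab hinter hsep ha hb)
    have i₂ := ih₂ (hU.right hab hinter hsep ha hb)
    rw [Multiset.countP_add]
    have hno : v ∉ U₁ ∨ v ∉ U₂ := by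
      by_contra! hcon
      have : v ∈ U₁ ∩ U₂ := Finset.mem_inter.2 hcon
      rw [hinter, Finset.mem_insert, Finset.mem_singleton] at this
      rcases this with rfl | rfl
      · exact hv ha
      · exact hv hb
    rcases hno with hno | hno
    · have : D₁.countP (fun T => v ∈ T) = 0 :=
        Multiset.countP_eq_zero.2 fun T hT hvT => hno (hD₁.subset T hT hvT)
      omega
    · have : D₂.countP (fun T => v ∈ T) = 0 :=
        Multiset.countP_eq_zero.2 fun T hT hvT => hno (hD₂.subset T hT hvT)
      omega

/-- The neighbours of a node that is not a separation vertex lie in its triconnected component. -/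
lemma TriconnectedPartition.mem_of_adj {D : Multiset (Finset V)}
    (h : TriconnectedPartition H U D) (hU : ArisesFrom G B (separationVertices G B) H U)
    {T : Finset V} (hT : T ∈ D) {v u : V} (hvT : v ∈ T) (hv : v ∉ separationVertices G B)
    (hu : u ∈ U) (hvu : H.Adj v u) : u ∈ T := by
  induction h with
  | piece H U _ =>
    rw [Multiset.mem_singleton] at hT
    exact hT ▸ hu
  | split H U₁ U₂ a b D₁ D₂ hab hinter h₁ h₂ hsep hD₁ hD₂ ih₁ ih₂ =>
    obtain ⟨ha, hb⟩ := hU.mem_separationVertices hab hinter h₁ h₂ hsep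
    have hno : v ∈ U₁ → v ∈ U₂ → False := by
      intro hv₁ hv₂
      have : v ∈ U₁ ∩ U₂ := Finset.mem_inter.2 ⟨hv₁, hv₂⟩
      rw [hinter, Finset.mem_insert, Finset.mem_singleton] at this
      rcases this with rfl | rfl
      · exact hv ha
      · exact hv hb
    have hadj : (H ⊔ SimpleGraph.edge a b).Adj v u := sup_edge_adj.2 (Or.inl hvu)
    rw [Finset.mem_union] at hu
    rcases Multiset.mem_add.1 hT with hT | hT
    · have hvU := hD₁.subset T hT hvT
      refine ih₁ (hU.left hab hinter hsep ha hb) hT ?_ hadj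
      by_contra hu₁
      exact hsep v (Finset.mem_sdiff.2 ⟨hvU, hno hvU⟩) u
        (Finset.mem_sdiff.2 ⟨hu.resolve_left hu₁, hu₁⟩) hvu
    · have hvU := hD₂.subset T hT hvT
      refine ih₂ (hU.right hab hinter hsep ha hb) hT ?_ hadj
      by_contra hu₂
      exact hsep u (Finset.mem_sdiff.2 ⟨hu.resolve_right hu₂, hu₂⟩) v
        (Finset.mem_sdiff.2 ⟨hvU, fun h => hno h hvU⟩) hvu.symm

/-- A connected set without separation vertices and with two boundary nodes forms, together with
them, a triconnected component of every partition. -/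
lemma TriconnectedPartition.mem_of_boundary [Fintype V] {D : Multiset (Finset V)}
    (h : TriconnectedPartition H U D) (hU : ArisesFrom G B (separationVertices G B) H U)
    {A : Finset V} (hA : A.Nonempty) (hAl : Linked G A)
    (hAS : Disjoint A (separationVertices G B)) (hAb : (boundary G A).card = 2)
    (hAU : A ∪ boundary G A ⊆ U) : A ∪ boundary G A ∈ D := by
  induction h with
  | piece H U hpiece =>
    rw [Multiset.mem_singleton]
    by_contra hne
    obtain ⟨-, hlink⟩ := (isConnectedPiece_iff (by norm_num)).1 hpiece
    -- Virtual links do not touch `A`, so deleting its two boundary nodes leaves `A` closed. A piece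
    -- survives this deletion connected, so it has no other nodes.
    have hsub := hlink (boundary G A) (by omega) A (fun x hx => by
      rw [Finset.mem_sdiff]
      exact ⟨hAU (Finset.mem_union_left _ hx), fun h => (mem_boundary.1 h).1 hx⟩) hA (by
        intro x hx y hy hxy
        rw [Finset.mem_sdiff] at hy
        by_contra hyA
        rcases hU.adj x y hxy with h | ⟨h, -⟩
        · exact hy.2 (mem_boundary.2 ⟨hyA, x, hx, h⟩)
        · exact Finset.disjoint_left.1 hAS hx h)
    refine hne (Finset.Subset.antisymm hAU fun x hx => ?_)
    by_cases hxb : x ∈ boundary G A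
    · exact Finset.mem_union_right _ hxb
    · exact Finset.mem_union_left _ (hsub (Finset.mem_sdiff.2 ⟨hx, hxb⟩))
  | split H U₁ U₂ a b D₁ D₂ hab hinter h₁ h₂ hsep hD₁ hD₂ ih₁ ih₂ =>
    obtain ⟨ha, hb⟩ := hU.mem_separationVertices hab hinter h₁ h₂ hsep
    have hno : ∀ v ∈ A, v ∈ U₁ → v ∈ U₂ → False := by
      intro v hvA hv₁ hv₂
      have : v ∈ U₁ ∩ U₂ := Finset.mem_inter.2 ⟨hv₁, hv₂⟩
      rw [hinter, Finset.mem_insert, Finset.mem_singleton] at this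
      rcases this with rfl | rfl
      · exact Finset.disjoint_left.1 hAS hvA ha
      · exact Finset.disjoint_left.1 hAS hvA hb
    have hAU' : ∀ v ∈ A, v ∈ U₁ ∨ v ∈ U₂ := fun v hv =>
      Finset.mem_union.1 (hAU (Finset.mem_union_left _ hv))
    have hbd : ∀ x ∈ boundary G A, x ∈ U₁ ∨ x ∈ U₂ := fun v hv =>
      Finset.mem_union.1 (hAU (Finset.mem_union_right _ hv))
    have hsepG : ∀ x y, x ∈ U₁ → x ∉ U₂ → y ∈ U₂ → y ∉ U₁ → ¬ G.Adj x y :=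
      fun x y hx hx' hy hy' hxy => hsep x (Finset.mem_sdiff.2 ⟨hx, hx'⟩) y
        (Finset.mem_sdiff.2 ⟨hy, hy'⟩) (hU.le hxy)
    rw [Multiset.mem_add]
    -- Being connected and containing neither `a` nor `b`, the set `A` lies within one side, and so
    -- does its boundary.
    by_cases hne : (A ∩ U₁).Nonempty
    · left
      have hAU₁ : A ⊆ U₁ := by
        refine (hAl (A ∩ U₁) Finset.inter_subset_left hne ?_).trans Finset.inter_subset_right
        intro x hx y hy hxy
        rw [Finset.mem_inter] at hx ⊢
        refine ⟨hy, by_contra fun hy₁ => ?_⟩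
        exact hsepG x y hx.2 (hno x hx.1 hx.2) ((hAU' y hy).resolve_left hy₁) hy₁ hxy
      refine ih₁ (hU.left hab hinter hsep ha hb) (Finset.union_subset hAU₁ fun x hx => ?_)
      by_contra hx₁
      obtain ⟨-, z, hz, hzx⟩ := mem_boundary.1 hx
      exact hsepG z x (hAU₁ hz) (hno z hz (hAU₁ hz)) ((hbd x hx).resolve_left hx₁) hx₁ hzx
    · right
      have hAU₂ : ∀ x ∈ A, x ∉ U₁ ∧ x ∈ U₂ := by
        intro x hx
        have : x ∉ U₁ := fun h => hne ⟨x, Finset.mem_inter.2 ⟨hx, h⟩⟩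
        exact ⟨this, (hAU' x hx).resolve_left this⟩
      refine ih₂ (hU.right hab hinter hsep ha hb)
        (Finset.union_subset (fun x hx => (hAU₂ x hx).2) fun x hx => ?_)
      by_contra hx₂
      obtain ⟨-, z, hz, hzx⟩ := mem_boundary.1 hx
      exact hsepG x z ((hbd x hx).resolve_right hx₂) hx₂ (hAU₂ z hz).2 (hAU₂ z hz).1 hzx.symm

/-- Every 2-vertex-connected graph has a partition into triconnected components. -/
theorem exists_triconnectedPartition (H : SimpleGraph V) (U : Finset V) (hne : U.Nonempty)
    (hU : KLinked H 2 U) : ∃ D, TriconnectedPartition H U D := by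
  induction hn : U.card using Nat.strong_induction_on generalizing H U with
  | _ n ih =>
  by_cases hpiece : IsConnectedPiece H 3 U
  · exact ⟨{U}, .piece H U hpiece⟩
  have hnot : ¬ KLinked H 3 U := fun h => hpiece ((isConnectedPiece_iff (by norm_num)).2 ⟨hne, h⟩)
  unfold KLinked at hnot
  push Not at hnot
  obtain ⟨S, hS, hSl⟩ := hnot
  have heq : U \ (S ∩ U) = U \ S := by
    ext x; simp only [Finset.mem_sdiff, Finset.mem_inter]; tauto
  -- Deleting fewer than two nodes of `U` cannot disconnect it.
  have hS2 : (S ∩ U).card = 2 := by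
    have h1 := Finset.card_le_card (Finset.inter_subset_left : S ∩ U ⊆ S)
    by_contra h2
    exact hSl (heq ▸ hU (S ∩ U) (by omega))
  obtain ⟨a, b, hab, hSab⟩ := Finset.card_eq_two.1 hS2
  rw [← heq, hSab] at hSl
  unfold Linked at hSl
  push Not at hSl
  obtain ⟨Y, hY, hYne, hYcl, hYn⟩ := hSl
  have habU : ({a, b} : Finset V) ⊆ U := hSab ▸ Finset.inter_subset_right
  have hYm : ∀ x ∈ Y, x ∈ U ∧ x ∉ ({a, b} : Finset V) := fun x hx => Finset.mem_sdiff.1 (hY hx)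
  obtain ⟨z, hz, hzY⟩ := Finset.not_subset.1 hYn
  rw [Finset.mem_sdiff] at hz
  set U₁ := Y ∪ {a, b} with hU₁
  set U₂ := U \ Y with hU₂
  have hunion : U₁ ∪ U₂ = U := by
    ext x
    have h1 := hYm x
    have h2 := @habU x
    simp only [hU₁, hU₂, Finset.mem_union, Finset.mem_sdiff]
    tauto
  have hinter : U₁ ∩ U₂ = {a, b} := by
    ext x
    have h1 := hYm x
    have h2 := @habU x
    simp only [hU₁, hU₂, Finset.mem_union, Finset.mem_sdiff, Finset.mem_inter]
    tauto
  have hd₁ : U₁ \ U₂ = Y := by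
    ext x
    have h1 := hYm x
    have h2 := @habU x
    simp only [hU₁, hU₂, Finset.mem_union, Finset.mem_sdiff]
    tauto
  have hd₂ : U₂ \ U₁ = (U \ {a, b}) \ Y := by
    ext x
    have h1 := hYm x
    have h2 := @habU x
    simp only [hU₁, hU₂, Finset.mem_union, Finset.mem_sdiff]
    tauto
  have hz₂ : z ∈ U₂ \ U₁ := by
    rw [hd₂]; exact Finset.mem_sdiff.2 ⟨Finset.mem_sdiff.2 hz, hzY⟩
  obtain ⟨y, hy⟩ := hYne
  have hsep : ∀ x ∈ U₁ \ U₂, ∀ y ∈ U₂ \ U₁, ¬ H.Adj x y := by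
    intro x hx y hy hxy
    rw [hd₁] at hx
    rw [hd₂, Finset.mem_sdiff] at hy
    exact hy.2 (hYcl x hx y hy.1 hxy)
  -- Closed sets of a side lift to `U`, so the side with its added link is again 2-linked.
  have klink : ∀ W₁ W₂ : Finset V, W₁ ∪ W₂ = U → W₁ ∩ W₂ = {a, b} →
      (∀ x ∈ W₁ \ W₂, ∀ y ∈ W₂ \ W₁, ¬ H.Adj x y) →
      KLinked (H ⊔ SimpleGraph.edge a b) 2 W₁ := by
    intro W₁ W₂ hW hWi hWs S hS Y hY hYne hcl
    have heq : W₁ \ (S ∩ W₁) = W₁ \ S := by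
      ext x; simp only [Finset.mem_sdiff, Finset.mem_inter]; tauto
    rw [← heq] at hY hcl ⊢
    obtain ⟨Y', hY', hYU, hcl'⟩ := exists_closedIn_of_split hab hWi hWs
      Finset.inter_subset_right hY hcl
    rw [hW] at hY' hcl'
    have hne' : Y'.Nonempty := by
      obtain ⟨x, hx⟩ := hYne
      exact ⟨x, (Finset.mem_inter.1 (hYU ▸ hx : x ∈ Y' ∩ W₁)).1⟩
    have := hU (S ∩ W₁) ((Finset.card_le_card Finset.inter_subset_left).trans_lt hS) Y' hY' hne'
      hcl'
    intro x hx
    rw [Finset.mem_sdiff] at hx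
    rw [← hYU, Finset.mem_inter]
    exact ⟨this (Finset.mem_sdiff.2 ⟨hW ▸ Finset.mem_union_left _ hx.1, hx.2⟩), hx.1⟩
  have hlt₁ : U₁.card < n := by
    rw [← hn]
    refine Finset.card_lt_card (Finset.ssubset_iff_of_subset ?_ |>.2 ⟨z, hz.1, ?_⟩)
    · exact hunion ▸ Finset.subset_union_left
    · exact (Finset.mem_sdiff.1 hz₂).2
  have hlt₂ : U₂.card < n := by
    rw [← hn]
    refine Finset.card_lt_card (Finset.ssubset_iff_of_subset Finset.sdiff_subset |>.2
      ⟨y, (hYm y hy).1, fun h => (Finset.mem_sdiff.1 h).2 hy⟩)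
  obtain ⟨D₁, hD₁⟩ := ih _ hlt₁ (H ⊔ SimpleGraph.edge a b) U₁ ⟨y, Finset.mem_union_left _ hy⟩
    (klink U₁ U₂ hunion hinter hsep) rfl
  obtain ⟨D₂, hD₂⟩ := ih _ hlt₂ (H ⊔ SimpleGraph.edge a b) U₂ ⟨z, (Finset.mem_sdiff.1 hz₂).1⟩
    (klink U₂ U₁ (by rw [Finset.union_comm, hunion]) (by rw [Finset.inter_comm, hinter])
      fun x hx y hy hxy => hsep y hy x hx hxy.symm) rfl
  refine ⟨D₁ + D₂, ?_⟩
  have := TriconnectedPartition.split H U₁ U₂ a b D₁ D₂ hab hinter (hd₁ ▸ ⟨y, hy⟩) ⟨z, hz₂⟩ hsep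
    hD₁ hD₂
  rwa [hunion] at this

end Partition

/-! ## Complete placements identify all link metrics -/

section Sufficiency

lemma mem_lowDegreeNodes {V : Type*} [Fintype V] {G : SimpleGraph V} {v : V} : v ∈ lowDegreeNodes G ↔ (boundary G {v}).card < 3 := by
  classical
  rw [lowDegreeNodes, Finset.mem_filter, ← SimpleGraph.card_neighborFinset_eq_degree]
  have : G.neighborFinset v = boundary G {v} := by
    ext x
    rw [SimpleGraph.mem_neighborFinset, mem_boundary]
    simp only [Finset.mem_singleton, exists_eq_left]
    exact ⟨fun h => ⟨h.ne', h⟩, fun h => h.2⟩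
  rw [← this]
  simp only [Finset.mem_univ, true_and]

variable {V : Type*} [DecidableEq V]

/-- The component `C` does not lack monitors. -/
def IsComplete (C S M : Finset V) : Prop :=
  0 < (C ∩ S).card → (C ∩ S).card < 3 → 3 ≤ (C ∩ S).card + ((C ∩ M) \ S).card

lemma IsComplete.mono {C S M M' : Finset V} (h : IsComplete C S M) (hM : M ⊆ M') :
    IsComplete C S M' := fun h₁ h₂ => (h h₁ h₂).trans (Nat.add_le_add_left (Finset.card_le_card
      (Finset.sdiff_subset_sdiff (Finset.inter_subset_inter le_rfl hM) le_rfl)) _)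

variable [Fintype V] {G : SimpleGraph V}

/-- `A` has at most two boundary nodes, at least two nodes, and its proper nonempty subsets have
at least three boundary nodes. -/
structure IsMinimalPart (G : SimpleGraph V) (A : Finset V) : Prop where
  card : 2 ≤ A.card
  boundary_le : (boundary G A).card ≤ 2
  minimal : ∀ X ⊂ A, X.Nonempty → 3 ≤ (boundary G X).card

variable {A B : Finset V}

lemma mem_boundary_or_mem {x y : V} (hx : x ∈ A) (hxy : G.Adj x y) : y ∈ A ∪ boundary G A := by
  rw [Finset.mem_union, mem_boundary]
  by_cases h : y ∈ A
  · exact Or.inl h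
  · exact Or.inr ⟨h, x, hx, hxy⟩

namespace IsMinimalPart

lemma eq_empty_of_boundary (hA : IsMinimalPart G A) {X : Finset V} (hX : X ⊂ A)
    (hb : (boundary G X).card ≤ 2) : X = ∅ := by
  by_contra hne
  have := hA.minimal X hX (Finset.nonempty_iff_ne_empty.2 hne)
  omega

/-- A proper closed subset would have its boundary inside that of `A`, against minimality. -/
lemma linked (hA : IsMinimalPart G A) : Linked G A := by
  intro Y hY hne hcl
  by_contra hn
  refine hne.ne_empty (hA.eq_empty_of_boundary ⟨hY, hn⟩
    ((Finset.card_le_card fun x hx => ?_).trans hA.boundary_le))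
  obtain ⟨hxY, y, hy, hyx⟩ := mem_boundary.1 hx
  exact mem_boundary.2 ⟨fun hxA => hxY (hcl y hy x hxA hyx), y, hY hy, hyx⟩

/-- Suppose deleting at most one node separates the set. By minimality each side that meets `A`
contains two boundary nodes of `A`, while there are only two in all; a side missing `A` is excluded
separately. -/
lemma kLinked (hA : IsMinimalPart G A) : KLinked G 2 (A ∪ boundary G A) := by
  intro S hS Y hY hYne hcl
  set F := boundary G A with hF
  have hFA : ∀ x ∈ F, x ∉ A := fun x hx => (mem_boundary.1 hx).1
  have hclosed : ∀ X ⊆ (A ∪ F) \ S, ClosedIn G ((A ∪ F) \ S) X → A ∩ X = ∅ → X = ∅ := by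
    intro X hX hXc hAX
    have hXA : ∀ x ∈ X, x ∉ A := fun x hx hxA => by
      have : x ∈ A ∩ X := Finset.mem_inter.2 ⟨hxA, hx⟩
      simp [hAX] at this
    have hXS : ∀ x ∈ X, ∀ y ∈ A, G.Adj x y → y ∈ S := by
      intro x hx y hy hxy
      by_contra hyS
      exact hXA y (hXc x hx y (by simp [hy, hyS]) hxy) hy
    by_contra hne
    obtain ⟨x, hx⟩ := Finset.nonempty_iff_ne_empty.2 hne
    have hxm := Finset.mem_sdiff.1 (hX hx)
    have hxF : x ∈ F := (Finset.mem_union.1 hxm.1).resolve_left (hXA x hx)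
    obtain ⟨-, s, hs, hsx⟩ := mem_boundary.1 hxF
    have hsS := hXS x hx s hs hsx.symm
    have hS1 : ∀ y ∈ S, y = s := fun y hy => Finset.card_le_one.1 (by omega) y hy s hsS
    have hcard : (A \ {s}).Nonempty := by
      obtain ⟨t, ht, hts⟩ := Finset.exists_mem_ne hA.card s
      exact ⟨t, by simp [ht, hts]⟩
    -- In `A` the node `x` is adjacent only to `s`, so removing `s` from `A` trades `x` for `s` in
    -- the boundary, which therefore does not grow.
    have hsub : boundary G (A \ {s}) ⊆ insert s (F.erase x) := by
      intro y hy
      obtain ⟨hyA, a, ha, hay⟩ := mem_boundary.1 hy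
      rw [Finset.mem_sdiff, Finset.mem_singleton] at ha hyA
      rw [Finset.mem_insert, Finset.mem_erase]
      by_cases hys : y = s
      · exact Or.inl hys
      · refine Or.inr ⟨?_, mem_boundary.2 ⟨fun h => hyA ⟨h, hys⟩, a, ha.1, hay⟩⟩
        rintro rfl
        exact ha.2 (hS1 a (hXS y hx a ha.1 hay.symm))
    refine hcard.ne_empty (hA.eq_empty_of_boundary
      (Finset.sdiff_ssubset (by simpa using hs) (by simp)) ?_)
    have h1 := Finset.card_le_card hsub
    have h2 := Finset.card_insert_le s (F.erase x)
    have h3 := Finset.card_erase_of_mem hxF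
    have h4 := hA.boundary_le
    have h5 := Finset.card_pos.2 ⟨x, hxF⟩
    rw [← hF] at h4
    omega
  have hbound : ∀ X Z, X ⊆ (A ∪ F) \ S → ClosedIn G ((A ∪ F) \ S) X → Disjoint X Z →
      (A ∩ Z).Nonempty → (A ∩ X).Nonempty → 2 ≤ (F ∩ X).card := by
    intro X Z hX hXc hdis hZ hne
    have h3 := hA.minimal (A ∩ X) (Finset.ssubset_iff_of_subset Finset.inter_subset_left |>.2 (by
      obtain ⟨z, hz⟩ := hZ
      rw [Finset.mem_inter] at hz
      exact ⟨z, hz.1, fun h =>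
        Finset.disjoint_left.1 hdis (Finset.mem_inter.1 h).2 hz.2⟩)) hne
    have hsub : boundary G (A ∩ X) ⊆ S ∪ (F ∩ X) := by
      intro y hy
      obtain ⟨hyn, a, ha, hay⟩ := mem_boundary.1 hy
      rw [Finset.mem_inter] at ha hyn
      rw [Finset.mem_union, Finset.mem_inter]
      by_cases hyS : y ∈ S
      · exact Or.inl hyS
      · have hyT := mem_boundary_or_mem ha.1 hay
        have hyX := hXc a ha.2 y (Finset.mem_sdiff.2 ⟨hyT, hyS⟩) hay
        exact Or.inr ⟨(Finset.mem_union.1 hyT).resolve_left fun h => hyn ⟨h, hyX⟩, hyX⟩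
    have h1 := Finset.card_le_card hsub
    have h2 := Finset.card_union_le S (F ∩ X)
    omega
  have hdis : Disjoint Y (((A ∪ F) \ S) \ Y) := Finset.disjoint_sdiff
  by_cases hAY : A ∩ Y = ∅
  · exact absurd (hclosed Y hY hcl hAY) hYne.ne_empty
  by_cases hAYc : A ∩ (((A ∪ F) \ S) \ Y) = ∅
  · exact Finset.sdiff_eq_empty_iff_subset.1
      (hclosed _ Finset.sdiff_subset hcl.sdiff hAYc)
  rw [← ne_eq, ← Finset.nonempty_iff_ne_empty] at hAY hAYc
  have h1 := hbound Y _ hY hcl hdis hAYc hAY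
  have h2 := hbound _ Y Finset.sdiff_subset hcl.sdiff hdis.symm hAY hAYc
  have h3 : (F ∩ Y).card + (F ∩ (((A ∪ F) \ S) \ Y)).card ≤ F.card := by
    rw [← Finset.card_union_of_disjoint
      (hdis.mono Finset.inter_subset_right Finset.inter_subset_right)]
    exact Finset.card_le_card (Finset.union_subset Finset.inter_subset_left
      Finset.inter_subset_left)
  have h4 := hA.boundary_le
  rw [← hF] at h4
  omega

/-- All neighbours of `z` lie in `A ∪ boundary G A`. So after deleting `z` every component meets
this set, which stays connected without `z`. -/
lemma not_isCutVertex (hA : IsMinimalPart G A) (hG : G.Connected) {z : V} (hz : z ∈ A) :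
    ¬ IsCutVertex G z := by
  rw [isCutVertex_iff, not_not]
  have hno : ∀ X ⊆ Finset.univ \ {z}, ClosedIn G (Finset.univ \ {z}) X →
      X ∩ (A ∪ boundary G A) = ∅ → X = ∅ := by
    intro X hX hXc hXT
    by_contra hne
    refine Finset.notMem_empty z (hXT ▸ Finset.mem_inter.2 ⟨linked_univ hG X (by simp)
      (Finset.nonempty_iff_ne_empty.2 hne) ?_ (Finset.mem_univ z), by simp [hz]⟩)
    intro x hx y _ hxy
    by_cases hyz : y = z
    · have : x ∈ X ∩ (A ∪ boundary G A) :=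
        Finset.mem_inter.2 ⟨hx, mem_boundary_or_mem (hyz ▸ hz) hxy.symm⟩
      simp [hXT] at this
    · exact hXc x hx y (by simp [hyz]) hxy
  intro Y hY hYne hcl
  by_cases hYT : Y ∩ (A ∪ boundary G A) = ∅
  · exact absurd (hno Y hY hcl hYT) hYne.ne_empty
  · have hsub : (A ∪ boundary G A) \ {z} ⊆ Y := by
      refine (hA.kLinked {z} (by simp) (Y ∩ (A ∪ boundary G A)) (fun x hx => ?_)
        (Finset.nonempty_iff_ne_empty.2 hYT) (fun x hx y hy hxy => ?_)).trans
          Finset.inter_subset_left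
      · rw [Finset.mem_inter] at hx
        exact Finset.mem_sdiff.2 ⟨hx.2, (Finset.mem_sdiff.1 (hY hx.1)).2⟩
      · rw [Finset.mem_inter] at hx ⊢
        rw [Finset.mem_sdiff] at hy
        exact ⟨hcl x hx.1 y (Finset.mem_sdiff.2 ⟨Finset.mem_univ y, hy.2⟩) hxy, hy.1⟩
    refine Finset.sdiff_eq_empty_iff_subset.1 (hno _ Finset.sdiff_subset hcl.sdiff ?_)
    refine Finset.eq_empty_of_forall_notMem fun x hx => ?_
    rw [Finset.mem_inter, Finset.mem_sdiff, Finset.mem_sdiff] at hx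
    exact hx.1.2 (hsub (Finset.mem_sdiff.2 ⟨hx.2, hx.1.1.2⟩))

/-- A node of a minimal part lies in no 2-vertex cut of a larger block. -/
lemma not_isTwoVertexCut (hA : IsMinimalPart G A) (hB : KLinked G 2 B)
    (hAB : A ∪ boundary G A ⊂ B) {z q : V} (hz : z ∈ A) : ¬ IsTwoVertexCut G B z q := by
  rw [isTwoVertexCut_iff]
  rintro ⟨hzB, hqB, hzq, hnl⟩
  refine hnl ?_
  set F := boundary G A with hF
  have hmem : ∀ {x}, x ∈ B \ {z, q} ↔ x ∈ B ∧ x ≠ z ∧ x ≠ q := by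
    intro x; simp
  -- a closed set that avoids the part is empty
  have hno : ∀ X ⊆ B \ {z, q}, ClosedIn G (B \ {z, q}) X → X ∩ (A ∪ F) = ∅ → X = ∅ := by
    intro X hX hXc hXT
    by_contra hne
    have hXT' : ∀ x ∈ X, x ∉ A ∪ F := fun x hx h => by
      have : x ∈ X ∩ (A ∪ F) := Finset.mem_inter.2 ⟨hx, h⟩
      simp [hXT] at this
    refine hXT' z (hB {q} (by simp) X (fun x hx => ?_) (Finset.nonempty_iff_ne_empty.2 hne) ?_
      (by simp [hzB, hzq])) (by simp [hz])
    · have := hmem.1 (hX hx)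
      simp [this.1, this.2.2]
    · intro x hx y hy hxy
      rw [Finset.mem_sdiff, Finset.mem_singleton] at hy
      by_cases hyz : y = z
      · exact absurd (mem_boundary_or_mem (hyz ▸ hz) hxy.symm) (hXT' x hx)
      · exact hXc x hx y (hmem.2 ⟨hy.1, hyz, hy.2⟩) hxy
  have hFA : ∀ x ∈ F, x ∉ A := fun x hx => (mem_boundary.1 hx).1
  have hF2 : F.card ≤ 2 := hA.boundary_le
  have hproper : ∀ X ⊆ B \ {z, q}, A ∩ X ⊂ A := fun X hX =>
    Finset.ssubset_iff_of_subset Finset.inter_subset_left |>.2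
      ⟨z, hz, fun h => (hmem.1 (hX (Finset.mem_inter.1 h).2)).2.1 rfl⟩
  have hbd : ∀ X, X ⊆ B \ {z, q} → ClosedIn G (B \ {z, q}) X →
      ∀ x ∈ boundary G (A ∩ X), x = z ∨ (x = q ∧ q ∈ A ∪ F) ∨ x ∈ F ∩ X := by
    intro X hX hXc x hx
    obtain ⟨hxn, a, ha, hax⟩ := mem_boundary.1 hx
    rw [Finset.mem_inter] at ha hxn
    have hxT := mem_boundary_or_mem ha.1 hax
    by_cases hxz : x = z
    · exact Or.inl hxz
    by_cases hxq : x = q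
    · exact Or.inr (Or.inl ⟨hxq, hxq ▸ hxT⟩)
    have hxX := hXc a ha.2 x (hmem.2 ⟨hAB.subset hxT, hxz, hxq⟩) hax
    exact Or.inr (Or.inr (Finset.mem_inter.2
      ⟨(Finset.mem_union.1 hxT).resolve_left fun h => hxn ⟨h, hxX⟩, hxX⟩))
  -- A nonempty side missing `F` would meet `A` in a set with boundary in `{z, q}`. Hence each of
  -- two opposite sides contains exactly one node of `F`.
  have hFX : ∀ X, X ⊆ B \ {z, q} → ClosedIn G (B \ {z, q}) X → F ∩ X = ∅ → X = ∅ := by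
    intro X hX hXc hFX
    have hAX : A ∩ X = ∅ := by
      refine hA.eq_empty_of_boundary (hproper X hX)
        ((Finset.card_le_card (t := {z, q}) fun x hx => ?_).trans Finset.card_le_two)
      rcases hbd X hX hXc x hx with h | h | h
      · simp [h]
      · simp [h.1]
      · simp [hFX] at h
    refine hno X hX hXc ?_
    rw [Finset.inter_comm, Finset.union_inter_distrib_right, hAX, hFX, Finset.empty_union]
  intro Y hY hYne hcl
  have hF1 : 1 ≤ (F ∩ Y).card := by
    rw [Nat.one_le_iff_ne_zero, ne_eq, Finset.card_eq_zero]
    exact fun h => hYne.ne_empty (hFX Y hY hcl h)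
  set Yc := (B \ {z, q}) \ Y with hYc
  have hYcs : Yc ⊆ B \ {z, q} := Finset.sdiff_subset
  by_contra hcon
  have hF1c : 1 ≤ (F ∩ Yc).card := by
    rw [Nat.one_le_iff_ne_zero, ne_eq, Finset.card_eq_zero]
    exact fun h => hcon (Finset.sdiff_eq_empty_iff_subset.1 (hFX Yc hYcs hcl.sdiff h))
  have hdis : Disjoint Y Yc := Finset.disjoint_sdiff
  have hcardF : ((F ∩ Y) ∪ (F ∩ Yc)).card = (F ∩ Y).card + (F ∩ Yc).card :=
    Finset.card_union_of_disjoint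
      (hdis.mono Finset.inter_subset_right Finset.inter_subset_right)
  have hsubF : (F ∩ Y) ∪ (F ∩ Yc) ⊆ F :=
    Finset.union_subset Finset.inter_subset_left Finset.inter_subset_left
  have hleF := Finset.card_le_card hsubF
  have heqF : (F ∩ Y) ∪ (F ∩ Yc) = F := Finset.eq_of_subset_of_card_le hsubF (by omega)
  have hcover : ∀ x ∈ B, x ≠ z → x ≠ q → x ∈ Y ∨ x ∈ Yc := by
    intro x hx hxz hxq
    by_cases h : x ∈ Y
    · exact Or.inl h
    · exact Or.inr (Finset.mem_sdiff.2 ⟨hmem.2 ⟨hx, hxz, hxq⟩, h⟩)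
  -- If `q` lies in `A`, whatever a side contains beyond `A ∪ F` is attached to the rest by a single
  -- node of `F`, which a 2-linked block forbids; so `B` would equal `A ∪ F`.
  by_cases hqA : q ∈ A
  · have hsub : ∀ X, X ⊆ B \ {z, q} → ClosedIn G (B \ {z, q}) X → (F ∩ X).card < 2 →
        X \ A ⊆ F := by
      intro X hX hXc hc x hx
      rw [Finset.mem_sdiff] at hx
      by_contra hxF
      have := hB (F ∩ X) hc (X \ (A ∪ F)) (fun y hy => ?_) ⟨x, by simp [hx, hxF]⟩
        (fun y hy v hv hyv => ?_)
        (Finset.mem_sdiff.2 ⟨hzB, fun h => hFA z (Finset.mem_inter.1 h).1 hz⟩)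
      · exact (hmem.1 (hX (Finset.mem_sdiff.1 this).1)).2.1 rfl
      · rw [Finset.mem_sdiff, Finset.mem_union] at hy
        exact Finset.mem_sdiff.2 ⟨(hmem.1 (hX hy.1)).1, fun h =>
          hy.2 (Or.inr (Finset.mem_inter.1 h).1)⟩
      · rw [Finset.mem_sdiff] at hy hv ⊢
        have hvA : v ∉ A := fun hvA => hy.2 (mem_boundary_or_mem hvA hyv.symm)
        have hvX := hXc y hy.1 v (hmem.2 ⟨hv.1, fun h => hvA (h ▸ hz), fun h => hvA (h ▸ hqA)⟩) hyv
        refine ⟨hvX, fun h => ?_⟩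
        exact hv.2 (Finset.mem_inter.2 ⟨(Finset.mem_union.1 h).resolve_left hvA, hvX⟩)
    refine hAB.2 fun x hx => ?_
    rw [Finset.mem_union]
    by_cases hxA : x ∈ A
    · exact Or.inl hxA
    right
    rcases hcover x hx (fun h => hxA (h ▸ hz)) (fun h => hxA (h ▸ hqA)) with h | h
    · exact hsub Y hY hcl (by omega) (Finset.mem_sdiff.2 ⟨h, hxA⟩)
    · exact hsub Yc hYcs hcl.sdiff (by omega) (Finset.mem_sdiff.2 ⟨h, hxA⟩)
  · have hqT : q ∉ A ∪ F := by
      rw [Finset.mem_union, not_or]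
      refine ⟨hqA, fun hqF => ?_⟩
      rw [← heqF] at hqF
      rcases Finset.mem_union.1 hqF with h | h
      · exact (hmem.1 (hY (Finset.mem_inter.1 h).2)).2.2 rfl
      · exact (hmem.1 (hYcs (Finset.mem_inter.1 h).2)).2.2 rfl
    -- Now `q` is outside `A ∪ F`, so `A ∩ X` has at most the boundary nodes `z` and one node of
    -- `F`, and is empty by minimality. This leaves no place for a second node of `A`.
    have hemp : ∀ X, X ⊆ B \ {z, q} → ClosedIn G (B \ {z, q}) X → (F ∩ X).card ≤ 1 →
        A ∩ X = ∅ := by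
      intro X hX hXc hc
      refine hA.eq_empty_of_boundary (hproper X hX)
        ((Finset.card_le_card (t := insert z (F ∩ X)) fun x hx => ?_).trans
          ((Finset.card_insert_le _ _).trans (by omega)))
      rcases hbd X hX hXc x hx with h | h | h
      · simp [h]
      · exact absurd h.2 hqT
      · exact Finset.mem_insert_of_mem h
    obtain ⟨t, ht, htz⟩ := Finset.exists_mem_ne hA.card z
    rcases hcover t (hAB.subset (by simp [ht])) htz (fun h => hqA (h ▸ ht)) with h | h
    · exact Finset.notMem_empty t
        (hemp Y hY hcl (by omega) ▸ Finset.mem_inter.2 ⟨ht, h⟩)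
    · exact Finset.notMem_empty t
        (hemp Yc hYcs hcl.sdiff (by omega) ▸ Finset.mem_inter.2 ⟨ht, h⟩)

end IsMinimalPart

/-- In a complete placement, every nonempty set without monitors has three boundary nodes. -/
theorem three_le_card_boundary_of_isComplete (hG : G.Connected) {M : Finset V}
    (hM : 3 ≤ M.card ∨ M = Finset.univ) (hlow : lowDegreeNodes G ⊆ M)
    (hblock : ∀ B, IsBiconnectedComponent G B → 3 ≤ B.card → IsComplete B (cutVertices G) M)
    (hpart : ∀ B, IsBiconnectedComponent G B → 3 ≤ B.card → ∃ D, TriconnectedPartition G B D ∧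
      ∀ T ∈ D, 3 ≤ T.card → IsComplete T (separationVertices G B) M)
    {A : Finset V} (hA : A.Nonempty) (hAM : Disjoint A M) : 3 ≤ (boundary G A).card := by
  induction hn : A.card using Nat.strong_induction_on generalizing A with
  | _ n ih =>
  by_contra! hlt
  set F := boundary G A with hF
  have hcard2 : 2 ≤ A.card := by
    by_contra! h
    have h1 : A.card = 1 := by have := Finset.card_pos.2 hA; omega
    obtain ⟨a, rfl⟩ := Finset.card_eq_one.1 h1
    exact Finset.disjoint_left.1 hAM (by simp) (hlow (mem_lowDegreeNodes.2 hlt))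
  have hmin : IsMinimalPart G A := ⟨hcard2, Nat.le_of_lt_succ hlt, fun X hX hXne =>
    ih X.card (hn ▸ Finset.card_lt_card hX) hXne (hAM.mono_left hX.subset) rfl⟩
  have hMA : ∀ x ∈ M, x ∉ A := fun x hx hxA => Finset.disjoint_left.1 hAM hxA hx
  have hFA : ∀ x ∈ F, x ∉ A := fun x hx => (mem_boundary.1 hx).1
  -- Otherwise all monitors lie in `F`: there are at most two of them, and not every node is one.
  have hTne : A ∪ F ≠ Finset.univ := by
    intro hT
    have hMF : M ⊆ F := fun x hx => by
      have : x ∈ A ∪ F := by simp [hT]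
      exact (Finset.mem_union.1 this).resolve_left (hMA x hx)
    rcases hM with h | h
    · have := Finset.card_le_card hMF
      omega
    · obtain ⟨a, ha⟩ := hA
      exact hMA a (by simp [h]) ha
  have hFne : F.Nonempty := by
    rw [Finset.nonempty_iff_ne_empty]
    intro h
    exact hTne (by rw [h, Finset.union_empty, eq_univ_of_boundary_eq_empty hG hA h])
  have hT3 : 3 ≤ (A ∪ F).card := by
    rw [Finset.card_union_of_disjoint (Finset.disjoint_right.2 hFA)]
    have := Finset.card_pos.2 hFne
    omega
  obtain ⟨B, hB, hTB⟩ := exists_isBiconnectedComponent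
    (hA.mono Finset.subset_union_left) hmin.kLinked
  have hB3 : 3 ≤ B.card := hT3.trans (Finset.card_le_card hTB)
  have hAC : ∀ x ∈ A, x ∉ cutVertices G := fun x hx h =>
    hmin.not_isCutVertex hG hx (mem_cutVertices.1 h)
  -- If `A ∪ F` is the whole block, its cut-vertices and monitors all lie in `F`, too few for
  -- completeness; a cut-vertex exists because the block is not the whole network.
  rcases eq_or_ne (A ∪ F) B with heq | hne
  · have hBF : ∀ x ∈ B, x ∉ A → x ∈ F := fun x hx hxA =>
      (Finset.mem_union.1 (heq ▸ hx : x ∈ A ∪ F)).resolve_left hxA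
    have hsub : (B ∩ cutVertices G) ∪ ((B ∩ M) \ cutVertices G) ⊆ F := by
      intro x hx
      simp only [Finset.mem_union, Finset.mem_inter, Finset.mem_sdiff] at hx
      rcases hx with h | h
      · exact hBF x h.1 fun hxA => hAC x hxA h.2
      · exact hBF x h.1.1 (hMA x h.1.2)
    have hle := Finset.card_le_card hsub
    rw [Finset.card_union_of_disjoint (Finset.disjoint_left.2 fun x hx hx' =>
      (Finset.mem_sdiff.1 hx').2 (Finset.mem_inter.1 hx).2)] at hle
    have hpos : 0 < (B ∩ cutVertices G).card := by
      by_contra! h0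
      have hemp := Finset.card_eq_zero.1 (Nat.le_zero.1 h0)
      have hBb : boundary G B = ∅ := by
        refine Finset.eq_empty_of_forall_notMem fun x hx => ?_
        obtain ⟨hxB, b, hb, hbx⟩ := mem_boundary.1 hx
        refine hxB (hB.mem_of_adj (by omega) hb (fun hcut => ?_) hbx)
        exact Finset.notMem_empty b (hemp ▸ Finset.mem_inter.2 ⟨hb, mem_cutVertices.2 hcut⟩)
      exact hTne (heq.trans (eq_univ_of_boundary_eq_empty hG (Finset.card_pos.1 (by omega)) hBb))
    have := hblock B hB hB3 hpos (by omega)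
    omega
  -- Otherwise `F` is a 2-vertex cut of `B`, and `A ∪ F` is a triconnected component with two
  -- separation vertices and no further monitors.
  · have hss : A ∪ F ⊂ B := Finset.ssubset_iff_subset_ne.2 ⟨hTB, hne⟩
    have hclA : ClosedIn G (B \ F) A := by
      intro x hx y hy hxy
      exact (Finset.mem_union.1 (mem_boundary_or_mem hx hxy)).resolve_right
        (Finset.mem_sdiff.1 hy).2
    have hAsub : A ⊆ B \ F := fun x hx =>
      Finset.mem_sdiff.2 ⟨hTB (Finset.mem_union_left _ hx), fun h => hFA x h hx⟩
    have hnl : ¬ Linked G (B \ F) := by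
      intro hl
      refine hss.2 fun x hx => ?_
      by_cases hxF : x ∈ F
      · exact Finset.mem_union_right _ hxF
      · exact Finset.mem_union_left _ (hl A hAsub hA hclA (Finset.mem_sdiff.2 ⟨hx, hxF⟩))
    have hF2 : F.card = 2 := by
      by_contra h
      exact hnl (hB.kLinked F (by omega))
    have hAS : Disjoint A (separationVertices G B) := by
      refine Finset.disjoint_left.2 fun x hx hxS => ?_
      rcases (mem_separationVertices.1 hxS).2 with h | ⟨u, h⟩
      · exact hmin.not_isCutVertex hG hx h
      · exact hmin.not_isTwoVertexCut hB.kLinked hss hx h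
    have hFS : F ⊆ separationVertices G B := by
      obtain ⟨x, y, hxy, hFxy⟩ := Finset.card_eq_two.1 hF2
      have hxF : x ∈ F := by rw [hFxy]; simp
      have hyF : y ∈ F := by rw [hFxy]; simp
      have hxB : x ∈ B := hTB (Finset.mem_union_right _ hxF)
      have hyB : y ∈ B := hTB (Finset.mem_union_right _ hyF)
      rw [hFxy] at hnl
      intro u hu
      rw [hFxy, Finset.mem_insert, Finset.mem_singleton] at hu
      rw [mem_separationVertices]
      rcases hu with rfl | rfl
      · exact ⟨hxB, Or.inr ⟨y, isTwoVertexCut_iff.2 ⟨hxB, hyB, hxy, hnl⟩⟩⟩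
      · exact ⟨hyB, Or.inr ⟨x, isTwoVertexCut_iff.2 ⟨hyB, hxB, hxy.symm,
          by rwa [Finset.pair_comm]⟩⟩⟩
    obtain ⟨D, hD, hDT⟩ := hpart B hB hB3
    have hTD := hD.mem_of_boundary (.refl G B _) hA hmin.linked hAS hF2 hTB
    have hTS : (A ∪ F) ∩ separationVertices G B = F := by
      ext x
      have h1 := @hFS x
      have h2 : x ∈ A → x ∉ separationVertices G B := fun h => Finset.disjoint_left.1 hAS h
      simp only [Finset.mem_inter, Finset.mem_union]
      tauto
    have hempty : ((A ∪ F) ∩ M) \ separationVertices G B = ∅ := by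
      ext x
      have h1 := @hFS x
      have h2 := hMA x
      simp only [Finset.mem_inter, Finset.mem_union, Finset.mem_sdiff, Finset.notMem_empty,
        iff_false]
      tauto
    have := hDT _ hTD hT3
    rw [IsComplete, hTS, hempty, hF2, Finset.card_empty] at this
    have := this (by norm_num) (by norm_num)
    omega

end Sufficiency

/-! ## Runs of the algorithm -/

section Runs

variable {α σ : Type*} {step : α → σ → σ → Prop}

lemma ForEach.exists (h : ∀ x s, ∃ s', step x s s') (l : List α) (s : σ) :
    ∃ s', ForEach step l s s' := by
  induction l generalizing s with
  | nil => exact ⟨s, .nil s⟩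
  | cons x l ih =>
    obtain ⟨s₁, h₁⟩ := h x s
    obtain ⟨s₂, h₂⟩ := ih s₁
    exact ⟨s₂, .cons x l s s₁ s₂ h₁ h₂⟩

variable {V : Type*}

lemma ForEach.subset {step : α → Finset V → Finset V → Prop}
    (h : ∀ x M M', step x M M' → M ⊆ M') {l : List α} {M M' : Finset V}
    (hl : ForEach step l M M') : M ⊆ M' := by
  induction hl with
  | nil => exact le_rfl
  | cons x l M M₁ M₂ hx _ ih => exact (h x M M₁ hx).trans ih

/-- A monotone property that every step establishes holds in the end for all entries. -/
lemma ForEach.forall_mem {step : α → Finset V → Finset V → Prop}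
    (h : ∀ x M M', step x M M' → M ⊆ M') {P : α → Finset V → Prop}
    (hP : ∀ x M M', M ⊆ M' → P x M → P x M') {l : List α} {M M' : Finset V}
    (hl : ForEach step l M M') (hstep : ∀ x ∈ l, ∀ M M', step x M M' → P x M') :
    ∀ x ∈ l, P x M' := by
  induction hl with
  | nil => simp
  | cons x l M M₁ M₂ hx hl ih =>
    intro y hy
    rcases List.mem_cons.1 hy with rfl | hy
    · exact hP y M₁ M₂ (hl.subset h) (hstep y (by simp) M M₁ hx)
    · exact ih (fun z hz => hstep z (by simp [hz])) y hy

variable [DecidableEq V]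

lemma AddMonitors.exists (A : Finset V) (k : ℕ) (M : Finset V) : ∃ M', AddMonitors A k M M' := by
  obtain ⟨N, hN, hc⟩ := Finset.exists_subset_card_eq (min_le_right k (A \ M).card)
  exact ⟨M ∪ N, N, hN, hc, rfl⟩

lemma AddMonitors.subset {A : Finset V} {k : ℕ} {M M' : Finset V} (h : AddMonitors A k M M') :
    M ⊆ M' := by
  obtain ⟨N, -, -, rfl⟩ := h
  exact Finset.subset_union_left

lemma CompleteComponent.exists (C S M : Finset V) : ∃ M', CompleteComponent C S M M' := by
  unfold CompleteComponent
  split_ifs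
  · exact AddMonitors.exists _ _ _
  · exact ⟨M, rfl⟩

lemma CompleteComponent.subset {C S M M' : Finset V} (h : CompleteComponent C S M M') :
    M ⊆ M' := by
  unfold CompleteComponent at h
  split_ifs at h
  · exact h.subset
  · exact h.ge

lemma inter_sdiff_eq (C S M : Finset V) : (C ∩ M) \ S = M ∩ (C \ S) := by
  ext x; simp only [Finset.mem_sdiff, Finset.mem_inter]; tauto

/-- The minimum in `AddMonitors` is never a restriction here, since `C` has at least three nodes. -/
lemma CompleteComponent.isComplete {C S M M' : Finset V} (h : CompleteComponent C S M M')
    (hC : 3 ≤ C.card) : IsComplete C S M' := by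
  intro h₁ h₂
  unfold CompleteComponent at h
  split_ifs at h with hif
  · obtain ⟨N, hN, hNc, rfl⟩ := h
    rw [inter_sdiff_eq] at hNc hif ⊢
    have h3 : (C ∩ S).card + (C \ S).card = C.card := Finset.card_inter_add_card_sdiff C S
    have h4 : ((C \ S) ∩ M).card + ((C \ S) \ M).card = (C \ S).card :=
      Finset.card_inter_add_card_sdiff _ M
    rw [Finset.inter_comm] at h4
    have h5 : (M ∩ (C \ S)).card + N.card ≤ ((M ∪ N) ∩ (C \ S)).card := by
      rw [← Finset.card_union_of_disjoint]
      · refine Finset.card_le_card fun x hx => ?_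
        rcases Finset.mem_union.1 hx with hx | hx
        · exact Finset.mem_inter.2 ⟨Finset.mem_union_left _ (Finset.mem_inter.1 hx).1,
            (Finset.mem_inter.1 hx).2⟩
        · exact Finset.mem_inter.2 ⟨Finset.mem_union_right _ hx, (Finset.mem_sdiff.1 (hN hx)).1⟩
      · exact Finset.disjoint_left.2 fun x hx hx' =>
          (Finset.mem_sdiff.1 (hN hx')).2 (Finset.mem_inter.1 hx).1
    omega
  · subst h
    by_contra hcon
    exact hif ⟨h₁, h₂, by omega⟩

variable {G : SimpleGraph V}

lemma TriconnectedStep.exists (G : SimpleGraph V) (B T M : Finset V) :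
    ∃ M', TriconnectedStep G B T M M' := by
  unfold TriconnectedStep
  split_ifs
  · exact CompleteComponent.exists _ _ _
  · exact ⟨M, rfl⟩

lemma TriconnectedStep.subset {B T M M' : Finset V} (h : TriconnectedStep G B T M M') :
    M ⊆ M' := by
  unfold TriconnectedStep at h
  split_ifs at h
  · exact h.subset
  · exact h.ge

variable [Fintype V]

lemma BiconnectedStep.subset {B M M' : Finset V} (h : BiconnectedStep G B M M') : M ⊆ M' := by
  unfold BiconnectedStep at h
  split_ifs at h
  · obtain ⟨l, M₁, -, hl, hc⟩ := h
    exact (hl.subset fun T M M' => TriconnectedStep.subset).trans hc.subset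
  · exact h.ge

lemma BiconnectedStep.isComplete {B M M' : Finset V} (h : BiconnectedStep G B M M')
    (hB : 3 ≤ B.card) : IsComplete B (cutVertices G) M' ∧ ∃ D, TriconnectedPartition G B D ∧
      ∀ T ∈ D, 3 ≤ T.card → IsComplete T (separationVertices G B) M' := by
  unfold BiconnectedStep at h
  rw [if_pos hB] at h
  obtain ⟨l, M₁, hD, hl, hc⟩ := h
  refine ⟨hc.isComplete hB, l, hD, fun T hT => ?_⟩
  have := hl.forall_mem (P := fun T M => 3 ≤ T.card → IsComplete T (separationVertices G B) M)
    (fun T M M' => TriconnectedStep.subset) (fun T M M' hM h hT => (h hT).mono hM) (by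
      intro T _ M M' h hT
      unfold TriconnectedStep at h
      rw [if_pos hT] at h
      exact h.isComplete hT) T (by simpa using hT)
  exact fun hT => (this hT).mono hc.subset

lemma exists_isMMPOutput (G : SimpleGraph V) : ∃ M, IsMMPOutput G M := by
  classical
  have hstep : ∀ (l : List (Finset V)), (∀ B ∈ l, IsBiconnectedComponent G B) →
      ∀ M, ∃ M', ForEach (BiconnectedStep G) l M M' := by
    intro l hl
    induction l with
    | nil => exact fun M => ⟨M, .nil M⟩
    | cons B l ih =>
      intro M
      have hB := hl B (by simp)
      obtain ⟨M₁, h₁⟩ : ∃ M₁, BiconnectedStep G B M M₁ := by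
        unfold BiconnectedStep
        split_ifs with h3
        · obtain ⟨D, hD⟩ := exists_triconnectedPartition G B (Finset.card_pos.1 (by omega))
            hB.kLinked
          obtain ⟨M₁, h₁⟩ := ForEach.exists (TriconnectedStep.exists G B) D.toList M
          obtain ⟨M₂, h₂⟩ := CompleteComponent.exists B (cutVertices G) M₁
          exact ⟨M₂, D.toList, M₁, by rwa [Multiset.coe_toList], h₁, h₂⟩
        · exact ⟨M, rfl⟩
      obtain ⟨M₂, h₂⟩ := ih (fun B hB => hl B (by simp [hB])) M₁
      exact ⟨M₂, .cons B l M M₁ M₂ h₁ h₂⟩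
  obtain ⟨M₁, h₁⟩ := hstep (Finset.univ.filter (IsBiconnectedComponent G)).toList (by simp)
    (lowDegreeNodes G)
  by_cases h3 : M₁.card < 3
  · obtain ⟨M, hM⟩ := AddMonitors.exists Finset.univ (3 - M₁.card) M₁
    exact ⟨M, _, M₁, Finset.nodup_toList _, by simp, h₁, by rwa [if_pos h3]⟩
  · exact ⟨M₁, _, M₁, Finset.nodup_toList _, by simp, h₁, by rw [if_neg h3]⟩

lemma IsMMPOutput.identifiesAllLinks (hG : G.Connected) {M : Finset V} (h : IsMMPOutput G M) :
    IdentifiesAllLinks G M := by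
  obtain ⟨l, M₁, -, hl, hrun, hfin⟩ := h
  have hM₁M : M₁ ⊆ M := by
    split_ifs at hfin
    · exact hfin.subset
    · exact hfin.ge
  have hall := hrun.forall_mem (P := fun B M => 3 ≤ B.card → IsComplete B (cutVertices G) M ∧
      ∃ D, TriconnectedPartition G B D ∧
        ∀ T ∈ D, 3 ≤ T.card → IsComplete T (separationVertices G B) M)
    (fun B M M' => BiconnectedStep.subset)
    (by
      intro B M M' hM h hB
      obtain ⟨h₁, D, hD, h₂⟩ := h hB
      exact ⟨h₁.mono hM, D, hD, fun T hT hT3 => (h₂ T hT hT3).mono hM⟩)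
    (fun B _ M M' h => h.isComplete)
  refine identifiesAllLinks_of_boundary fun A hA hAM =>
    three_le_card_boundary_of_isComplete hG (M := M) ?_ ?_ ?_ ?_ hA hAM
  · split_ifs at hfin with h3
    · obtain ⟨N, hN, hNc, rfl⟩ := hfin
      have hdis : Disjoint M₁ N := Finset.disjoint_left.2 fun x hx hx' =>
        (Finset.mem_sdiff.1 (hN hx')).2 hx
      rw [Finset.card_union_of_disjoint hdis]
      by_cases hle : 3 - M₁.card ≤ (Finset.univ \ M₁).card
      · left; omega
      · right
        have : N = Finset.univ \ M₁ := Finset.eq_of_subset_of_card_le hN (by omega)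
        rw [this]; simp
    · left; rw [hfin]; omega
  · exact (hrun.subset fun B M M' => BiconnectedStep.subset).trans hM₁M
  · exact fun B hB hB3 => (hall B ((hl B).2 hB) hB3).1.mono hM₁M
  · intro B hB hB3
    obtain ⟨-, D, hD, hDT⟩ := hall B ((hl B).2 hB) hB3
    exact ⟨D, hD, fun T hT hT3 => (hDT T hT hT3).mono hM₁M⟩

end Runs

/-! ## Optimality -/

section Optimality

variable {V : Type*} [DecidableEq V]

/-- Exchange: monitors of `M''` inside `X` can be replaced by those of `N`. -/
lemma exists_exchange {M M'' N X : Finset V} (hM : M ⊆ M'') (hN : N ⊆ X \ M)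
    (hc : (M ∩ X).card + N.card ≤ (M'' ∩ X).card) :
    ∃ M₀, M ∪ N ⊆ M₀ ∧ M₀.card = M''.card ∧
      ∀ Z, X ⊆ Z ∨ Disjoint X Z → (M₀ ∩ Z).card = (M'' ∩ Z).card := by
  have hle : ((M ∪ N) ∩ X).card ≤ (M'' ∩ X).card := by
    refine (Finset.card_le_card ?_).trans ((Finset.card_union_le (M ∩ X) N).trans hc)
    intro x hx
    rw [Finset.mem_inter, Finset.mem_union] at hx
    rw [Finset.mem_union, Finset.mem_inter]
    tauto
  -- The new content `R` of `X` contains the required monitors and is as large as the old content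
  -- `M'' ∩ X`.
  obtain ⟨R, hR, hRX, hRc⟩ := Finset.exists_subsuperset_card_eq
    (Finset.inter_subset_right : (M ∪ N) ∩ X ⊆ X) hle
    (Finset.card_le_card Finset.inter_subset_right)
  have hcount : ∀ Z, X ⊆ Z ∨ Disjoint X Z → (((M'' \ X) ∪ R) ∩ Z).card = (M'' ∩ Z).card := by
    rintro Z (hZ | hZ)
    · have h1 : ((M'' \ X) ∪ R) ∩ Z = ((M'' ∩ Z) \ X) ∪ R := by
        ext x
        have h2 := @hRX x
        have h3 := @hZ x
        simp only [Finset.mem_inter, Finset.mem_union, Finset.mem_sdiff]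
        tauto
      rw [h1, Finset.card_union_of_disjoint (Finset.disjoint_left.2 fun x hx hx' =>
        (Finset.mem_sdiff.1 hx).2 (hRX hx')), hRc,
        ← Finset.card_inter_add_card_sdiff (M'' ∩ Z) X, Finset.inter_assoc,
        Finset.inter_eq_right.2 hZ, add_comm]
    · congr 1
      ext x
      have h2 := @hRX x
      have h3 : x ∈ X → x ∉ Z := fun h => Finset.disjoint_left.1 hZ h
      simp only [Finset.mem_inter, Finset.mem_union, Finset.mem_sdiff]
      tauto
  refine ⟨(M'' \ X) ∪ R, fun x hx => ?_, ?_, hcount⟩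
  · rw [Finset.mem_union, Finset.mem_sdiff]
    by_cases hxX : x ∈ X
    · exact Or.inr (hR (Finset.mem_inter.2 ⟨hx, hxX⟩))
    · refine Or.inl ⟨(Finset.mem_union.1 hx).elim (fun h => hM h) fun h => ?_, hxX⟩
      exact absurd (Finset.mem_sdiff.1 (hN h)).1 hxX
  -- This set contains both placements, so counting inside it compares their sizes.
  · have := hcount (X ∪ (M'' ∪ R)) (Or.inl Finset.subset_union_left)
    rwa [Finset.inter_eq_left.2, Finset.inter_eq_left.2] at this
    · exact Finset.subset_union_left.trans Finset.subset_union_right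
    · exact Finset.union_subset
        (Finset.sdiff_subset.trans (Finset.subset_union_left.trans Finset.subset_union_right))
        (Finset.subset_union_right.trans Finset.subset_union_right)

/-- If `C` has at least three nodes, then at least three of them are in `S` or monitors. -/
def MeetsDemand (C S M : Finset V) : Prop :=
  3 ≤ C.card → 3 ≤ (C ∩ S).card + (M ∩ (C \ S)).card

/-- A step keeps the monitors inside a placement of the same size that meets the other demands. -/
lemma CompleteComponent.exists_superset {C S M M' M'' : Finset V}
    (h : CompleteComponent C S M M') (hC : 3 ≤ C.card) (hM : M ⊆ M'')
    (hd : MeetsDemand C S M'') :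
    ∃ M₀, M' ⊆ M₀ ∧ M₀.card = M''.card ∧
      ∀ Z, C \ S ⊆ Z ∨ Disjoint (C \ S) Z → (M₀ ∩ Z).card = (M'' ∩ Z).card := by
  unfold CompleteComponent at h
  split_ifs at h with hif
  · obtain ⟨N, hN, hNc, rfl⟩ := h
    refine exists_exchange hM hN ?_
    rw [inter_sdiff_eq] at hNc hif
    have := hd hC
    omega
  · exact ⟨M'', h ▸ hM, rfl, fun _ _ => rfl⟩

/-- The demands of a block and of all triconnected components in its partitions. -/
def MeetsBlockDemands [Fintype V] (G : SimpleGraph V) (B M : Finset V) : Prop :=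
  MeetsDemand B (cutVertices G) M ∧ ∀ D, TriconnectedPartition G B D → ∀ T ∈ D,
    MeetsDemand T (separationVertices G B) M

variable [Fintype V] {G : SimpleGraph V}

/-- Exchange regions of triconnected components are nested in the region of their block, so
exchanging there preserves the count relevant to the block. -/
lemma sdiff_separationVertices_subset {B T : Finset V} (hT : T ⊆ B) :
    T \ separationVertices G B ⊆ B \ cutVertices G := by
  intro x hx
  rw [Finset.mem_sdiff] at hx ⊢
  refine ⟨hT hx.1, fun h => hx.2 (mem_separationVertices.2 ⟨hT hx.1, Or.inl ?_⟩)⟩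
  exact mem_cutVertices.1 h

/-- The demands of a block count only monitors inside `B \ cutVertices G`. -/
lemma MeetsBlockDemands.congr {B M M' : Finset V} (h : MeetsBlockDemands G B M)
    (hM : ∀ Z ⊆ B \ cutVertices G, (M' ∩ Z).card = (M ∩ Z).card) : MeetsBlockDemands G B M' := by
  refine ⟨fun h3 => ?_, fun D hD T hT h3 => ?_⟩
  · rw [hM _ le_rfl]; exact h.1 h3
  · rw [hM _ (sdiff_separationVertices_subset (hD.subset T hT))]; exact h.2 D hD T hT h3

/-- A node that is not a separation vertex lies in at most one entry of the list, so the exchange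
regions are disjoint and serving one component does not disturb the demands of the others. -/
lemma ForEach.exists_superset_of_triconnectedStep {B : Finset V} {l : List (Finset V)}
    {M M' M'' : Finset V} (hl : ForEach (TriconnectedStep G B) l M M')
    (hsub : ∀ T ∈ l, T ⊆ B)
    (hcount : ∀ v ∉ separationVertices G B, l.countP (fun T => v ∈ T) ≤ 1)
    (hM : M ⊆ M'') (hd : ∀ T ∈ l, MeetsDemand T (separationVertices G B) M'') :
    ∃ M₀, M' ⊆ M₀ ∧ M₀.card = M''.card ∧
      ∀ Z, B \ cutVertices G ⊆ Z ∨ Disjoint (B \ cutVertices G) Z →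
        (M₀ ∩ Z).card = (M'' ∩ Z).card := by
  induction hl generalizing M'' with
  | nil => exact ⟨M'', hM, rfl, fun _ _ => rfl⟩
  | cons T l M M₁ M₂ hT hl ih =>
    have hTB := sdiff_separationVertices_subset (G := G) (hsub T (by simp))
    obtain ⟨M₀, hM₀, hc₀, hZ₀⟩ : ∃ M₀, M₁ ⊆ M₀ ∧ M₀.card = M''.card ∧
        ∀ Z, T \ separationVertices G B ⊆ Z ∨ Disjoint (T \ separationVertices G B) Z →
          (M₀ ∩ Z).card = (M'' ∩ Z).card := by
      unfold TriconnectedStep at hT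
      split_ifs at hT with h3
      · exact hT.exists_superset h3 hM (hd T (by simp))
      · exact ⟨M'', hT ▸ hM, rfl, fun _ _ => rfl⟩
    obtain ⟨M₃, hM₃, hc₃, hZ₃⟩ := ih (fun T' hT' => hsub T' (by simp [hT']))
      (fun v hv => by
        have := hcount v hv
        rw [List.countP_cons] at this
        omega) hM₀
      (fun T' hT' h3 => by
        rw [hZ₀ _ (Or.inr (Finset.disjoint_left.2 fun x hx hx' => ?_))]
        · exact hd T' (by simp [hT']) h3
        · rw [Finset.mem_sdiff] at hx hx'
          have := hcount x hx.2
          rw [List.countP_cons_of_pos (by simpa using hx.1)] at this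
          have h0 : l.countP (fun T => x ∈ T) = 0 := by omega
          rw [List.countP_eq_zero] at h0
          exact h0 T' hT' (by simpa using hx'.1))
    refine ⟨M₃, hM₃, hc₃.trans hc₀, fun Z hZ => (hZ₃ Z hZ).trans (hZ₀ Z ?_)⟩
    rcases hZ with h | h
    · exact Or.inl (hTB.trans h)
    · exact Or.inr (h.mono_left hTB)

lemma BiconnectedStep.exists_superset {B M M' M'' : Finset V} (h : BiconnectedStep G B M M')
    (hM : M ⊆ M'') (hd : MeetsBlockDemands G B M'') :
    ∃ M₀, M' ⊆ M₀ ∧ M₀.card = M''.card ∧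
      ∀ Z, Disjoint (B \ cutVertices G) Z → (M₀ ∩ Z).card = (M'' ∩ Z).card := by
  unfold BiconnectedStep at h
  split_ifs at h with h3
  · obtain ⟨l, M₁, hD, hl, hc⟩ := h
    obtain ⟨M₀, hM₀, hc₀, hZ₀⟩ := hl.exists_superset_of_triconnectedStep
      (fun T hT => hD.subset T (by simpa using hT))
      (fun v hv => by simpa using hD.countP_le_one (.refl G B _) hv) hM
      (fun T hT => hd.2 _ hD T (by simpa using hT))
    obtain ⟨M₂, hM₂, hc₂, hZ₂⟩ := hc.exists_superset h3 hM₀ (fun h3 => by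
      rw [hZ₀ _ (Or.inl le_rfl)]; exact hd.1 h3)
    exact ⟨M₂, hM₂, hc₂.trans hc₀, fun Z hZ => (hZ₂ Z (Or.inr hZ)).trans (hZ₀ Z (Or.inr hZ))⟩
  · exact ⟨M'', h ▸ hM, rfl, fun _ _ => rfl⟩

/-- By `IsBiconnectedComponent.eq_of_mem` the exchange regions of distinct blocks are disjoint, so
demands still to be served survive each exchange. -/
lemma ForEach.exists_superset_of_biconnectedStep {l : List (Finset V)} {M M' M'' : Finset V}
    (hl : ForEach (BiconnectedStep G) l M M') (hnd : l.Nodup)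
    (hB : ∀ B ∈ l, IsBiconnectedComponent G B) (hM : M ⊆ M'')
    (hd : ∀ B ∈ l, 3 ≤ B.card → MeetsBlockDemands G B M'') :
    ∃ M₀, M' ⊆ M₀ ∧ M₀.card = M''.card := by
  induction hl generalizing M'' with
  | nil => exact ⟨M'', hM, rfl⟩
  | cons B l M M₁ M₂ h hl ih =>
    rw [List.nodup_cons] at hnd
    by_cases h3 : 3 ≤ B.card
    · obtain ⟨M₀, hM₀, hc₀, hZ₀⟩ := h.exists_superset hM (hd B (by simp) h3)
      obtain ⟨M₃, hM₃, hc₃⟩ := ih hnd.2 (fun B' hB' => hB B' (by simp [hB'])) hM₀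
        (fun B' hB' h3' => (hd B' (by simp [hB']) h3').congr fun Z hZ => hZ₀ Z <|
          Finset.disjoint_left.2 fun x hx hx' => by
            have hx'' := hZ hx'
            rw [Finset.mem_sdiff, mem_cutVertices] at hx hx''
            have := (hB B (by simp)).eq_of_mem (by omega) (hB B' (by simp [hB'])) (by omega) hx.1
              hx''.1 hx.2
            exact hnd.1 (this ▸ hB'))
      exact ⟨M₃, hM₃, hc₃.trans hc₀⟩
    · unfold BiconnectedStep at h
      rw [if_neg h3] at h
      exact ih hnd.2 (fun B' hB' => hB B' (by simp [hB'])) (h ▸ hM)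
        fun B' hB' => hd B' (by simp [hB'])

/-- Deleting the separating nodes from a component leaves a set whose boundary consists of
separating nodes of that component, so `IdentifiesAllLinks.three_le_card_add` applies. -/
lemma IdentifiesAllLinks.meetsBlockDemands (hG : G.Connected) (hV : 2 ≤ Fintype.card V)
    {M : Finset V} (hM : IdentifiesAllLinks G M) {B : Finset V} (hB : IsBiconnectedComponent G B)
    (hB3 : 3 ≤ B.card) : MeetsBlockDemands G B M := by
  refine ⟨fun h3 => hM.three_le_card_add hG hV (hB.boundary_subset (by omega)) ?_,
    fun D hD T hT h3 => hM.three_le_card_add hG hV (fun x hx => ?_) ?_⟩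
  · rwa [Finset.card_inter_add_card_sdiff]
  · obtain ⟨hx, v, hv, hvx⟩ := mem_boundary.1 hx
    rw [Finset.mem_sdiff] at hv hx
    have hTB := hD.subset T hT
    have hvC : ¬ IsCutVertex G v := fun h => hv.2 (mem_separationVertices.2 ⟨hTB hv.1, Or.inl h⟩)
    have hxB := hB.mem_of_adj (by omega) (hTB hv.1) hvC hvx
    have hxT := hD.mem_of_adj (.refl G B _) hT hv.1 hv.2 hxB hvx
    exact Finset.mem_inter.2 ⟨hxT, by_contra fun h => hx ⟨hxT, h⟩⟩
  · rwa [Finset.card_inter_add_card_sdiff]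

lemma IdentifiesAllLinks.lowDegreeNodes_subset (hG : G.Connected) (hV : 2 ≤ Fintype.card V)
    {M : Finset V} (hM : IdentifiesAllLinks G M) : lowDegreeNodes G ⊆ M := by
  intro v hv
  by_contra hvM
  have := hM.three_le_card_boundary hG hV (A := {v}) (by simp) (by simpa using hvM)
  have := mem_lowDegreeNodes.1 hv
  omega

lemma IsMMPOutput.card_le (hG : G.Connected) (hV : 2 ≤ Fintype.card V) {M M' : Finset V}
    (h : IsMMPOutput G M) (hM' : IdentifiesAllLinks G M') : M.card ≤ M'.card := by
  obtain ⟨l, M₁, hnd, hl, hrun, hfin⟩ := h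
  have hlow := hM'.lowDegreeNodes_subset hG hV
  split_ifs at hfin with h3
  · obtain ⟨N, hN, hNc, rfl⟩ := hfin
    have hle : (M₁ ∪ N).card ≤ min 3 (Fintype.card V) := by
      refine le_min ?_ (Finset.card_le_univ _)
      have := Finset.card_union_le M₁ N
      omega
    refine hle.trans ?_
    -- If the final filling takes place, the output has at most three monitors. With three or more
    -- nodes the criterion forces three; with two, all degrees are below three and every node is
    -- forced.
    by_cases hV3 : 3 ≤ Fintype.card V
    · have := hM'.three_le_card_add hG hV (X := Finset.univ) (K := ∅)
        (fun x hx => by simp [mem_boundary] at hx) (by simpa using hV3)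
      rw [Finset.inter_univ, Finset.card_empty] at this
      omega
    · have huniv : M' = Finset.univ := by
        refine Finset.eq_univ_iff_forall.2 fun v => hlow (mem_lowDegreeNodes.2 ?_)
        have := Finset.card_le_univ (boundary G {v})
        omega
      rw [huniv, Finset.card_univ]
      omega
  · subst hfin
    obtain ⟨M₀, hM₀, hc₀⟩ := hrun.exists_superset_of_biconnectedStep hnd
      (fun B hB => (hl B).1 hB) hlow
      (fun B hB hB3 => hM'.meetsBlockDemands hG hV ((hl B).1 hB) hB3)
    exact hc₀ ▸ Finset.card_le_card hM₀

end Optimality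

end MonitorPlacement

theorem theorem1 {V : Type*} [Fintype V] [DecidableEq V] (G : SimpleGraph V)
    (hG : G.Connected) (hV : 2 ≤ Fintype.card V) :
    (∃ M : Finset V, MonitorPlacement.IsMMPOutput G M) ∧
      ∀ M : Finset V, MonitorPlacement.IsMMPOutput G M →
        MonitorPlacement.IdentifiesAllLinks G M ∧
          ∀ M' : Finset V, MonitorPlacement.IdentifiesAllLinks G M' → M.card ≤ M'.card :=
  ⟨MonitorPlacement.exists_isMMPOutput G, fun _ hM =>
    ⟨hM.identifiesAllLinks hG, fun _ hM' => hM.card_le hG hV hM'⟩⟩
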